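/- Let $n=n_0+n_1$ with integers $n_0\ge 0$, $n_1\ge 2$; let $0<q<1$, $k\in\mathbb Z_{\ge 0}$ and let $t>0$ with $t^2=q^k$. Put $(x)_\infty=\prod_{i\ge 0}(1-xq^i)$, $(x)_m=\prod_{i=0}^{m-1}(1-xq^i)$, and write $(x,y,\dots)_m=(x)_m(y)_m\cdots$ (also for $m=\infty$). For nonzero parameters $a_1,\dots,a_4$ let $$\Delta_+(x)=\prod_{1\le i<j\le n}\frac{(x_ix_j,x_ix_j^{-1},x_i^{-1}x_j,x_i^{-1}x_j^{-1})_\infty}{(t^2x_ix_j,t^2x_ix_j^{-1},t^2x_i^{-1}x_j,t^2x_i^{-1}x_j^{-1})_\infty}\prod_{i=1}^n\frac{(x_i^2,x_i^{-2})_\infty}{\prod_{r=1}^4(a_rx_i,a_rx_i^{-1})_\infty},$$ $$\Delta(x)=\Delta_+(x)\prod_{1\le i<j\le n}\frac{(x_ix_j-t^2)(x_ix_j^{-1}-t^2)}{(x_ix_j-1)(x_ix_j^{-1}-1)}\prod_{i=1}^n\frac{(x_i-a_3)(x_i-a_4)}{x_i^2-1},$$ $$\chi_1(x)=\prod_{i=n_0+1}^n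 x_i^{\,n-i+1}(1-a_3^{-1}x_i^{-1})(1-a_4^{-1}x_i^{-1})\prod_{n_0+1\le i<j\le n}(1-t^{-2}x_i^{-1}x_j)(1-t^{-2}x_i^{-1}x_j^{-1}),$$ and let $\chi_1^\dagger$ be obtained from $\chi_1$ by replacing $x_i,t,a_3,a_4$ by their inverses. Let $a,b\in\mathbb C$ with $0<|a|,|b|<1$, let $\epsilon_0\in\mathbb C$ with $q^{1/2}<|\epsilon_0|<q^{-1/2}$, and put $\epsilon_r=\epsilon_0q^r$ for $r\ge 0$, $x_{r,s}=\epsilon_r^{-1}q^{s+1/2}$, $y_{r,s}=\epsilon_rbq^{s+1/2}$, $z_s=-aq^{s+1/2}$ for $s\in\mathbb Z_{\ge0}$. Assume that $\epsilon_0$ is generic: for each $r$ all the points $x_{r,s},y_{r,s},z_s$ and their reciprocals are pairwise distinct and do not lie on the unit circle. For each $r$ let $C_r$ be a closed piecewise $C^1$ curve that encloses (has winding number $1$ about) the origin and all $x_{r,s},y_{r,s},z_s$, and excludes (has winding number $0$ about) all $x_{r,s}^{-1},y_{r,s}^{-1},z_s^{-1}$. Consider, with $\epsilon=\epsilon_r$,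 Case I: $(a_1,a_2,a_3,a_4)=(\epsilon^{-1}q^{1/2},-aq^{1/2},\epsilon bq^{1/2},-q^{1/2})$; Case II: $(a_1,a_2,a_3,a_4)=(\epsilon bq^{1/2},-aq^{1/2},\epsilon^{-1}q^{1/2},-q^{1/2})$. Then in both cases the integrals below exist, the multiple series converge absolutely, and: Case I: $$\lim_{r\to\infty}(-\epsilon_r^{-1}q,-\epsilon_r^{-1}aq)_\infty^n\,\epsilon_r^{n(n-1)k+n_1(n_1+1)}\frac1{(2\pi\mathrm i)^n}\int_{C_r^n}\chi_1(x)\chi_1(x)^\dagger\Delta(x)\frac{dx_1}{x_1}\cdots\frac{dx_n}{x_n}$$ $$=A_I\sum_{s_1,\dots,s_n=0}^\infty\prod_{i=1}^na^{s_i}q^{((n-1)k+1)s_i}\frac{(q^{s_i+1})_\infty}{(bq^{s_i+1})_\infty}\prod_{1\le i<j\le n}(q^{s_i-s_j},q^{-s_i+s_j+1})_k$$ $$\times\prod_{i=n_0+1}^nq^{s_i}(1-bq^{s_i+1})\prod_{n_0+1\le i<j\le n}(t^{-2}q^{s_i}-q^{s_j})(q^{s_i}-t^{-2}q^{s_j});$$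 Case II: $$\lim_{r\to\infty}(-\epsilon_r^{-1}q,-\epsilon_r^{-1}aq)_\infty^n\,\epsilon_r^{n(n-1)k+n_1(n_1+1)+n}\frac1{(2\pi\mathrm i)^n}\int_{C_r^n}\chi_1(x)\chi_1(x)^\dagger\Delta(x)\frac{dx_1}{x_1}\cdots\frac{dx_n}{x_n}$$ $$=A_{II}\sum_{s_1,\dots,s_n=0}^\infty\prod_{i=1}^na^{s_i}q^{((n-1)k+1)s_i}\frac{(q^{s_i+1})_\infty}{(bq^{s_i+1})_\infty}\prod_{1\le i<j\le n}(q^{s_i-s_j+1},q^{-s_i+s_j})_k$$ $$\times\prod_{i=n_0+1}^nq^{s_i}(1-q^{s_i})\prod_{n_0+1\le i<j\le n}(t^2q^{s_i}-q^{s_j})(q^{s_i}-t^2q^{s_j}),$$ where $$A_I=(-1)^{\binom n2k}(q)_\infty^{-2n}\,q^{\binom{n_1}2+\binom n2\frac{k(k+1)}2}\,t^{n_1(n_1-1)}\,b^{-n_1},$$ $$A_{II}=(-1)^{\binom n2k}(q)_\infty^{-2n}\,q^{\frac{n_1(n_1+1)}2+n+\binom n2\frac{k(k+1)}2}\,t^{n_0(n_0-1)+2n_0n_1}.$$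 -/

import Mathlib

namespace KoornwinderLimit

noncomputable section

/-- The infinite `q`-shifted factorial `(x)_∞ = ∏_{i ≥ 0} (1 - x q^i)`. -/
def qInf (q : ℝ) (x : ℂ) : ℂ := ∏' i : ℕ, (1 - x * (q : ℂ) ^ i)

/-- The finite `q`-shifted factorial `(x)_m = ∏_{0 ≤ i < m} (1 - x q^i)`. -/
def qFin (q : ℝ) (x : ℂ) (m : ℕ) : ℂ := ∏ i ∈ Finset.range m, (1 - x * (q : ℂ) ^ i)

/-! ### The weight function

The four parameters `a₁, a₂, a₃, a₄` are the values `p 0, p 1, p 2, p 3` of `p : Fin 4 → ℂ`. -/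

/-- The symmetric weight
`Δ₊(x) = ∏_{i<j} (x_i x_j, x_i/x_j, x_j/x_i, 1/(x_i x_j))_∞ /
  (t² x_i x_j, t² x_i/x_j, t² x_j/x_i, t²/(x_i x_j))_∞
  · ∏_i (x_i², x_i⁻²)_∞ / ∏_r (a_r x_i, a_r/x_i)_∞`. -/
def deltaPlus {n : ℕ} (q t : ℝ) (p : Fin 4 → ℂ) (x : Fin n → ℂ) : ℂ :=
  (∏ i, ∏ j ∈ Finset.Ioi i,
    (qInf q (x i * x j) * qInf q (x i * (x j)⁻¹) *
        qInf q ((x i)⁻¹ * x j) * qInf q ((x i)⁻¹ * (x j)⁻¹)) /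
      (qInf q ((t : ℂ) ^ 2 * (x i * x j)) * qInf q ((t : ℂ) ^ 2 * (x i * (x j)⁻¹)) *
        qInf q ((t : ℂ) ^ 2 * ((x i)⁻¹ * x j)) *
        qInf q ((t : ℂ) ^ 2 * ((x i)⁻¹ * (x j)⁻¹)))) *
  ∏ i, (qInf q (x i ^ 2) * qInf q ((x i)⁻¹ ^ 2)) /
    ∏ r, (qInf q (p r * x i) * qInf q (p r * (x i)⁻¹))

/-- The function `𝒞(x)`, the product of `v_α` over the negative roots `α` of type `C_n`:
`∏_{i<j} (x_i x_j - t²)(x_i/x_j - t²) / ((x_i x_j - 1)(x_i/x_j - 1))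
  · ∏_i (x_i - a₃)(x_i - a₄) / (x_i² - 1)`. -/
def cFun {n : ℕ} (t : ℝ) (p : Fin 4 → ℂ) (x : Fin n → ℂ) : ℂ :=
  (∏ i, ∏ j ∈ Finset.Ioi i,
    ((x i * x j - (t : ℂ) ^ 2) * (x i * (x j)⁻¹ - (t : ℂ) ^ 2)) /
      ((x i * x j - 1) * (x i * (x j)⁻¹ - 1))) *
  ∏ i, ((x i - p 2) * (x i - p 3)) / (x i ^ 2 - 1)

/-- The nonsymmetric weight `Δ = 𝒞 Δ₊`. -/
def delta {n : ℕ} (q t : ℝ) (p : Fin 4 → ℂ) (x : Fin n → ℂ) : ℂ :=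
  cFun t p x * deltaPlus q t p x

/-! ### The function `χ₁` -/

/-- The indices `n₀ + 1, …, n` (in `Fin n` these are the `i` with `n₀ ≤ i`). -/
def lastIdx (n₀ n₁ : ℕ) : Finset (Fin (n₀ + n₁)) :=
  Finset.univ.filter fun i => n₀ ≤ (i : ℕ)

/-- `χ₁(x) = x^{ρ₁} ∏_{α ∈ Σ₁⁻} (1 - x^α) v_α(x; 𝐭⁻¹, q⁻¹)` with `ρ₁ = (0,…,0,n₁,n₁-1,…,1)` and
`Σ₁⁻ = {-2ε_i} ∪ {-ε_i ± ε_j : i < j}`, the indices running over `n₀ + 1, …, n`.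
The factor of `α = -2ε_i` is `(1 - a₃⁻¹ x_i⁻¹)(1 - a₄⁻¹ x_i⁻¹)` and that of `α = -ε_i ± ε_j` is
`1 - t⁻² x_i⁻¹ x_j^{±1}`. -/
def chi (n₀ n₁ : ℕ) (t : ℝ) (p : Fin 4 → ℂ) (x : Fin (n₀ + n₁) → ℂ) : ℂ :=
  (∏ i ∈ lastIdx n₀ n₁, x i ^ (n₀ + n₁ - (i : ℕ))) *
  (∏ i ∈ lastIdx n₀ n₁, (1 - (p 2)⁻¹ * (x i)⁻¹) * (1 - (p 3)⁻¹ * (x i)⁻¹)) *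
  ∏ i ∈ lastIdx n₀ n₁, ∏ j ∈ Finset.Ioi i,
    (1 - ((t : ℂ) ^ 2)⁻¹ * ((x i)⁻¹ * x j)) * (1 - ((t : ℂ) ^ 2)⁻¹ * ((x i)⁻¹ * (x j)⁻¹))

/-- `χ₁†(x)`: the involution `†` inverts the variables and all the parameters. It sends `t` to
`t⁻¹`, `a₃` to `a₃⁻¹` and `a₄` to `a₄⁻¹` (the only parameters on which `χ₁` depends). -/
def chiDagger (n₀ n₁ : ℕ) (t : ℝ) (p : Fin 4 → ℂ) (x : Fin (n₀ + n₁) → ℂ) : ℂ :=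
  chi n₀ n₁ t⁻¹ (fun r => (p r)⁻¹) (fun i => (x i)⁻¹)

/-- The integrand `χ₁(x) χ₁(x)† Δ(x) / (x₁ ⋯ x_n)`, so that `dx/x = dx₁/x₁ ⋯ dx_n/x_n`. -/
def integrand (n₀ n₁ : ℕ) (q t : ℝ) (p : Fin 4 → ℂ) (x : Fin (n₀ + n₁) → ℂ) : ℂ :=
  chi n₀ n₁ t p x * chiDagger n₀ n₁ t p x * delta q t p x * ∏ i, (x i)⁻¹

/-! ### The two families of parameters -/

/-- Case I: `(a₁,a₂,a₃,a₄) = (ε⁻¹ q^{1/2}, -a q^{1/2}, ε b q^{1/2}, -q^{1/2})`. -/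
def paramI (q : ℝ) (a b ε : ℂ) : Fin 4 → ℂ :=
  ![ε⁻¹ * (√q : ℝ), -a * (√q : ℝ), ε * b * (√q : ℝ), -((√q : ℝ) : ℂ)]

/-- Case II: `(a₁,a₂,a₃,a₄) = (ε b q^{1/2}, -a q^{1/2}, ε⁻¹ q^{1/2}, -q^{1/2})`. -/
def paramII (q : ℝ) (a b ε : ℂ) : Fin 4 → ℂ :=
  ![ε * b * (√q : ℝ), -a * (√q : ℝ), ε⁻¹ * (√q : ℝ), -((√q : ℝ) : ℂ)]

/-- `ε_r = ε₀ q^r`. -/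
def epsSeq (q : ℝ) (ε₀ : ℂ) (r : ℕ) : ℂ := ε₀ * (q : ℂ) ^ r

/-! ### The contours -/

/-- The three sequences of poles (for a given value `ε` of `ε_r`):
`x_{r,s} = ε⁻¹ q^{s+1/2}`, `y_{r,s} = ε b q^{s+1/2}`, `z_s = -a q^{s+1/2}`. -/
def pole (q : ℝ) (a b ε : ℂ) (i : Fin 3) (s : ℕ) : ℂ :=
  (![ε⁻¹, ε * b, -a] : Fin 3 → ℂ) i * ((q : ℂ) ^ s * (√q : ℝ))

/-- `ε₀` is generic: for each `r`, all the points `x_{r,s}, y_{r,s}, z_s` and their reciprocals are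
pairwise distinct, and none of them lies on the unit circle. -/
def Generic (q : ℝ) (a b ε₀ : ℂ) : Prop :=
  ∀ r : ℕ,
    Function.Injective (fun m : Bool × Fin 3 × ℕ =>
      if m.1 then pole q a b (epsSeq q ε₀ r) m.2.1 m.2.2
      else (pole q a b (epsSeq q ε₀ r) m.2.1 m.2.2)⁻¹) ∧
    ∀ (i : Fin 3) (s : ℕ), ‖pole q a b (epsSeq q ε₀ r) i s‖ ≠ 1 ∧
      ‖(pole q a b (epsSeq q ε₀ r) i s)⁻¹‖ ≠ 1

/-- `γ`, restricted to `[0,1]`, is a closed piecewise `C¹` curve: it is `C¹` on each closed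
subinterval of `[0,1]` that has none of finitely many break points in its interior. -/
structure IsClosedCurve (γ : ℝ → ℂ) : Prop where
  continuousOn : ContinuousOn γ (Set.Icc 0 1)
  closed : γ 0 = γ 1
  piecewise : ∃ B : Finset ℝ, ∀ c d : ℝ, 0 ≤ c → c < d → d ≤ 1 →
    (∀ u ∈ B, u ∉ Set.Ioo c d) → ContDiffOn ℝ 1 γ (Set.Icc c d)

/-- `γ` does not meet `w` and has winding number `m` about `w`. -/
def WindsAround (γ : ℝ → ℂ) (w : ℂ) (m : ℤ) : Prop :=
  (∀ u ∈ Set.Icc (0 : ℝ) 1, γ u ≠ w) ∧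
    (2 * (Real.pi : ℂ) * Complex.I)⁻¹ * ∫ u in (0 : ℝ)..1, deriv γ u / (γ u - w) = m

/-- A deformed contour for the value `ε` of `ε_r`: a closed curve that encloses (winds once,
counterclockwise, about) the origin and all the points `x_{r,s}, y_{r,s}, z_s`, and that excludes
(has winding number zero about) all the reciprocals of these points. -/
structure IsDeformedContour (q : ℝ) (a b ε : ℂ) (γ : ℝ → ℂ) : Prop where
  curve : IsClosedCurve γ
  origin : WindsAround γ 0 1
  inside : ∀ (i : Fin 3) (s : ℕ), WindsAround γ (pole q a b ε i s) 1
  outside : ∀ (i : Fin 3) (s : ℕ), WindsAround γ (pole q a b ε i s)⁻¹ 0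

/-- The pull-back of `f(x) dx₁ ⋯ dx_n` to the cube `[0,1]^n` along `γ × ⋯ × γ`. -/
def pullback {n : ℕ} (γ : ℝ → ℂ) (f : (Fin n → ℂ) → ℂ) (u : Fin n → ℝ) : ℂ :=
  f (fun i => γ (u i)) * ∏ i, deriv γ (u i)

/-- `∫_{C^n} f(x) dx₁ ⋯ dx_n` where `C` is the curve parametrized by `γ` on `[0,1]`. -/
def contourIntegral {n : ℕ} (γ : ℝ → ℂ) (f : (Fin n → ℂ) → ℂ) : ℂ :=
  ∫ u in Set.Icc (0 : Fin n → ℝ) 1, pullback γ f u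

/-! ### The limits -/

/-- The general term of the multiple series in Case I. -/
def termI (n₀ n₁ : ℕ) (q t : ℝ) (k : ℕ) (a b : ℂ) (s : Fin (n₀ + n₁) → ℕ) : ℂ :=
  (∏ i, a ^ s i * (q : ℂ) ^ (((n₀ + n₁ - 1) * k + 1) * s i) *
    (qInf q ((q : ℂ) ^ (s i + 1)) / qInf q (b * (q : ℂ) ^ (s i + 1)))) *
  (∏ i, ∏ j ∈ Finset.Ioi i,
    qFin q ((q : ℂ) ^ ((s i : ℤ) - s j)) k * qFin q ((q : ℂ) ^ (-(s i : ℤ) + s j + 1)) k) *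
  (∏ i ∈ lastIdx n₀ n₁, (q : ℂ) ^ s i * (1 - b * (q : ℂ) ^ (s i + 1))) *
  ∏ i ∈ lastIdx n₀ n₁, ∏ j ∈ Finset.Ioi i,
    (((t : ℂ) ^ 2)⁻¹ * (q : ℂ) ^ s i - (q : ℂ) ^ s j) *
      ((q : ℂ) ^ s i - ((t : ℂ) ^ 2)⁻¹ * (q : ℂ) ^ s j)

/-- The general term of the multiple series in Case II. -/
def termII (n₀ n₁ : ℕ) (q t : ℝ) (k : ℕ) (a b : ℂ) (s : Fin (n₀ + n₁) → ℕ) : ℂ :=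
  (∏ i, a ^ s i * (q : ℂ) ^ (((n₀ + n₁ - 1) * k + 1) * s i) *
    (qInf q ((q : ℂ) ^ (s i + 1)) / qInf q (b * (q : ℂ) ^ (s i + 1)))) *
  (∏ i, ∏ j ∈ Finset.Ioi i,
    qFin q ((q : ℂ) ^ ((s i : ℤ) - s j + 1)) k * qFin q ((q : ℂ) ^ (-(s i : ℤ) + s j)) k) *
  (∏ i ∈ lastIdx n₀ n₁, (q : ℂ) ^ s i * (1 - (q : ℂ) ^ s i)) *
  ∏ i ∈ lastIdx n₀ n₁, ∏ j ∈ Finset.Ioi i,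
    ((t : ℂ) ^ 2 * (q : ℂ) ^ s i - (q : ℂ) ^ s j) *
      ((q : ℂ) ^ s i - (t : ℂ) ^ 2 * (q : ℂ) ^ s j)

/-- `A_I = (-1)^{C(n,2) k} (q)_∞^{-2n} q^{C(n₁,2) + C(n,2) k(k+1)/2} t^{n₁(n₁-1)} b^{-n₁}`,
where `n = n₀ + n₁`. -/
def constI (n₀ n₁ : ℕ) (q t : ℝ) (k : ℕ) (b : ℂ) : ℂ :=
  (-1) ^ ((n₀ + n₁).choose 2 * k) * (qInf q q ^ (2 * (n₀ + n₁)))⁻¹ *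
    (q : ℂ) ^ (n₁.choose 2 + (n₀ + n₁).choose 2 * (k * (k + 1) / 2)) *
    (t : ℂ) ^ (n₁ * (n₁ - 1)) * (b ^ n₁)⁻¹

/-- `A_II = (-1)^{C(n,2) k} (q)_∞^{-2n} q^{n₁(n₁+1)/2 + n + C(n,2) k(k+1)/2}
  t^{n₀(n₀-1) + 2 n₀ n₁}`, where `n = n₀ + n₁`. -/
def constII (n₀ n₁ : ℕ) (q t : ℝ) (k : ℕ) : ℂ :=
  (-1) ^ ((n₀ + n₁).choose 2 * k) * (qInf q q ^ (2 * (n₀ + n₁)))⁻¹ *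
    (q : ℂ) ^ (n₁ * (n₁ + 1) / 2 + (n₀ + n₁) + (n₀ + n₁).choose 2 * (k * (k + 1) / 2)) *
    (t : ℂ) ^ (n₀ * (n₀ - 1) + 2 * n₀ * n₁)

end

end KoornwinderLimit

open KoornwinderLimit

namespace KoornwinderLimit

/-! ### `q`-shifted factorials: bounds, reflection, duplication -/

section QFactorial

variable {q : ℝ}

/-! Because `t² = q^k`, the interaction of two variables in `Δ` is a finite product: for `i < j` it
equals `∏_{l<k} (1 - q^l x_i x_j)(1 - q^{l+1}/(x_i x_j))(1 - q^l x_i/x_j)(1 - q^{l+1} x_j/x_i)`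
(`weight_pair_eq`), and `χ₁ χ₁†` contributes four-factor products of the same shape
(`chi_mul_chiDagger`). Multiplied by `ε²`, each of them is a quadratic form in `ε x_i`, `ε/x_i`, `ε
x_j`, `ε/x_j` (`quadForm_eq`). The scaled integrand is therefore a product of one-variable functions
times a polynomial in these scaled variables whose coefficients do not depend on `ε`. Expansion into
monomials and Fubini reduce everything to one variable (`tendsto_prefactor_pow_mul_integral`).

In one variable the contour is moved to the unit circle. The bounds on `|ε₀|` put exactly `x_{r,0},
…, x_{r,r-1}` outside the circle. They are enclosed by `C_r` while their reciprocals are excluded,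
so the move costs `r` pairs of residues (`IsDeformedContour.integral_div_poleDenom`). After
multiplication by `(-ε⁻¹q, -ε⁻¹aq)_∞` the circle integral is `O((|a| q)^r)`
(`exists_norm_circle_le`), and the `s`-th pair of residues is `O((|a| q)^s)` uniformly in `r` and
converges (`prefactor_mul_residue`, `exists_norm_weightFun_le`). Dominated convergence for series
gives a sum over all `s` (`tendsto_prefactor_mul_integral`).

At `x = x_{r,s}` one has `ε x = q^{s+1/2}` and `ε/x → 0`; at the reciprocal the roles are exchanged.
For each variable only one of the two residues survives in the limit (`TameNumerator`): in Case I
the one at `x_{r,s}` if `i ≤ n₀` and the one at `1/x_{r,s}` if `i > n₀`, in Case II the opposite.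
The value of the polynomial at these limits gives the summand; for the pairs with `i > n₀` the two
kinds of factorials are exchanged with the help of a factor of `χ₁ χ₁†` (`sub_mul_qFin_mul_qFin`).

Two points need care. The contours are arbitrary curves known only through winding numbers, so the
residue theorem is derived from partial fractions on an annulus, Cauchy's formula for the annulus
and Fubini. And the factorization of the integrand is proved only where no `x_i²`, `x_i x_j`,
`x_i/x_j` is an integer power of `q`. The curve may meet these walls, but only for a null set of
parameters or where some derivative, and with it the pulled-back form, vanishes
(`IsClosedCurve.ae_offWalls`). -/

lemma norm_ofReal_of_pos (hq₀ : 0 < q) : ‖(q : ℂ)‖ = q := by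
  rw [Complex.norm_real, Real.norm_of_nonneg hq₀.le]

lemma ofReal_ne_zero_of_pos (hq₀ : 0 < q) : (q : ℂ) ≠ 0 := by
  exact_mod_cast hq₀.ne'

lemma summable_norm_neg_mul_pow (hq₀ : 0 < q) (hq₁ : q < 1) (x : ℂ) :
    Summable fun i : ℕ => ‖-(x * (q : ℂ) ^ i)‖ := by
  simp only [norm_neg, norm_mul, norm_pow, norm_ofReal_of_pos hq₀]
  exact (summable_geometric_of_lt_one hq₀.le hq₁).mul_left _

lemma multipliable_one_sub_mul_pow (hq₀ : 0 < q) (hq₁ : q < 1) (x : ℂ) :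
    Multipliable fun i : ℕ => 1 - x * (q : ℂ) ^ i := by
  simpa only [sub_eq_add_neg] using
    multipliable_one_add_of_summable (summable_norm_neg_mul_pow hq₀ hq₁ x)

lemma differentiable_qInf (hq₀ : 0 < q) (hq₁ : q < 1) : Differentiable ℂ (qInf q) := by
  intro x
  have hK : IsOpen (Metric.ball (0 : ℂ) (‖x‖ + 1)) := Metric.isOpen_ball
  have h := Summable.hasProdLocallyUniformlyOn_nat_one_add (f := fun (i : ℕ) (z : ℂ) => -(z * (q : ℂ) ^ i))
    (u := fun i => (‖x‖ + 1) * q ^ i) hK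
    ((summable_geometric_of_lt_one hq₀.le hq₁).mul_left _)
    (Filter.Eventually.of_forall fun i z hz => by
      simp only [norm_neg, norm_mul, norm_pow, norm_ofReal_of_pos hq₀]
      have : ‖z‖ < ‖x‖ + 1 := by simpa using hz
      gcongr) (fun i => by fun_prop)
  have hd := h.tendstoLocallyUniformlyOn_finsetRange.differentiableOn
    (Filter.Eventually.of_forall fun N => by fun_prop) hK
  have := hd.differentiableAt (hK.mem_nhds (x := x) (by simp))
  have e : qInf q = fun x : ℂ => ∏' i : ℕ, (1 + -(x * (q : ℂ) ^ i)) := by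
    funext z
    simp only [qInf, sub_eq_add_neg]
  rw [e]
  exact this

lemma continuous_qInf (hq₀ : 0 < q) (hq₁ : q < 1) : Continuous (qInf q) :=
  (differentiable_qInf hq₀ hq₁).continuous

lemma continuous_qFin (s : ℕ) : Continuous fun x => qFin q x s := by
  unfold qFin; fun_prop

lemma qInf_zero : qInf q 0 = 1 := by simp [qInf]

lemma qFin_zero_left (s : ℕ) : qFin q 0 s = 1 := by simp [qFin]

lemma qInf_eq_qFin_mul (hq₀ : 0 < q) (hq₁ : q < 1) (x : ℂ) (s : ℕ) :
    qInf q x = qFin q x s * qInf q (x * (q : ℂ) ^ s) := by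
  unfold qInf qFin
  rw [← Multipliable.prod_mul_tprod_nat_mul' (k := s)]
  · congr 1
    refine tprod_congr fun i => ?_
    ring
  · refine (multipliable_one_sub_mul_pow hq₀ hq₁ (x * (q : ℂ) ^ s)).congr fun i => ?_
    ring

lemma qInf_ne_zero (hq₀ : 0 < q) (hq₁ : q < 1) {x : ℂ} (h : ∀ i : ℕ, x * (q : ℂ) ^ i ≠ 1) :
    qInf q x ≠ 0 := by
  have := tprod_one_add_ne_zero_of_summable (f := fun i : ℕ => -(x * (q : ℂ) ^ i))
    (fun i => by
      rw [← sub_eq_add_neg, sub_ne_zero]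
      exact (h i).symm) (summable_norm_neg_mul_pow hq₀ hq₁ x)
  simpa only [qInf, sub_eq_add_neg] using this

lemma qInf_ne_zero_of_norm_lt_one (hq₀ : 0 < q) (hq₁ : q < 1) {x : ℂ} (h : ‖x‖ < 1) :
    qInf q x ≠ 0 := by
  refine qInf_ne_zero hq₀ hq₁ fun i hi => ?_
  have : ‖x * (q : ℂ) ^ i‖ < 1 := by
    rw [norm_mul, norm_pow, norm_ofReal_of_pos hq₀]
    exact mul_lt_one_of_nonneg_of_lt_one_left (norm_nonneg _) h (pow_le_one₀ hq₀.le hq₁.le)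
  rw [hi] at this
  simp at this

lemma qFin_ne_zero_of_norm_lt_one (hq₀ : 0 < q) (hq₁ : q < 1) {x : ℂ} (h : ‖x‖ < 1) (s : ℕ) :
    qFin q x s ≠ 0 := by
  have := qInf_ne_zero_of_norm_lt_one hq₀ hq₁ h
  rw [qInf_eq_qFin_mul hq₀ hq₁ x s] at this
  exact left_ne_zero_of_mul this

lemma exists_norm_qInf_le (hq₀ : 0 < q) (hq₁ : q < 1) (R : ℝ) :
    ∃ C > 0, ∀ x : ℂ, ‖x‖ ≤ R → ‖qInf q x‖ ≤ C := by
  obtain ⟨C, hC⟩ := (isCompact_closedBall (0 : ℂ) R).exists_bound_of_continuousOn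
    (continuous_qInf hq₀ hq₁).continuousOn
  exact ⟨max C 1, by positivity, fun x hx => (hC x (by simpa using hx)).trans (le_max_left _ _)⟩

lemma exists_le_norm_qInf (hq₀ : 0 < q) (hq₁ : q < 1) {ρ : ℝ} (hρ : ρ < 1) :
    ∃ c > 0, ∀ x : ℂ, ‖x‖ ≤ ρ → c ≤ ‖qInf q x‖ := by
  have hne : ∀ x ∈ Metric.closedBall (0 : ℂ) ρ, qInf q x ≠ 0 := fun x hx =>
    qInf_ne_zero_of_norm_lt_one hq₀ hq₁ ((by simpa using hx : ‖x‖ ≤ ρ).trans_lt hρ)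
  obtain ⟨C, hC⟩ := (isCompact_closedBall (0 : ℂ) ρ).exists_bound_of_continuousOn
    ((continuous_qInf hq₀ hq₁).continuousOn.inv₀ hne)
  refine ⟨(max C 1)⁻¹, by positivity, fun x hx => ?_⟩
  have hx' : x ∈ Metric.closedBall (0 : ℂ) ρ := by simpa using hx
  have h := (hC x hx').trans (le_max_left C 1)
  rw [Pi.inv_apply, norm_inv] at h
  exact inv_le_of_inv_le₀ (norm_pos_iff.2 (hne x hx')) h

/-- Each factor is at most `1 + R q^i ≤ exp (R q^i)`, and the geometric series bounds the exponents
independently of the length `s`. -/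
lemma exists_norm_qFin_le (hq₀ : 0 < q) (hq₁ : q < 1) {R : ℝ} (hR : 0 ≤ R) :
    ∃ C > 0, ∀ (x : ℂ) (s : ℕ), ‖x‖ ≤ R → ‖qFin q x s‖ ≤ C := by
  refine ⟨Real.exp (R * (1 - q)⁻¹), Real.exp_pos _, fun x s hx => ?_⟩
  have hsum := summable_geometric_of_lt_one hq₀.le hq₁
  calc ‖qFin q x s‖ ≤ ∏ i ∈ Finset.range s, Real.exp (R * q ^ i) := by
        rw [qFin, norm_prod]
        refine Finset.prod_le_prod (fun _ _ => norm_nonneg _) fun i _ => ?_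
        calc ‖1 - x * (q : ℂ) ^ i‖ ≤ 1 + ‖x‖ * q ^ i := by
              refine (norm_sub_le _ _).trans ?_
              simp [abs_of_pos hq₀]
          _ ≤ R * q ^ i + 1 := by
              rw [add_comm]
              gcongr
          _ ≤ _ := Real.add_one_le_exp _
    _ = Real.exp (R * ∑ i ∈ Finset.range s, q ^ i) := by rw [← Real.exp_sum, Finset.mul_sum]
    _ ≤ _ := by
        rw [← tsum_geometric_of_lt_one hq₀.le hq₁]
        have := hsum.sum_le_tsum (Finset.range s) fun i _ => by positivity
        gcongr

/-- Write `(x)_s = (x)_∞ / (x q^s)_∞`; both infinite products are controlled on the disc of radius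
`ρ`, so the bound does not depend on `s`. -/
lemma exists_le_norm_qFin (hq₀ : 0 < q) (hq₁ : q < 1) {ρ : ℝ} (hρ : ρ < 1) :
    ∃ c > 0, ∀ (x : ℂ) (s : ℕ), ‖x‖ ≤ ρ → c ≤ ‖qFin q x s‖ := by
  obtain ⟨c, hc, hc'⟩ := exists_le_norm_qInf hq₀ hq₁ hρ
  obtain ⟨C, hC, hC'⟩ := exists_norm_qInf_le hq₀ hq₁ ρ
  refine ⟨c / C, by positivity, fun x s hx => ?_⟩
  have hx' : ‖x * (q : ℂ) ^ s‖ ≤ ρ := by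
    rw [norm_mul, norm_pow, norm_ofReal_of_pos hq₀]
    exact (mul_le_of_le_one_right (norm_nonneg _) (pow_le_one₀ hq₀.le hq₁.le)).trans hx
  rw [div_le_iff₀ hC]
  calc c ≤ ‖qInf q x‖ := hc' x hx
    _ = ‖qFin q x s‖ * ‖qInf q (x * (q : ℂ) ^ s)‖ := by
        rw [← norm_mul, ← qInf_eq_qFin_mul hq₀ hq₁]
    _ ≤ _ := by gcongr; exact hC' _ hx'

/-- Take `-x q^i` out of each factor and reverse the order. This replaces a factorial of large
argument by an explicit power times one whose argument stays bounded. -/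
lemma qFin_eq_reflect (hq₀ : 0 < q) {x : ℂ} (hx : x ≠ 0) (s : ℕ) :
    qFin q x s = (-x) ^ s * (q : ℂ) ^ s.choose 2 * qFin q ((x * (q : ℂ) ^ s)⁻¹ * q) s := by
  have hq := ofReal_ne_zero_of_pos hq₀
  unfold qFin
  rw [← Finset.prod_range_reflect (fun i => 1 - (x * (q : ℂ) ^ s)⁻¹ * q * (q : ℂ) ^ i),
    Nat.choose_two_right, ← Finset.sum_range_id, ← Finset.prod_pow_eq_pow_sum,
    ← Finset.card_range s, ← Finset.prod_const, Finset.card_range, ← Finset.prod_mul_distrib,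
    ← Finset.prod_mul_distrib]
  refine Finset.prod_congr rfl fun i hi => ?_
  have hi' := Finset.mem_range.1 hi
  have : (q : ℂ) ^ s = q ^ i * q * q ^ (s - 1 - i) := by
    rw [← pow_succ, ← pow_add]
    congr 1
    omega
  rw [this]
  field_simp
  ring

/-- Split the product into even and odd indices; each factor is then a difference of two squares. -/
lemma qInf_sq (hq₀ : 0 < q) (hq₁ : q < 1) (x : ℂ) :
    qInf q (x ^ 2) = qInf q x * qInf q (-x) * qInf q ((√q : ℝ) * x) * qInf q (-((√q : ℝ) * x)) := by
  have hs : ((√q : ℝ) : ℂ) ^ 2 = q := by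
    rw [← Complex.ofReal_pow, Real.sq_sqrt hq₀.le]
  set r : ℂ := ((√q : ℝ) : ℂ)
  have m := multipliable_one_sub_mul_pow hq₀ hq₁
  have e₁ (i : ℕ) : 1 - x ^ 2 * (q : ℂ) ^ (2 * i) =
      (1 - x * (q : ℂ) ^ i) * (1 - -x * (q : ℂ) ^ i) := by ring
  have e₂ (i : ℕ) : 1 - x ^ 2 * (q : ℂ) ^ (2 * i + 1) =
      (1 - r * x * (q : ℂ) ^ i) * (1 - -(r * x) * (q : ℂ) ^ i) := by
    rw [pow_succ, ← hs]
    ring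
  have h₁ : HasProd (fun i : ℕ => 1 - x ^ 2 * (q : ℂ) ^ (2 * i)) (qInf q x * qInf q (-x)) := by
    simp only [e₁]
    exact (m x).hasProd.mul (m (-x)).hasProd
  have h₂ : HasProd (fun i : ℕ => 1 - x ^ 2 * (q : ℂ) ^ (2 * i + 1))
      (qInf q (r * x) * qInf q (-(r * x))) := by
    simp only [e₂]
    exact (m (r * x)).hasProd.mul (m (-(r * x))).hasProd
  rw [mul_assoc (qInf q x * qInf q (-x))]
  exact (HasProd.even_mul_odd (f := fun i : ℕ => 1 - x ^ 2 * (q : ℂ) ^ i) h₁ h₂).tprod_eq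

end QFactorial

open MeasureTheory Set Filter Topology

/-! ### Integration along closed piecewise `C¹` curves -/

section Curve

variable {γ : ℝ → ℂ}

/-- A closed piecewise `C¹` curve is differentiable with bounded derivative off a finite set. -/
lemma IsClosedCurve.exists_finset_bound (h : IsClosedCurve γ) :
    ∃ (T : Finset ℝ) (M : ℝ), ∀ u ∈ Ioo (0 : ℝ) 1, u ∉ T →
      HasDerivAt γ (deriv γ u) u ∧ ‖deriv γ u‖ ≤ M := by
  classical
  obtain ⟨B, hB⟩ := h.piecewise
  have key : ∀ p : ℝ × ℝ, ∃ M : ℝ, 0 ≤ p.1 → p.1 < p.2 → p.2 ≤ 1 →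
      (∀ u ∈ B, u ∉ Ioo p.1 p.2) → ∀ u ∈ Ioo p.1 p.2,
        HasDerivAt γ (deriv γ u) u ∧ ‖deriv γ u‖ ≤ M := by
    rintro ⟨c, d⟩
    by_cases hcd : 0 ≤ c ∧ c < d ∧ d ≤ 1 ∧ ∀ u ∈ B, u ∉ Ioo c d
    · obtain ⟨h₀, h₁, h₂, h₃⟩ := hcd
      have hC := hB c d h₀ h₁ h₂ h₃
      have hcont := hC.continuousOn_derivWithin (uniqueDiffOn_Icc h₁) le_rfl
      obtain ⟨M, hM⟩ := isCompact_Icc.exists_bound_of_continuousOn hcont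
      refine ⟨M, fun _ _ _ _ u hu => ⟨?_, ?_⟩⟩
      · exact ((hC.differentiableOn one_ne_zero u (Ioo_subset_Icc_self hu)).differentiableAt
          (Icc_mem_nhds hu.1 hu.2)).hasDerivAt
      · rw [← derivWithin_of_mem_nhds (Icc_mem_nhds hu.1 hu.2)]
        exact hM u (Ioo_subset_Icc_self hu)
    · exact ⟨0, fun h₀ h₁ h₂ h₃ => absurd ⟨h₀, h₁, h₂, h₃⟩ hcd⟩
  choose M hM using key
  set T : Finset ℝ := insert 0 (insert 1 (B.filter fun u => u ∈ Icc (0 : ℝ) 1)) with hT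
  have hT01 : ∀ u ∈ T, 0 ≤ u ∧ u ≤ 1 := by
    intro u hu
    simp only [hT, Finset.mem_insert, Finset.mem_filter] at hu
    rcases hu with rfl | rfl | hu
    · simp
    · simp
    · exact hu.2
  -- The sum over all pairs of break points dominates the bound for the one pair of neighbours of
  -- `u`.
  refine ⟨T, ∑ p ∈ T ×ˢ T, |M p|, fun u hu huT => ?_⟩
  have hne₁ : (T.filter (· ≤ u)).Nonempty := ⟨0, by simp [hT, hu.1.le]⟩
  have hne₂ : (T.filter (u ≤ ·)).Nonempty := ⟨1, by simp [hT, hu.2.le]⟩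
  have hc := Finset.mem_filter.1 (Finset.max'_mem _ hne₁)
  have hd := Finset.mem_filter.1 (Finset.min'_mem _ hne₂)
  set c := (T.filter (· ≤ u)).max' hne₁
  set d := (T.filter (u ≤ ·)).min' hne₂
  have hcu : c < u := lt_of_le_of_ne hc.2 fun e => huT (e ▸ hc.1)
  have hud : u < d := lt_of_le_of_ne hd.2 fun e => huT (e ▸ hd.1)
  have hno : ∀ w ∈ B, w ∉ Ioo c d := by
    intro w hw hwcd
    have hwT : w ∈ T := by
      simp only [hT, Finset.mem_insert, Finset.mem_filter]
      exact Or.inr (Or.inr ⟨hw, (hT01 c hc.1).1.trans hwcd.1.le, hwcd.2.le.trans (hT01 d hd.1).2⟩)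
    rcases le_total w u with hwu | hwu
    · exact absurd (Finset.le_max' _ w (Finset.mem_filter.2 ⟨hwT, hwu⟩)) (not_le.2 hwcd.1)
    · exact absurd (Finset.min'_le _ w (Finset.mem_filter.2 ⟨hwT, hwu⟩)) (not_le.2 hwcd.2)
  obtain ⟨h₁, h₂⟩ := hM (c, d) (hT01 c hc.1).1 (hcu.trans hud) (hT01 d hd.1).2 hno u ⟨hcu, hud⟩
  refine ⟨h₁, h₂.trans ((le_abs_self _).trans ?_)⟩
  exact Finset.single_le_sum (f := fun p => |M p|) (fun _ _ => abs_nonneg _)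
    (Finset.mem_product.2 ⟨hc.1, hd.1⟩)

lemma IsClosedCurve.integrableOn_deriv (h : IsClosedCurve γ) :
    IntegrableOn (deriv γ) (Icc 0 1) := by
  obtain ⟨T, M, hTM⟩ := h.exists_finset_bound
  rw [integrableOn_Icc_iff_integrableOn_Ioo]
  refine Measure.integrableOn_of_bounded (M := M) (by simp)
    (stronglyMeasurable_deriv γ).aestronglyMeasurable ?_
  have hT : ∀ᵐ u : ℝ, u ∉ T := T.countable_toSet.ae_notMem _
  filter_upwards [ae_restrict_mem measurableSet_Ioo, ae_restrict_of_ae hT] with u hu hu'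
  exact (hTM u hu hu').2

lemma IsClosedCurve.integrableOn_mul_deriv (h : IsClosedCurve γ) {φ : ℝ → ℂ}
    (hφ : ContinuousOn φ (Icc 0 1)) : IntegrableOn (fun u => φ u * deriv γ u) (Icc 0 1) :=
  h.integrableOn_deriv.continuousOn_mul hφ isCompact_Icc

lemma IsClosedCurve.intervalIntegrable_mul_deriv (h : IsClosedCurve γ) {φ : ℝ → ℂ}
    (hφ : ContinuousOn φ (Icc 0 1)) :
    IntervalIntegrable (fun u => φ u * deriv γ u) volume 0 1 := by
  rw [intervalIntegrable_iff_integrableOn_Icc_of_le zero_le_one]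
  exact h.integrableOn_mul_deriv hφ

/-- The integral of a derivative along a closed curve vanishes. -/
lemma IsClosedCurve.integral_eq_zero_of_hasDerivAt (h : IsClosedCurve γ) {Φ F : ℂ → ℂ}
    (hΦ : ∀ u ∈ Icc (0 : ℝ) 1, HasDerivAt Φ (F (γ u)) (γ u))
    (hF : ContinuousOn (fun u => F (γ u)) (Icc 0 1)) :
    ∫ u in (0 : ℝ)..1, F (γ u) * deriv γ u = 0 := by
  obtain ⟨T, M, hTM⟩ := h.exists_finset_bound
  have := integral_eq_of_hasDerivAt_off_countable_of_le (fun u => Φ (γ u))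
    (fun u => F (γ u) * deriv γ u) zero_le_one T.countable_toSet
    (fun u hu => (hΦ u hu).continuousAt.comp_continuousWithinAt (h.continuousOn u hu))
    (fun u hu => by
      have := (hΦ u (Ioo_subset_Icc_self hu.1)).scomp u (hTM u hu.1 hu.2).1
      rwa [smul_eq_mul, mul_comm] at this)
    (h.intervalIntegrable_mul_deriv hF)
  rw [this, h.closed, sub_self]

/-- On `|w| < |z|` the principal branch of `log (1 - w/z)` is a primitive of `1/(w - z)`. -/
lemma IsClosedCurve.integral_inv_eq_zero_of_norm_lt (h : IsClosedCurve γ) {z : ℂ}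
    (hz : ∀ u ∈ Icc (0 : ℝ) 1, ‖γ u‖ < ‖z‖) :
    ∫ u in (0 : ℝ)..1, (γ u - z)⁻¹ * deriv γ u = 0 := by
  have hne : ∀ u ∈ Icc (0 : ℝ) 1, γ u - z ≠ 0 := fun u hu e => by
    have := hz u hu
    rw [sub_eq_zero.1 e] at this
    exact lt_irrefl _ this
  refine h.integral_eq_zero_of_hasDerivAt (F := fun w => (w - z)⁻¹)
    (Φ := fun w => Complex.log (1 + -(w / z))) (fun u hu => ?_)
    (ContinuousOn.inv₀ (h.continuousOn.sub continuousOn_const) hne)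
  have hz0 : z ≠ 0 := norm_pos_iff.1 ((norm_nonneg _).trans_lt (hz u hu))
  have hlt : ‖-(γ u / z)‖ < 1 := by
    rw [norm_neg, norm_div, div_lt_one (norm_pos_iff.2 hz0)]
    exact hz u hu
  have hd : HasDerivAt (fun w : ℂ => 1 + -(w / z)) (-(1 / z)) (γ u) :=
    (((hasDerivAt_id (γ u)).div_const z).neg).const_add 1
  convert hd.clog (Complex.mem_slitPlane_of_norm_lt_one hlt) using 1
  have h₁ := hne u hu
  have h₄ : 1 + -(γ u / z) = -(γ u - z) / z := by
    field_simp
    ring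
  rw [h₄]
  field_simp

/-- On `|w| > |z|` the principal branch of `log (1 - z/w)` is a primitive of `1/(w - z) - 1/w`.
Hence the winding number about `z` is that about the origin. -/
lemma IsClosedCurve.integral_inv_eq_of_lt_norm (h : IsClosedCurve γ) {z : ℂ}
    (hz : ∀ u ∈ Icc (0 : ℝ) 1, ‖z‖ < ‖γ u‖) :
    ∫ u in (0 : ℝ)..1, (γ u - z)⁻¹ * deriv γ u = ∫ u in (0 : ℝ)..1, (γ u)⁻¹ * deriv γ u := by
  have hne : ∀ u ∈ Icc (0 : ℝ) 1, γ u - z ≠ 0 := fun u hu e => by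
    have := hz u hu
    rw [sub_eq_zero.1 e] at this
    exact lt_irrefl _ this
  have hne0 : ∀ u ∈ Icc (0 : ℝ) 1, γ u ≠ 0 := fun u hu =>
    norm_pos_iff.1 ((norm_nonneg _).trans_lt (hz u hu))
  have hc₁ : ContinuousOn (fun u => (γ u - z)⁻¹) (Icc 0 1) :=
    ContinuousOn.inv₀ (h.continuousOn.sub continuousOn_const) hne
  have hc₂ : ContinuousOn (fun u => (γ u)⁻¹) (Icc 0 1) := ContinuousOn.inv₀ h.continuousOn hne0
  rw [← sub_eq_zero, ← intervalIntegral.integral_sub (h.intervalIntegrable_mul_deriv hc₁)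
    (h.intervalIntegrable_mul_deriv hc₂)]
  simp only [← sub_mul]
  refine h.integral_eq_zero_of_hasDerivAt (F := fun w => (w - z)⁻¹ - w⁻¹)
    (Φ := fun w => Complex.log (1 + -(z / w))) (fun u hu => ?_) (hc₁.sub hc₂)
  have hg := hne0 u hu
  have hlt : ‖-(z / γ u)‖ < 1 := by
    rw [norm_neg, norm_div, div_lt_one (norm_pos_iff.2 hg)]
    exact hz u hu
  have hd : HasDerivAt (fun w : ℂ => 1 + -(z / w)) (-((0 * γ u - z * 1) / γ u ^ 2)) (γ u) :=
    ((((hasDerivAt_const (γ u) z).div (hasDerivAt_id (γ u)) hg)).neg).const_add 1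
  convert hd.clog (Complex.mem_slitPlane_of_norm_lt_one hlt) using 1
  have h₁ := hne u hu
  have h₄ : 1 + -(z / γ u) = (γ u - z) / γ u := by
    field_simp
    ring
  rw [h₄]
  field_simp
  ring

lemma WindsAround.integral_eq {w : ℂ} {m : ℤ} (h : WindsAround γ w m) :
    ∫ u in (0 : ℝ)..1, (γ u - w)⁻¹ * deriv γ u = 2 * (Real.pi : ℂ) * Complex.I * m := by
  have := h.2
  rw [← this]
  simp only [div_eq_inv_mul]
  rw [mul_inv_cancel_left₀ Complex.two_pi_I_ne_zero]

/-- Interchange of the integrals along a closed curve and along a circle avoiding it. -/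
lemma IsClosedCurve.integral_circleIntegral_swap (h : IsClosedCurve γ) {ρ : ℝ} (hρ : 0 ≤ ρ)
    (hγ : ∀ u ∈ Icc (0 : ℝ) 1, ‖γ u‖ ≠ ρ) {G : ℂ → ℂ}
    (hG : ContinuousOn G (Metric.sphere 0 ρ)) :
    IntervalIntegrable (fun u => (∮ z in C(0, ρ), (z - γ u)⁻¹ * G z) * deriv γ u) volume 0 1 ∧
    ∫ u in (0 : ℝ)..1, (∮ z in C(0, ρ), (z - γ u)⁻¹ * G z) * deriv γ u =
      ∮ z in C(0, ρ), (∫ u in (0 : ℝ)..1, (z - γ u)⁻¹ * deriv γ u) * G z := by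
  rw [intervalIntegrable_iff_integrableOn_Icc_of_le zero_le_one]
  simp only [circleIntegral, smul_eq_mul, ← intervalIntegral.integral_mul_const,
    ← intervalIntegral.integral_const_mul]
  have hmem (θ : ℝ) : circleMap 0 ρ θ ∈ Metric.sphere (0 : ℂ) ρ := circleMap_mem_sphere _ hρ θ
  have hne : ∀ u ∈ Icc (0 : ℝ) 1, ∀ θ : ℝ, circleMap 0 ρ θ - γ u ≠ 0 := by
    intro u hu θ e
    refine hγ u hu ?_
    rw [← sub_eq_zero.1 e]
    simpa using hmem θ
  have hcG : Continuous fun θ => G (circleMap 0 ρ θ) :=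
    hG.comp_continuous (continuous_circleMap 0 ρ) hmem
  set K : Set (ℝ × ℝ) := Icc (0 : ℝ) 1 ×ˢ Icc 0 (2 * Real.pi) with hK
  -- The derivative of the curve need not be continuous, so the Fubini integrand is treated as a
  -- continuous kernel on a compact rectangle times an integrable function of one variable.
  have hcont : ContinuousOn (fun p : ℝ × ℝ => deriv (circleMap 0 ρ) p.2 *
      ((circleMap 0 ρ p.2 - γ p.1)⁻¹ * G (circleMap 0 ρ p.2))) K := by
    simp only [deriv_circleMap]
    have hγ₁ : ContinuousOn (fun p : ℝ × ℝ => γ p.1) K :=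
      h.continuousOn.comp continuousOn_fst fun p hp => hp.1
    have h₁ : ContinuousOn (fun p : ℝ × ℝ => (circleMap 0 ρ p.2 - γ p.1)⁻¹) K :=
      ContinuousOn.inv₀ (((continuous_circleMap 0 ρ).comp continuous_snd).continuousOn.sub hγ₁)
        fun p hp => hne p.1 hp.1 p.2
    have h₂ : Continuous fun p : ℝ × ℝ => G (circleMap 0 ρ p.2) := hcG.comp continuous_snd
    have h₃ : Continuous fun p : ℝ × ℝ => circleMap 0 ρ p.2 * Complex.I :=
      ((continuous_circleMap 0 ρ).comp continuous_snd).mul continuous_const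
    exact h₃.continuousOn.mul (h₁.mul h₂.continuousOn)
  have hint : IntegrableOn (fun p : ℝ × ℝ => (deriv (circleMap 0 ρ) p.2 *
      ((circleMap 0 ρ p.2 - γ p.1)⁻¹ * G (circleMap 0 ρ p.2))) * (deriv γ p.1 * 1)) K := by
    have hd : IntegrableOn (fun p : ℝ × ℝ => deriv γ p.1 * (1 : ℂ)) K := by
      rw [IntegrableOn, hK, Measure.volume_eq_prod, ← Measure.prod_restrict]
      exact h.integrableOn_deriv.mul_prod (g := fun _ => (1 : ℂ)) (integrable_const _)
    exact hd.continuousOn_mul hcont (isCompact_Icc.prod isCompact_Icc)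
  simp only [intervalIntegral.integral_of_le zero_le_one,
    intervalIntegral.integral_of_le Real.two_pi_pos.le, ← integral_Icc_eq_integral_Ioc]
  have hint' : Integrable (Function.uncurry fun u θ => deriv (circleMap 0 ρ) θ *
      ((circleMap 0 ρ θ - γ u)⁻¹ * G (circleMap 0 ρ θ)) * deriv γ u)
      ((volume.restrict (Icc 0 1)).prod (volume.restrict (Icc 0 (2 * Real.pi)))) := by
    rw [IntegrableOn, hK, Measure.volume_eq_prod, ← Measure.prod_restrict] at hint
    refine hint.congr (Eventually.of_forall fun p => ?_)
    simp [Function.uncurry]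
  refine ⟨hint'.integral_prod_left, ?_⟩
  rw [integral_integral_swap hint']
  refine integral_congr_ae (Eventually.of_forall fun θ => ?_)
  refine integral_congr_ae (Eventually.of_forall fun u => ?_)
  simp only
  ring

end Curve

/-! ### The residue theorem on an annulus -/

section Residue

variable {γ : ℝ → ℂ}

/-- The closed annulus `ρ ≤ |z| ≤ R`. -/
def closedAnnulus (ρ R : ℝ) : Set ℂ := {z | ρ ≤ ‖z‖ ∧ ‖z‖ ≤ R}

/-- The open annulus `ρ < |z| < R`. -/
def openAnnulus (ρ R : ℝ) : Set ℂ := {z | ρ < ‖z‖ ∧ ‖z‖ < R}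

lemma isOpen_openAnnulus (ρ R : ℝ) : IsOpen (openAnnulus ρ R) :=
  (isOpen_lt continuous_const continuous_norm).inter (isOpen_lt continuous_norm continuous_const)

lemma closedBall_sdiff_ball (ρ R : ℝ) :
    Metric.closedBall (0 : ℂ) R \ Metric.ball 0 ρ = closedAnnulus ρ R := by
  ext z
  simp [closedAnnulus, and_comm]

lemma ball_sdiff_closedBall (ρ R : ℝ) :
    Metric.ball (0 : ℂ) R \ Metric.closedBall 0 ρ = openAnnulus ρ R := by
  ext z
  simp [openAnnulus, and_comm]

/-- Two concentric circles give the same integral of a function holomorphic between them. -/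
lemma circleIntegral_eq_of_differentiableOn_openAnnulus {ρ R : ℝ} (hρ : 0 < ρ) (hρR : ρ ≤ R)
    {G : ℂ → ℂ} (hc : ContinuousOn G (closedAnnulus ρ R))
    (hd : DifferentiableOn ℂ G (openAnnulus ρ R)) :
    (∮ z in C(0, R), G z) = ∮ z in C(0, ρ), G z := by
  refine Complex.circleIntegral_eq_of_differentiable_on_annulus_off_countable hρ hρR
    countable_empty ?_ ?_
  · rwa [closedBall_sdiff_ball]
  · rw [ball_sdiff_closedBall, sdiff_empty]
    exact fun z hz => hd.differentiableAt ((isOpen_openAnnulus ρ R).mem_nhds hz)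

/-- Cauchy's integral formula for an annulus. -/
lemma cauchy_annulus {ρ R : ℝ} (hρ : 0 < ρ) {G : ℂ → ℂ}
    (hc : ContinuousOn G (closedAnnulus ρ R)) (hd : DifferentiableOn ℂ G (openAnnulus ρ R))
    {w : ℂ} (hw : w ∈ openAnnulus ρ R) :
    (∮ z in C(0, R), (z - w)⁻¹ * G z) - (∮ z in C(0, ρ), (z - w)⁻¹ * G z) =
      2 * (Real.pi : ℂ) * Complex.I * G w := by
  have hρR : ρ < R := hw.1.trans hw.2
  have hsub : openAnnulus ρ R ⊆ closedAnnulus ρ R := fun z hz => ⟨hz.1.le, hz.2.le⟩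
  have hnhds := (isOpen_openAnnulus ρ R).mem_nhds hw
  -- The divided difference of `G` at `w` is holomorphic across `w`, so its integrals over the two
  -- circles agree. Expanding them leaves the integrals of `1/(z - w)`, which are `2πi` on the outer
  -- circle and `0` on the inner one.
  have hd' : DifferentiableOn ℂ (dslope G w) (openAnnulus ρ R) :=
    (Complex.differentiableOn_dslope hnhds).2 hd
  have hc' : ContinuousOn (dslope G w) (closedAnnulus ρ R) :=
    (continuousOn_dslope (mem_of_superset hnhds hsub)).2 ⟨hc, hd.differentiableAt hnhds⟩
  have hsph : ∀ r, (r = ρ ∨ r = R) → Metric.sphere (0 : ℂ) r ⊆ closedAnnulus ρ R := by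
    rintro r (rfl | rfl) z hz <;> rw [mem_sphere_zero_iff_norm] at hz <;>
      simp [closedAnnulus, hz, hρR.le]
  have key : ∀ r, (r = ρ ∨ r = R) → (∮ z in C(0, r), dslope G w z) =
      (∮ z in C(0, r), (z - w)⁻¹ * G z) - (∮ z in C(0, r), (z - w)⁻¹) * G w := by
    intro r hr
    have hr0 : 0 ≤ r := by rcases hr with rfl | rfl <;> linarith
    have hne : ∀ z ∈ Metric.sphere (0 : ℂ) r, z - w ≠ 0 := by
      intro z hz e
      rw [mem_sphere_zero_iff_norm, sub_eq_zero.1 e] at hz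
      rcases hr with rfl | rfl
      · exact hw.1.ne' hz
      · exact hw.2.ne hz
    have hci : ContinuousOn (fun z => (z - w)⁻¹) (Metric.sphere (0 : ℂ) r) :=
      ContinuousOn.inv₀ (by fun_prop) hne
    have hcG := hc.mono (hsph r hr)
    rw [mul_comm _ (G w), ← smul_eq_mul (G w), ← circleIntegral.integral_smul,
      ← circleIntegral.integral_sub (f := fun z => (z - w)⁻¹ * G z) (g := fun z => G w • (z - w)⁻¹)
        ((hci.mul hcG).circleIntegrable hr0) ((hci.const_smul (G w)).circleIntegrable hr0)]
    refine circleIntegral.integral_congr hr0 fun z hz => ?_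
    have hzw : z ≠ w := sub_ne_zero.1 (hne z hz)
    simp only [dslope_of_ne _ hzw, slope_def_field, smul_eq_mul]
    field_simp [hne z hz]
  have h := circleIntegral_eq_of_differentiableOn_openAnnulus hρ hρR.le hc' hd'
  rw [key R (Or.inr rfl), key ρ (Or.inl rfl),
    circleIntegral.integral_sub_inv_of_mem_ball (by simpa using hw.2)] at h
  have h0 : (∮ z in C(0, ρ), (z - w)⁻¹) = 0 := by
    refine Complex.circleIntegral_eq_zero_of_differentiable_on_off_countable hρ.le countable_empty
      (ContinuousOn.inv₀ (by fun_prop) fun z hz e => ?_) fun z hz => ?_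
    · rw [sub_eq_zero.1 e, mem_closedBall_zero_iff] at hz
      exact absurd hz (not_le.2 hw.1)
    · refine DifferentiableAt.inv (by fun_prop) fun e => ?_
      rw [sub_eq_zero.1 e] at hz
      have : ‖w‖ < ρ := by simpa using hz
      exact absurd this (not_lt.2 hw.1.le)
  rw [h0] at h
  linear_combination h

/-- A closed curve in an annulus winding once about the origin is homologous to a circle. -/
theorem IsClosedCurve.integral_eq_circleIntegral (h : IsClosedCurve γ) (h0 : WindsAround γ 0 1)
    {ρ R : ℝ} (hρ : 0 < ρ) (hγ : ∀ u ∈ Icc (0 : ℝ) 1, γ u ∈ openAnnulus ρ R) {G : ℂ → ℂ}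
    (hc : ContinuousOn G (closedAnnulus ρ R)) (hd : DifferentiableOn ℂ G (openAnnulus ρ R)) :
    ∫ u in (0 : ℝ)..1, G (γ u) * deriv γ u = ∮ z in C(0, ρ), G z := by
  have hR : 0 < R := hρ.trans ((hγ 0 (by simp)).1.trans (hγ 0 (by simp)).2)
  have hρR : ρ < R := (hγ 0 (by simp)).1.trans (hγ 0 (by simp)).2
  have hsph : ∀ r, (r = ρ ∨ r = R) → Metric.sphere (0 : ℂ) r ⊆ closedAnnulus ρ R := by
    rintro r (rfl | rfl) z hz <;> rw [mem_sphere_zero_iff_norm] at hz <;>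
      simp [closedAnnulus, hz, hρR.le]
  have s₁ := h.integral_circleIntegral_swap hR.le (fun u hu => (hγ u hu).2.ne)
    (hc.mono (hsph R (Or.inr rfl)))
  have s₂ := h.integral_circleIntegral_swap hρ.le (fun u hu => (hγ u hu).1.ne')
    (hc.mono (hsph ρ (Or.inl rfl)))
  have neg_inv (z : ℂ) : ∫ u in (0 : ℝ)..1, (z - γ u)⁻¹ * deriv γ u =
      -∫ u in (0 : ℝ)..1, (γ u - z)⁻¹ * deriv γ u := by
    rw [← intervalIntegral.integral_neg]
    refine intervalIntegral.integral_congr fun u _ => ?_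
    rw [← neg_sub (γ u) z, inv_neg, neg_mul]
  -- After inserting Cauchy's formula at `γ u` and exchanging integrals, the inner integral is minus
  -- `2πi` times a winding number about `z`: zero for `z` on the outer circle, that of the origin
  -- for `z` on the inner one. Only the inner circle contributes.
  have e₁ : (∮ z in C(0, R), (∫ u in (0 : ℝ)..1, (z - γ u)⁻¹ * deriv γ u) * G z) = 0 := by
    rw [circleIntegral.integral_congr (g := fun _ => 0) hR.le]
    · simp [circleIntegral]
    · intro z hz
      beta_reduce
      rw [neg_inv, h.integral_inv_eq_zero_of_norm_lt, neg_zero, zero_mul]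
      intro u hu
      rw [mem_sphere_zero_iff_norm.1 hz]
      exact (hγ u hu).2
  have hw : ∫ u in (0 : ℝ)..1, (γ u)⁻¹ * deriv γ u = 2 * (Real.pi : ℂ) * Complex.I := by
    simpa using h0.integral_eq
  have e₂ : (∮ z in C(0, ρ), (∫ u in (0 : ℝ)..1, (z - γ u)⁻¹ * deriv γ u) * G z) =
      -(2 * (Real.pi : ℂ) * Complex.I) * ∮ z in C(0, ρ), G z := by
    rw [← smul_eq_mul (-_), ← circleIntegral.integral_smul]
    refine circleIntegral.integral_congr hρ.le fun z hz => ?_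
    rw [neg_inv, h.integral_inv_eq_of_lt_norm, hw, smul_eq_mul]
    intro u hu
    rw [mem_sphere_zero_iff_norm.1 hz]
    exact (hγ u hu).1
  have hsub : ∫ u in (0 : ℝ)..1, ((∮ z in C(0, R), (z - γ u)⁻¹ * G z) -
      (∮ z in C(0, ρ), (z - γ u)⁻¹ * G z)) * deriv γ u =
      (2 * (Real.pi : ℂ) * Complex.I) * ∫ u in (0 : ℝ)..1, G (γ u) * deriv γ u := by
    rw [← intervalIntegral.integral_const_mul]
    refine intervalIntegral.integral_congr fun u hu => ?_
    rw [uIcc_of_le zero_le_one] at hu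
    rw [cauchy_annulus hρ hc hd (hγ u hu), mul_assoc]
  simp only [sub_mul] at hsub
  rw [intervalIntegral.integral_sub s₁.1 s₂.1, s₁.2, s₂.2, e₁, e₂] at hsub
  refine mul_left_cancel₀ Complex.two_pi_I_ne_zero ?_
  linear_combination -hsub


/-- Partial fraction decomposition of `N(x) / ∏ (x - P i)` with `N` holomorphic. -/
lemma exists_partialFraction {ι : Type*} [DecidableEq ι] {U : Set ℂ} (hU : IsOpen U) (P : ι → ℂ)
    {N : ℂ → ℂ} (hN : DifferentiableOn ℂ N U) (S : Finset ι) (hP : Set.InjOn P S)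
    (hPU : ∀ i ∈ S, P i ∈ U) :
    ∃ (G : ℂ → ℂ) (c : ι → ℂ), DifferentiableOn ℂ G U ∧
      ∀ x, (∀ i ∈ S, x ≠ P i) → N x / ∏ i ∈ S, (x - P i) = G x + ∑ i ∈ S, c i / (x - P i) := by
  induction S using Finset.induction_on with
  | empty => exact ⟨N, fun _ => 0, hN, by simp⟩
  | insert a S ha ih =>
    obtain ⟨G, c, hG, hGc⟩ := ih (hP.mono (by simp)) fun i hi => hPU i (Finset.mem_insert_of_mem hi)
    have hne : ∀ i ∈ S, P i - P a ≠ 0 := fun i hi e => by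
      have := hP (Finset.mem_insert_of_mem hi) (Finset.mem_insert_self a S) (sub_eq_zero.1 e)
      exact ha (this ▸ hi)
    -- Dividing the earlier decomposition by `x - P a`, the part `G` splits as `G(x)/(x - P a) =
    -- dslope G (P a) x + G(P a)/(x - P a)`. Each simple fraction splits by `1/((x-P_i)(x-P_a)) =
    -- (1/(x-P_i) - 1/(x-P_a))/(P_i-P_a)`.
    refine ⟨dslope G (P a), fun i => if i = a then G (P a) - ∑ j ∈ S, c j / (P j - P a)
      else c i / (P i - P a),
      (Complex.differentiableOn_dslope (hU.mem_nhds (hPU a (Finset.mem_insert_self a S)))).2 hG,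
      fun x hx => ?_⟩
    have hxa : x ≠ P a := hx a (Finset.mem_insert_self a S)
    have hxa' : x - P a ≠ 0 := sub_ne_zero.2 hxa
    rw [Finset.prod_insert ha, Finset.sum_insert ha]
    beta_reduce
    rw [if_pos rfl, mul_comm (x - P a), ← div_div,
      hGc x fun i hi => hx i (Finset.mem_insert_of_mem hi), dslope_of_ne _ hxa, slope_def_field]
    have e : ∑ i ∈ S, (if i = a then G (P a) - ∑ j ∈ S, c j / (P j - P a)
        else c i / (P i - P a)) / (x - P i) =
        ∑ i ∈ S, (c i / (x - P i) / (x - P a) + c i / (P i - P a) / (x - P a)) := by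
      refine Finset.sum_congr rfl fun i hi => ?_
      rw [if_neg fun e : i = a => ha (e ▸ hi)]
      have h₁ := hne i hi
      have h₂ : x - P i ≠ 0 := sub_ne_zero.2 (hx i (Finset.mem_insert_of_mem hi))
      field_simp
      ring
    rw [e, Finset.sum_add_distrib, ← Finset.sum_div, ← Finset.sum_div]
    field_simp
    ring

/-- The integrals of a meromorphic function with simple poles along a closed curve and along the
unit circle differ by the residues at the poles about which the winding numbers differ. -/
theorem IsClosedCurve.integral_eq_unitCircle_add_residues (h : IsClosedCurve γ)
    (h0 : WindsAround γ 0 1) {ι : Type*} [DecidableEq ι] {ρ R : ℝ} (hρ : 0 < ρ) (hρ₁ : ρ < 1)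
    (hR₁ : 1 < R) (hγ : ∀ u ∈ Icc (0 : ℝ) 1, γ u ∈ openAnnulus ρ R) (S : Finset ι) (P : ι → ℂ)
    (hP : Set.InjOn P S) (hPU : ∀ i ∈ S, P i ∈ openAnnulus ρ R) (hP₁ : ∀ i ∈ S, ‖P i‖ ≠ 1)
    (m : ι → ℤ) (hm : ∀ i ∈ S, WindsAround γ (P i) (m i))
    {N F : ℂ → ℂ} (hN : DifferentiableOn ℂ N (openAnnulus ρ R))
    (hF : ∀ x ∈ openAnnulus ρ R, (∀ i ∈ S, x ≠ P i) → F x = N x / ∏ i ∈ S, (x - P i))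
    {K : ι → ℂ → ℂ}
    (hK : ∀ i ∈ S, (m i : ℂ) ≠ (if ‖P i‖ < 1 then 1 else 0) → ContinuousAt (K i) (P i))
    (hFK : ∀ i ∈ S, (m i : ℂ) ≠ (if ‖P i‖ < 1 then 1 else 0) → ∀ᶠ x in 𝓝[≠] P i, F x = K i x / (x - P i)) :
    ∫ u in (0 : ℝ)..1, F (γ u) * deriv γ u = (∮ z in C(0, 1), F z) +
      2 * (Real.pi : ℂ) * Complex.I *
        ∑ i ∈ S, ((m i : ℂ) - if ‖P i‖ < 1 then 1 else 0) * K i (P i) := by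
  have hUo := isOpen_openAnnulus ρ R
  obtain ⟨G, c, hG, hGc⟩ := exists_partialFraction hUo P hN S hP hPU
  have hFG : ∀ x ∈ openAnnulus ρ R, (∀ i ∈ S, x ≠ P i) → F x = G x + ∑ i ∈ S, c i / (x - P i) :=
    fun x hx hxP => (hF x hx hxP).trans (hGc x hxP)
  -- identification of the residues
  have hcK : ∀ i ∈ S, (m i : ℂ) ≠ (if ‖P i‖ < 1 then 1 else 0) → c i = K i (P i) := by
    intro i hi hmi
    have hne : ∀ᶠ x in 𝓝[≠] P i, ∀ j ∈ S, x ≠ P j := by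
      rw [Filter.eventually_all_finset]
      intro j hj
      by_cases hij : P j = P i
      · rw [hij]; exact self_mem_nhdsWithin
      · exact nhdsWithin_le_nhds (isOpen_ne.mem_nhds (Ne.symm hij))
    have hmem : ∀ᶠ x in 𝓝[≠] P i, x ∈ openAnnulus ρ R :=
      nhdsWithin_le_nhds (hUo.mem_nhds (hPU i hi))
    have l₁ : Tendsto (fun x => F x * (x - P i)) (𝓝[≠] P i) (𝓝 (K i (P i))) := by
      refine ((hK i hi hmi).tendsto.mono_left nhdsWithin_le_nhds).congr' ?_
      filter_upwards [hFK i hi hmi, self_mem_nhdsWithin] with x hx hx'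
      rw [hx, div_mul_cancel₀ _ (sub_ne_zero.2 hx')]
    have l₂ : Tendsto (fun x => (G x + ∑ j ∈ S.erase i, c j / (x - P j)) * (x - P i) + c i)
        (𝓝[≠] P i) (𝓝 ((G (P i) + ∑ j ∈ S.erase i, c j / (P i - P j)) * (P i - P i) + c i)) := by
      have hcG : ContinuousAt G (P i) := (hG.differentiableAt (hUo.mem_nhds (hPU i hi))).continuousAt
      have : ContinuousAt (fun x => (G x + ∑ j ∈ S.erase i, c j / (x - P j)) * (x - P i) + c i)
          (P i) := by
        refine ((hcG.add (tendsto_finsetSum _ fun j hj => ?_)).mul (by fun_prop)).add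
          continuousAt_const
        refine ContinuousAt.div (f := fun _ => c j) (g := fun x => x - P j) continuousAt_const
          (by fun_prop) (sub_ne_zero.2 fun e => ?_)
        exact (Finset.ne_of_mem_erase hj) (hP (Finset.mem_of_mem_erase hj) hi e.symm)
      exact this.tendsto.mono_left nhdsWithin_le_nhds
    rw [sub_self, mul_zero, zero_add] at l₂
    refine tendsto_nhds_unique (l₂.congr' ?_) l₁
    filter_upwards [hne, hmem] with x hx hx'
    rw [hFG x hx' hx, ← Finset.add_sum_erase S _ hi]
    linear_combination -div_mul_cancel₀ (c i) (sub_ne_zero.2 (hx i hi))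
  have hsubU : closedAnnulus ρ R ⊇ openAnnulus ρ R := fun z hz => ⟨hz.1.le, hz.2.le⟩
  -- a slightly smaller closed annulus containing the curve and the unit circle
  obtain ⟨ρ', hρ', hρ'1, hρ'γ⟩ : ∃ ρ', ρ < ρ' ∧ ρ' < 1 ∧ ∀ u ∈ Icc (0 : ℝ) 1, ρ' < ‖γ u‖ := by
    obtain ⟨u₀, hu₀, hmin⟩ := isCompact_Icc.exists_isMinOn (nonempty_Icc.2 zero_le_one)
      h.continuousOn.norm
    obtain ⟨ρ', h₁, h₂⟩ := exists_between (lt_min hρ₁ (hγ u₀ hu₀).1)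
    exact ⟨ρ', h₁, h₂.trans_le (min_le_left _ _), fun u hu =>
      (h₂.trans_le (min_le_right _ _)).trans_le (hmin hu)⟩
  obtain ⟨R', hR', hR'1, hR'γ⟩ : ∃ R', R' < R ∧ 1 < R' ∧ ∀ u ∈ Icc (0 : ℝ) 1, ‖γ u‖ < R' := by
    obtain ⟨u₀, hu₀, hmax⟩ := isCompact_Icc.exists_isMaxOn (nonempty_Icc.2 zero_le_one)
      h.continuousOn.norm
    obtain ⟨R', h₁, h₂⟩ := exists_between (max_lt hR₁ (hγ u₀ hu₀).2)
    exact ⟨R', h₂, (le_max_left _ _).trans_lt h₁, fun u hu =>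
      (hmax hu).trans_lt ((le_max_right _ _).trans_lt h₁)⟩
  have hs₁ : closedAnnulus ρ' R' ⊆ openAnnulus ρ R := fun z hz =>
    ⟨hρ'.trans_le hz.1, hz.2.trans_lt hR'⟩
  have hs₂ : openAnnulus ρ' R' ⊆ openAnnulus ρ R := fun z hz =>
    ⟨hρ'.trans hz.1, hz.2.trans hR'⟩
  have hs₃ : closedAnnulus ρ' 1 ⊆ openAnnulus ρ R := fun z hz =>
    ⟨hρ'.trans_le hz.1, hz.2.trans_lt hR₁⟩
  have hs₄ : openAnnulus ρ' 1 ⊆ openAnnulus ρ R := fun z hz =>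
    ⟨hρ'.trans hz.1, hz.2.trans hR₁⟩
  have iG := h.integral_eq_circleIntegral h0 (hρ.trans hρ') (fun u hu => ⟨hρ'γ u hu, hR'γ u hu⟩)
    (hG.continuousOn.mono hs₁) (hG.mono hs₂)
  rw [← circleIntegral_eq_of_differentiableOn_openAnnulus (hρ.trans hρ') hρ'1.le
    (hG.continuousOn.mono hs₃) (hG.mono hs₄)] at iG
  have hγP : ∀ i ∈ S, ContinuousOn (fun u => (γ u - P i)⁻¹) (Icc 0 1) := fun i hi =>
    ContinuousOn.inv₀ (h.continuousOn.sub continuousOn_const) fun u hu =>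
      sub_ne_zero.2 ((hm i hi).1 u hu)
  have hsph : Metric.sphere (0 : ℂ) 1 ⊆ openAnnulus ρ R := fun z hz => by
    rw [mem_sphere_zero_iff_norm] at hz
    exact ⟨hz ▸ hρ₁, hz ▸ hR₁⟩
  have hzP : ∀ i ∈ S, ∀ z ∈ Metric.sphere (0 : ℂ) 1, z ≠ P i := fun i hi z hz e => by
    rw [mem_sphere_zero_iff_norm, e] at hz
    exact hP₁ i hi hz
  have hcP : ∀ i ∈ S, ContinuousOn (fun z : ℂ => (z - P i)⁻¹) (Metric.sphere 0 1) := fun i hi =>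
    ContinuousOn.inv₀ (by fun_prop) fun z hz => sub_ne_zero.2 (hzP i hi z hz)
  have jγ : ∫ u in (0 : ℝ)..1, F (γ u) * deriv γ u = (∫ u in (0 : ℝ)..1, G (γ u) * deriv γ u) +
      ∑ i ∈ S, c i * (2 * (Real.pi : ℂ) * Complex.I * m i) := by
    rw [← Finset.sum_congr rfl fun i hi => congrArg (c i * ·) (hm i hi).integral_eq]
    simp only [← intervalIntegral.integral_const_mul]
    have hint : ∀ i ∈ S, IntervalIntegrable (fun u => c i * ((γ u - P i)⁻¹ * deriv γ u))
        volume 0 1 := fun i hi => (h.intervalIntegrable_mul_deriv (hγP i hi)).const_mul (c i)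
    have hsum := IntervalIntegrable.sum S hint
    rw [Finset.sum_fn] at hsum
    rw [← intervalIntegral.integral_finsetSum hint,
      ← intervalIntegral.integral_add (f := fun u => G (γ u) * deriv γ u)
        (h.intervalIntegrable_mul_deriv (hG.continuousOn.comp h.continuousOn hγ)) hsum]
    refine intervalIntegral.integral_congr fun u hu => ?_
    rw [uIcc_of_le zero_le_one] at hu
    rw [hFG _ (hγ u hu) fun i hi => (hm i hi).1 u hu, add_mul, Finset.sum_mul]
    congr 1
    refine Finset.sum_congr rfl fun i hi => ?_
    rw [div_eq_mul_inv, mul_assoc]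
  have kP : ∀ i ∈ S, (∮ z in C(0, 1), (z - P i)⁻¹) =
      2 * (Real.pi : ℂ) * Complex.I * if ‖P i‖ < 1 then 1 else 0 := by
    intro i hi
    split_ifs with hlt
    · rw [circleIntegral.integral_sub_inv_of_mem_ball (by simpa using hlt), mul_one]
    · have hgt : 1 < ‖P i‖ := lt_of_le_of_ne (not_lt.1 hlt) (hP₁ i hi).symm
      rw [mul_zero]
      refine Complex.circleIntegral_eq_zero_of_differentiable_on_off_countable zero_le_one
        countable_empty (ContinuousOn.inv₀ (by fun_prop) fun z hz e => ?_) fun z hz => ?_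
      · rw [sub_eq_zero.1 e, mem_closedBall_zero_iff] at hz
        exact absurd hz (not_le.2 hgt)
      · refine DifferentiableAt.inv (by fun_prop) fun e => ?_
        rw [sub_eq_zero.1 e] at hz
        have : ‖P i‖ < 1 := by simpa using hz
        exact absurd this hlt
  have jC : (∮ z in C(0, 1), F z) = (∮ z in C(0, 1), G z) +
      ∑ i ∈ S, c i * (2 * (Real.pi : ℂ) * Complex.I * if ‖P i‖ < 1 then 1 else 0) := by
    have hci : ∀ i ∈ S, CircleIntegrable (fun z => c i * (z - P i)⁻¹) 0 1 := fun i hi =>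
      (continuousOn_const.mul (hcP i hi)).circleIntegrable zero_le_one
    rw [← Finset.sum_congr rfl fun i hi => congrArg (c i * ·) (kP i hi)]
    simp only [← circleIntegral.integral_const_mul]
    have hsum := CircleIntegrable.sum S hci
    rw [Finset.sum_fn] at hsum
    rw [← circleIntegral.integral_fun_sum hci, ← circleIntegral.integral_add
      ((hG.continuousOn.mono hsph).circleIntegrable zero_le_one) hsum]
    refine circleIntegral.integral_congr zero_le_one fun z hz => ?_
    rw [hFG z (hsph hz) fun i hi => hzP i hi z hz]
    simp only [div_eq_mul_inv]
  rw [jγ, jC, iG, add_assoc, Finset.mul_sum, ← Finset.sum_add_distrib]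
  congr 1
  refine Finset.sum_congr rfl fun i hi => ?_
  -- Where the curve and the circle wind equally often about the pole, the two contributions cancel
  -- and the value of the residue is not needed.
  by_cases hmi : (m i : ℂ) = if ‖P i‖ < 1 then 1 else 0
  · rw [hmi]
    ring
  · rw [hcK i hi hmi]
    ring

end Residue

/-! ### Zeros of the denominator of the one-variable weight -/

section Poles

variable {q : ℝ} {a b ε : ℂ}

/-- The numbers `ε⁻¹ q^{1/2}`, `ε b q^{1/2}`, `-a q^{1/2}`. -/
noncomputable def poleBase (q : ℝ) (a b ε : ℂ) (i : Fin 3) : ℂ :=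
  (![ε⁻¹, ε * b, -a] : Fin 3 → ℂ) i * (√q : ℝ)

lemma pole_eq (i : Fin 3) (s : ℕ) : pole q a b ε i s = poleBase q a b ε i * (q : ℂ) ^ s := by
  simp only [pole, poleBase]
  ring

lemma ofReal_sqrt_ne_zero (hq₀ : 0 < q) : ((√q : ℝ) : ℂ) ≠ 0 := by
  exact_mod_cast (Real.sqrt_pos.2 hq₀).ne'

lemma ofReal_sqrt_sq (hq₀ : 0 < q) : ((√q : ℝ) : ℂ) ^ 2 = q := by
  rw [← Complex.ofReal_pow, Real.sq_sqrt hq₀.le]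

lemma poleBase_ne_zero (hq₀ : 0 < q) (ha : a ≠ 0) (hb : b ≠ 0) (hε : ε ≠ 0) (i : Fin 3) :
    poleBase q a b ε i ≠ 0 := by
  have := ofReal_sqrt_ne_zero hq₀
  fin_cases i <;> simp [poleBase, ha, hb, hε, this]

/-- `∏ (c x, c / x)_∞` over the numbers `c` of `poleBase`. -/
noncomputable def poleDenom (q : ℝ) (a b ε x : ℂ) : ℂ :=
  ∏ i, qInf q (poleBase q a b ε i * x) * qInf q (poleBase q a b ε i * x⁻¹)

/-- `poleDenom` with the factor vanishing at `ε⁻¹ q^{s+1/2}` removed. -/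
noncomputable def poleDenomRes (q : ℝ) (a b ε : ℂ) (s : ℕ) (x : ℂ) : ℂ :=
  qInf q (poleBase q a b ε 0 * x) *
    (qFin q (poleBase q a b ε 0 * x⁻¹) s * qInf q (poleBase q a b ε 0 * x⁻¹ * (q : ℂ) ^ (s + 1))) *
    (qInf q (poleBase q a b ε 1 * x) * qInf q (poleBase q a b ε 1 * x⁻¹)) *
    (qInf q (poleBase q a b ε 2 * x) * qInf q (poleBase q a b ε 2 * x⁻¹))

lemma poleDenom_inv (x : ℂ) : poleDenom q a b ε x⁻¹ = poleDenom q a b ε x := by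
  simp only [poleDenom, inv_inv]
  exact Finset.prod_congr rfl fun i _ => mul_comm _ _

lemma qInf_eq_mul_removed (hq₀ : 0 < q) (hq₁ : q < 1) (x : ℂ) (s : ℕ) :
    qInf q x = (1 - x * (q : ℂ) ^ s) * (qFin q x s * qInf q (x * (q : ℂ) ^ (s + 1))) := by
  rw [qInf_eq_qFin_mul hq₀ hq₁ x (s + 1), qFin, Finset.prod_range_succ, ← qFin]
  ring

lemma poleDenom_eq_mul (hq₀ : 0 < q) (hq₁ : q < 1) (s : ℕ) (x : ℂ) :
    poleDenom q a b ε x = (1 - pole q a b ε 0 s * x⁻¹) * poleDenomRes q a b ε s x := by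
  rw [poleDenom, poleDenomRes, Fin.prod_univ_three,
    qInf_eq_mul_removed hq₀ hq₁ (poleBase q a b ε 0 * x⁻¹) s, pole_eq]
  ring

lemma continuousAt_poleDenomRes (hq₀ : 0 < q) (hq₁ : q < 1) (s : ℕ) {x : ℂ} (hx : x ≠ 0) :
    ContinuousAt (poleDenomRes q a b ε s) x := by
  have h₁ (c : ℂ) : ContinuousAt (fun x => qInf q (c * x)) x :=
    ((continuous_qInf hq₀ hq₁).comp (continuous_const_mul c)).continuousAt
  have hi (c d : ℂ) : ContinuousAt (fun x => c * x⁻¹ * d) x :=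
    (continuousAt_const.mul (continuousAt_id.inv₀ hx)).mul continuousAt_const
  have hi' (c : ℂ) : ContinuousAt (fun x => c * x⁻¹) x :=
    continuousAt_const.mul (continuousAt_id.inv₀ hx)
  have h₂ (c : ℂ) : ContinuousAt (fun x => qInf q (c * x⁻¹)) x :=
    ContinuousAt.comp (g := qInf q) (continuous_qInf hq₀ hq₁).continuousAt (hi' c)
  have h₃ (c d : ℂ) : ContinuousAt (fun x => qInf q (c * x⁻¹ * d)) x :=
    ContinuousAt.comp (g := qInf q) (continuous_qInf hq₀ hq₁).continuousAt (hi c d)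
  have h₄ (c : ℂ) : ContinuousAt (fun x => qFin q (c * x⁻¹) s) x :=
    ContinuousAt.comp (g := fun x => qFin q x s) (continuous_qFin s).continuousAt (hi' c)
  exact (((h₁ _).mul ((h₄ _).mul (h₃ _ _))).mul ((h₁ _).mul (h₂ _))).mul ((h₁ _).mul (h₂ _))

/-- The points `x_s, y_s, z_s` and their reciprocals, as a single family. -/
noncomputable def polePoint (q : ℝ) (a b ε : ℂ) (m : Bool × Fin 3 × ℕ) : ℂ :=
  if m.1 then pole q a b ε m.2.1 m.2.2 else (pole q a b ε m.2.1 m.2.2)⁻¹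

lemma pole_ne_zero (hq₀ : 0 < q) (ha : a ≠ 0) (hb : b ≠ 0) (hε : ε ≠ 0) (i : Fin 3) (s : ℕ) :
    pole q a b ε i s ≠ 0 := by
  rw [pole_eq]
  exact mul_ne_zero (poleBase_ne_zero hq₀ ha hb hε i) (pow_ne_zero _ (ofReal_ne_zero_of_pos hq₀))

/-- A vanishing factor would make a pole equal to the reciprocal of a pole, against genericity. -/
lemma qInf_pole_ne_zero (hq₀ : 0 < q) (hq₁ : q < 1) (ha : a ≠ 0) (hb : b ≠ 0) (hε : ε ≠ 0)
    (hinj : Function.Injective (polePoint q a b ε)) (i j : Fin 3) (s : ℕ) :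
    qInf q (poleBase q a b ε i * pole q a b ε j s) ≠ 0 := by
  refine qInf_ne_zero hq₀ hq₁ fun m hm => ?_
  have hp := pole_ne_zero hq₀ ha hb hε j s
  have : polePoint q a b ε (true, i, m) = polePoint q a b ε (false, j, s) := by
    simp only [polePoint, if_true, Bool.false_eq_true, if_false]
    refine eq_inv_of_mul_eq_one_left ?_
    rw [pole_eq i m]
    linear_combination hm
  simpa using hinj this

/-- A vanishing factor would make poles of two different families coincide. -/
lemma qInf_pole_inv_ne_zero (hq₀ : 0 < q) (hq₁ : q < 1) (ha : a ≠ 0) (hb : b ≠ 0) (hε : ε ≠ 0)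
    (hinj : Function.Injective (polePoint q a b ε)) {i j : Fin 3} (hij : i ≠ j) (s : ℕ) :
    qInf q (poleBase q a b ε i * (pole q a b ε j s)⁻¹) ≠ 0 := by
  refine qInf_ne_zero hq₀ hq₁ fun m hm => ?_
  have hp := pole_ne_zero hq₀ ha hb hε j s
  have : polePoint q a b ε (true, i, m) = polePoint q a b ε (true, j, s) := by
    simp only [polePoint, if_true]
    rw [pole_eq i m]
    field_simp at hm
    linear_combination hm
  have h := hinj this
  simp only [Prod.mk.injEq, true_and] at h
  exact hij h.1

lemma qFin_ne_zero_of_ne (s : ℕ) {x : ℂ} (h : ∀ i < s, x * (q : ℂ) ^ i ≠ 1) : qFin q x s ≠ 0 :=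
  Finset.prod_ne_zero_iff.2 fun i hi => sub_ne_zero.2 (h i (Finset.mem_range.1 hi)).symm

lemma poleDenomRes_pole (hq₀ : 0 < q) (ha : a ≠ 0) (hb : b ≠ 0) (hε : ε ≠ 0) (s : ℕ) :
    poleDenomRes q a b ε s (pole q a b ε 0 s) =
      qInf q (poleBase q a b ε 0 * pole q a b ε 0 s) * (qFin q ((q : ℂ) ^ s)⁻¹ s * qInf q q) *
    (qInf q (poleBase q a b ε 1 * pole q a b ε 0 s) *
      qInf q (poleBase q a b ε 1 * (pole q a b ε 0 s)⁻¹)) *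
    (qInf q (poleBase q a b ε 2 * pole q a b ε 0 s) *
      qInf q (poleBase q a b ε 2 * (pole q a b ε 0 s)⁻¹)) := by
  have h₀ := poleBase_ne_zero hq₀ ha hb hε 0
  have hq := ofReal_ne_zero_of_pos hq₀
  have e : poleBase q a b ε 0 * (pole q a b ε 0 s)⁻¹ = ((q : ℂ) ^ s)⁻¹ := by
    rw [pole_eq]
    field_simp
  have e' : ((q : ℂ) ^ s)⁻¹ * (q : ℂ) ^ (s + 1) = q := by
    rw [pow_succ]
    field_simp
  rw [poleDenomRes, e, e']

lemma poleDenomRes_pole_ne_zero (hq₀ : 0 < q) (hq₁ : q < 1) (ha : a ≠ 0) (hb : b ≠ 0) (hε : ε ≠ 0)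
    (hinj : Function.Injective (polePoint q a b ε)) (s : ℕ) :
    poleDenomRes q a b ε s (pole q a b ε 0 s) ≠ 0 := by
  have hq := ofReal_ne_zero_of_pos hq₀
  have h₁ := qInf_pole_ne_zero hq₀ hq₁ ha hb hε hinj
  have h₂ : qInf q (q : ℂ) ≠ 0 := qInf_ne_zero_of_norm_lt_one hq₀ hq₁ (by
    rwa [norm_ofReal_of_pos hq₀])
  have h₃ : qFin q ((q : ℂ) ^ s)⁻¹ s ≠ 0 := by
    refine qFin_ne_zero_of_ne s fun i hi e => ?_
    rw [inv_mul_eq_one₀ (pow_ne_zero _ hq)] at e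
    have e' : q ^ s = q ^ i := by exact_mod_cast e
    exact hi.ne' (pow_right_injective₀ hq₀ hq₁.ne e')
  rw [poleDenomRes_pole hq₀ ha hb hε]
  exact mul_ne_zero (mul_ne_zero (mul_ne_zero (h₁ _ _ _) (mul_ne_zero h₃ h₂))
    (mul_ne_zero (h₁ _ _ _) (qInf_pole_inv_ne_zero hq₀ hq₁ ha hb hε hinj (by decide) _)))
    (mul_ne_zero (h₁ _ _ _) (qInf_pole_inv_ne_zero hq₀ hq₁ ha hb hε hinj (by decide) _))

lemma prod_sub_mul_pow {x : ℂ} (hx : x ≠ 0) (c : ℂ) (m : ℕ) :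
    ∏ s ∈ Finset.range m, (x - c * (q : ℂ) ^ s) = x ^ m * qFin q (c * x⁻¹) m := by
  rw [qFin, ← Finset.card_range m, ← Finset.prod_const, Finset.card_range,
    ← Finset.prod_mul_distrib]
  refine Finset.prod_congr rfl fun i _ => ?_
  field_simp

lemma prod_sub_inv_mul_pow (hq₀ : 0 < q) (x : ℂ) {c : ℂ} (hc : c ≠ 0) (m : ℕ) :
    ∏ s ∈ Finset.range m, (x - (c * (q : ℂ) ^ s)⁻¹) =
      (∏ s ∈ Finset.range m, -(c * (q : ℂ) ^ s)⁻¹) * qFin q (c * x) m := by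
  have hq := ofReal_ne_zero_of_pos hq₀
  rw [qFin, ← Finset.prod_mul_distrib]
  refine Finset.prod_congr rfl fun i _ => ?_
  field_simp
  ring

end Poles

/-! ### From the deformed contour to the unit circle -/

section ResidueFormula

variable {q : ℝ} {a b ε : ℂ}

/-- Counts the points `c q^s` of modulus greater than `ρ`; only these enter the finite residue sum.
-/
lemma exists_minimal_index (hq₀ : 0 < q) (hq₁ : q < 1) (c : ℂ) {ρ : ℝ} (hρ : 0 < ρ) :
    ∃ m : ℕ, ‖c‖ * q ^ m ≤ ρ ∧ ∀ s < m, ρ < ‖c‖ * q ^ s := by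
  have hex : ∃ m : ℕ, ‖c‖ * q ^ m ≤ ρ := by
    have : Tendsto (fun m : ℕ => ‖c‖ * q ^ m) atTop (𝓝 (‖c‖ * 0)) :=
      (tendsto_pow_atTop_nhds_zero_of_lt_one hq₀.le hq₁).const_mul _
    rw [mul_zero] at this
    exact (this.eventually_le_const hρ).exists
  classical
  exact ⟨Nat.find hex, Nat.find_spec hex, fun s hs => not_le.1 (Nat.find_min hex hs)⟩

lemma norm_pole (hq₀ : 0 < q) (i : Fin 3) (s : ℕ) :
    ‖pole q a b ε i s‖ = ‖poleBase q a b ε i‖ * q ^ s := by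
  rw [pole_eq, norm_mul, norm_pow, norm_ofReal_of_pos hq₀]

/-- Evaluation of a contour integral with poles at the points `pole q a b ε i s` and at their
reciprocals: it is the sum of an integral over the unit circle and of residues. -/
theorem IsDeformedContour.integral_div_poleDenom (hq₀ : 0 < q) (hq₁ : q < 1) (ha : a ≠ 0)
    (hb : b ≠ 0) (hε : ε ≠ 0) (hinj : Function.Injective (polePoint q a b ε))
    (hne : ∀ i s, ‖pole q a b ε i s‖ ≠ 1) {r : ℕ} (hr : ∀ s, 1 < ‖pole q a b ε 0 s‖ ↔ s < r)
    (h₁ : ∀ s, ‖pole q a b ε 1 s‖ < 1) (h₂ : ∀ s, ‖pole q a b ε 2 s‖ < 1) {γ : ℝ → ℂ}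
    (hγ : IsDeformedContour q a b ε γ) {H : ℂ → ℂ} (hH : ∀ x ≠ 0, DifferentiableAt ℂ H x) :
    ∫ u in (0 : ℝ)..1, H (γ u) / poleDenom q a b ε (γ u) * deriv γ u =
      (∮ x in C(0, 1), H x / poleDenom q a b ε x) +
      2 * (Real.pi : ℂ) * Complex.I * ∑ s ∈ Finset.range r,
        (H (pole q a b ε 0 s) * pole q a b ε 0 s + H (pole q a b ε 0 s)⁻¹ * (pole q a b ε 0 s)⁻¹) /
          poleDenomRes q a b ε s (pole q a b ε 0 s) := by
  classical
  have hp0 := pole_ne_zero hq₀ ha hb hε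
  have hbase := poleBase_ne_zero hq₀ ha hb hε
  have hqne := ofReal_ne_zero_of_pos hq₀
  -- an annulus containing the curve
  obtain ⟨ρ, hρ, hρ₁, hργ, hργ', hρc⟩ : ∃ ρ : ℝ, 0 < ρ ∧ ρ < 1 ∧
      (∀ u ∈ Icc (0 : ℝ) 1, ρ < ‖γ u‖) ∧ (∀ u ∈ Icc (0 : ℝ) 1, ρ < ‖γ u‖⁻¹) ∧
      ∀ i, ρ < ‖poleBase q a b ε i‖⁻¹ := by
    have hγ0 : ∀ u ∈ Icc (0 : ℝ) 1, γ u ≠ 0 := hγ.origin.1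
    obtain ⟨u₀, hu₀, hmin⟩ := isCompact_Icc.exists_isMinOn (nonempty_Icc.2 zero_le_one)
      hγ.curve.continuousOn.norm
    obtain ⟨u₁, hu₁, hmin'⟩ := isCompact_Icc.exists_isMinOn (nonempty_Icc.2 zero_le_one)
      (hγ.curve.continuousOn.norm.inv₀ fun u hu => norm_ne_zero_iff.2 (hγ0 u hu))
    have e₀ : 0 < ‖γ u₀‖ := norm_pos_iff.2 (hγ0 u₀ hu₀)
    have e₁ : 0 < ‖γ u₁‖⁻¹ := inv_pos.2 (norm_pos_iff.2 (hγ0 u₁ hu₁))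
    have e₂ : ∀ i, 0 < ‖poleBase q a b ε i‖⁻¹ := fun i => inv_pos.2 (norm_pos_iff.2 (hbase i))
    obtain ⟨ρ, hρ, hρ'⟩ := exists_between (lt_min zero_lt_one (lt_min e₀ (lt_min e₁
      (lt_min (e₂ 0) (lt_min (e₂ 1) (e₂ 2))))))
    simp only [lt_min_iff] at hρ'
    refine ⟨ρ, hρ, hρ'.1, fun u hu => hρ'.2.1.trans_le (hmin hu),
      fun u hu => hρ'.2.2.1.trans_le (hmin' hu), fun i => ?_⟩
    fin_cases i
    · exact hρ'.2.2.2.1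
    · exact hρ'.2.2.2.2.1
    · exact hρ'.2.2.2.2.2
  -- The annulus `ρ < |z| < ρ⁻¹` is stable under inversion, and `ρ` is small enough that no pole has
  -- modulus `ρ⁻¹` or more. So it contains exactly the first `M i` poles of each family and their
  -- reciprocals.
  choose M hM hM' using fun i => exists_minimal_index hq₀ hq₁ (poleBase q a b ε i) hρ
  set S : Finset (Bool × Σ _ : Fin 3, ℕ) :=
    Finset.univ ×ˢ Finset.univ.sigma fun i => Finset.range (M i) with hS
  have hmemS : ∀ j : Bool × Σ _ : Fin 3, ℕ, j ∈ S ↔ j.2.2 < M j.2.1 := by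
    intro j
    simp [hS]
  set P : (Bool × Σ _ : Fin 3, ℕ) → ℂ := fun j => polePoint q a b ε (j.1, j.2.1, j.2.2) with hPdef
  have hPinj : Function.Injective P := by
    refine hinj.comp ?_
    rintro ⟨x, i, s⟩ ⟨x', i', s'⟩ e
    simp only [Prod.mk.injEq] at e
    obtain ⟨rfl, rfl, rfl⟩ := e
    rfl
  have hPtrue (i : Fin 3) (s : ℕ) : P (true, ⟨i, s⟩) = pole q a b ε i s := by
    simp [hPdef, polePoint]
  have hPfalse (i : Fin 3) (s : ℕ) : P (false, ⟨i, s⟩) = (pole q a b ε i s)⁻¹ := by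
    simp [hPdef, polePoint]
  have hpole_mem : ∀ i, ∀ s < M i, pole q a b ε i s ∈ openAnnulus ρ ρ⁻¹ := by
    intro i s hs
    rw [openAnnulus, mem_ofPred_eq, norm_pole hq₀]
    refine ⟨hM' i s hs, ?_⟩
    calc ‖poleBase q a b ε i‖ * q ^ s ≤ ‖poleBase q a b ε i‖ :=
          mul_le_of_le_one_right (norm_nonneg _) (pow_le_one₀ hq₀.le hq₁.le)
      _ < ρ⁻¹ := (lt_inv_comm₀ hρ (norm_pos_iff.2 (hbase i))).1 (hρc i)
  have hinv_mem : ∀ x ∈ openAnnulus ρ ρ⁻¹, x⁻¹ ∈ openAnnulus ρ ρ⁻¹ := by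
    rintro x ⟨h, h'⟩
    have hx : 0 < ‖x‖ := hρ.trans h
    rw [openAnnulus, mem_ofPred_eq, norm_inv]
    exact ⟨(lt_inv_comm₀ hρ hx).2 h', (inv_lt_inv₀ hx hρ).2 h⟩
  have hPU : ∀ j ∈ S, P j ∈ openAnnulus ρ ρ⁻¹ := by
    rintro ⟨x, i, s⟩ hj
    have := hpole_mem i s ((hmemS _).1 hj)
    cases x
    · rw [hPfalse]; exact hinv_mem _ this
    · rw [hPtrue]; exact this
  -- the factor without zeros in the annulus
  set tail : ℂ → ℂ := fun x => ∏ i, qInf q (poleBase q a b ε i * x * (q : ℂ) ^ M i) *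
    qInf q (poleBase q a b ε i * x⁻¹ * (q : ℂ) ^ M i) with htail
  have htail_ne : ∀ x ∈ openAnnulus ρ ρ⁻¹, tail x ≠ 0 := by
    have aux : ∀ i, ∀ x ∈ openAnnulus ρ ρ⁻¹,
        qInf q (poleBase q a b ε i * x * (q : ℂ) ^ M i) ≠ 0 := by
      intro i x hx
      refine qInf_ne_zero_of_norm_lt_one hq₀ hq₁ ?_
      rw [mul_right_comm, norm_mul, norm_mul, norm_pow, norm_ofReal_of_pos hq₀]
      have hx0 : 0 < ‖x‖ := hρ.trans hx.1
      calc ‖poleBase q a b ε i‖ * q ^ M i * ‖x‖ ≤ ρ * ‖x‖ := by gcongr; exact hM i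
        _ < ρ * ρ⁻¹ := by gcongr; exact hx.2
        _ = 1 := mul_inv_cancel₀ hρ.ne'
    exact fun x hx => Finset.prod_ne_zero_iff.2 fun i _ =>
      mul_ne_zero (aux i x hx) (aux i _ (hinv_mem x hx))
  -- This constant and the powers of `x` in `N` are what separates the monic product `∏ (x - P j)`
  -- from the finite factorials in the denominator.
  set κ : ℂ := ∏ i, ∏ s ∈ Finset.range (M i), -(poleBase q a b ε i * (q : ℂ) ^ s)⁻¹ with hκ
  have hκ0 : κ ≠ 0 := Finset.prod_ne_zero_iff.2 fun i _ => Finset.prod_ne_zero_iff.2 fun s _ =>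
    neg_ne_zero.2 (inv_ne_zero (mul_ne_zero (hbase i) (pow_ne_zero _ hqne)))
  set N : ℂ → ℂ := fun x => H x * (κ * ∏ i, x ^ M i) / tail x with hN
  have hprodS : ∀ x ≠ 0, ∏ j ∈ S, (x - P j) =
      κ * (∏ i, x ^ M i) * ∏ i, qFin q (poleBase q a b ε i * x) (M i) *
        qFin q (poleBase q a b ε i * x⁻¹) (M i) := by
    intro x hx
    rw [hS, Finset.prod_product, Fintype.prod_bool, Finset.prod_sigma, Finset.prod_sigma]
    simp only [hPtrue, hPfalse, pole_eq, prod_sub_mul_pow hx,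
      prod_sub_inv_mul_pow hq₀ x (hbase _), Finset.prod_mul_distrib, hκ]
    ring
  have hDprod : ∀ x, poleDenom q a b ε x = (∏ i, qFin q (poleBase q a b ε i * x) (M i) *
        qFin q (poleBase q a b ε i * x⁻¹) (M i)) * tail x := by
    intro x
    rw [poleDenom, htail, ← Finset.prod_mul_distrib]
    refine Finset.prod_congr rfl fun i _ => ?_
    rw [qInf_eq_qFin_mul hq₀ hq₁ (poleBase q a b ε i * x) (M i),
      qInf_eq_qFin_mul hq₀ hq₁ (poleBase q a b ε i * x⁻¹) (M i)]
    ring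
  have hU0 : ∀ x ∈ openAnnulus ρ ρ⁻¹, x ≠ 0 := fun x hx => norm_pos_iff.1 (hρ.trans hx.1)
  have hNd : DifferentiableOn ℂ N (openAnnulus ρ ρ⁻¹) := by
    intro x hx
    have hx0 := hU0 x hx
    have hqd := differentiable_qInf hq₀ hq₁
    have ht : DifferentiableAt ℂ tail x := by
      refine DifferentiableAt.fun_finsetProd fun i _ => DifferentiableAt.mul ?_ ?_
      · exact (hqd _).comp x (by fun_prop)
      · refine (hqd _).comp x ?_
        exact ((differentiableAt_inv hx0).const_mul _).mul_const _
    refine DifferentiableAt.differentiableWithinAt ?_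
    refine DifferentiableAt.div ((hH x hx0).mul ?_) ht (htail_ne x hx)
    fun_prop
  have hF : ∀ x ∈ openAnnulus ρ ρ⁻¹, (∀ j ∈ S, x ≠ P j) →
      H x / poleDenom q a b ε x = N x / ∏ j ∈ S, (x - P j) := by
    intro x hx _
    have hx0 := hU0 x hx
    have hκx : κ * ∏ i, x ^ M i ≠ 0 :=
      mul_ne_zero hκ0 (Finset.prod_ne_zero_iff.2 fun i _ => pow_ne_zero _ hx0)
    rw [hprodS x hx0, hDprod, hN]
    beta_reduce
    rw [div_div, mul_comm (H x), mul_left_comm (tail x), mul_div_mul_left _ _ hκx, mul_comm (tail x)]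
  set y : ℕ → ℂ := fun s => pole q a b ε 0 s with hy
  -- The winding numbers of `γ` and of the unit circle differ only at `x_0, …, x_{r-1}` and at their
  -- reciprocals.
  have hw_true : ∀ (i : Fin 3) (s : ℕ), ¬((1 : ℂ) = if ‖pole q a b ε i s‖ < 1 then 1 else 0) →
      i = 0 ∧ s < r := by
    intro i s h
    rw [eq_comm, ite_eq_left_iff, not_forall] at h
    obtain ⟨h, -⟩ := h
    have h' := lt_of_le_of_ne (not_lt.1 h) (hne i s).symm
    fin_cases i
    · exact ⟨rfl, (hr s).1 h'⟩
    · exact absurd (h₁ s) h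
    · exact absurd (h₂ s) h
  have hinv_lt : ∀ (i : Fin 3) (s : ℕ), ‖(pole q a b ε i s)⁻¹‖ < 1 ↔ 1 < ‖pole q a b ε i s‖ := by
    intro i s
    rw [norm_inv, inv_lt_one₀ (norm_pos_iff.2 (hp0 i s))]
  have hw_false : ∀ (i : Fin 3) (s : ℕ),
      ¬((0 : ℂ) = if ‖(pole q a b ε i s)⁻¹‖ < 1 then 1 else 0) → i = 0 ∧ s < r := by
    intro i s h
    rw [eq_comm, ite_eq_right_iff, not_forall] at h
    obtain ⟨h, -⟩ := h
    rw [hinv_lt] at h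
    fin_cases i
    · exact ⟨rfl, (hr s).1 h⟩
    · exact absurd (h₁ s) (not_lt.2 h.le)
    · exact absurd (h₂ s) (not_lt.2 h.le)
  have hE0 : ∀ s, poleDenomRes q a b ε s (y s) ≠ 0 :=
    poleDenomRes_pole_ne_zero hq₀ hq₁ ha hb hε hinj
  -- At the reciprocals the symmetry of the denominator under `x ↦ 1/x` is used, and `1 - y x = -y
  -- (x - y⁻¹)` produces the sign. It is compensated by the winding number difference `0 - 1`, so
  -- both residues enter the result with a plus sign.
  set K : (Bool × Σ _ : Fin 3, ℕ) → ℂ → ℂ := fun j x =>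
    if j.1 then H x * x / poleDenomRes q a b ε j.2.2 x
    else -(H x * (y j.2.2)⁻¹) / poleDenomRes q a b ε j.2.2 x⁻¹ with hK
  have hKtrue (s : ℕ) : K (true, ⟨0, s⟩) = fun x => H x * x / poleDenomRes q a b ε s x := by
    simp [hK]
  have hKfalse (s : ℕ) : K (false, ⟨0, s⟩) =
      fun x => -(H x * (y s)⁻¹) / poleDenomRes q a b ε s x⁻¹ := by
    simp [hK]
  set w : (Bool × Σ _ : Fin 3, ℕ) → ℤ := fun j => if j.1 then 1 else 0 with hw
  have main := hγ.curve.integral_eq_unitCircle_add_residues hγ.origin hρ hρ₁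
    ((one_lt_inv₀ hρ).2 hρ₁) (fun u hu => ⟨hργ u hu, (lt_inv_comm₀ hρ
      (norm_pos_iff.2 (hγ.origin.1 u hu))).1 (hργ' u hu)⟩) S P hPinj.injOn hPU ?_ w ?_ hNd hF
      (K := K) ?_ ?_
  · rw [main]
    congr 2
    have hsub : Finset.range r ⊆ Finset.range (M 0) := by
      intro s hs
      rw [Finset.mem_range] at hs ⊢
      by_contra hsM
      have h := (hr s).2 hs
      rw [norm_pole hq₀] at h
      have : ‖poleBase q a b ε 0‖ * q ^ s ≤ ‖poleBase q a b ε 0‖ * q ^ M 0 :=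
        mul_le_mul_of_nonneg_left (pow_le_pow_of_le_one hq₀.le hq₁.le (not_lt.1 hsM))
          (norm_nonneg _)
      linarith [hM 0]
    rw [hS, Finset.sum_product, Fintype.sum_bool, Finset.sum_sigma, Finset.sum_sigma,
      Fin.sum_univ_three, Fin.sum_univ_three]
    have hz : ∀ (x : Bool) (i : Fin 3), i ≠ 0 → ∑ s ∈ Finset.range (M i),
        ((w (x, ⟨i, s⟩) : ℂ) - if ‖P (x, ⟨i, s⟩)‖ < 1 then 1 else 0) *
          K (x, ⟨i, s⟩) (P (x, ⟨i, s⟩)) = 0 := by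
      intro x i hi
      refine Finset.sum_eq_zero fun s _ => ?_
      rw [mul_eq_zero, sub_eq_zero]
      left
      by_contra h
      cases x
      · rw [hPfalse] at h
        exact hi (hw_false i s (by simpa [hw] using h)).1
      · rw [hPtrue] at h
        exact hi (hw_true i s (by simpa [hw] using h)).1
    rw [hz true 1 (by decide), hz true 2 (by decide), hz false 1 (by decide),
      hz false 2 (by decide)]
    simp only [add_zero]
    rw [← Finset.sum_add_distrib]
    symm
    rw [← Finset.sum_subset hsub]
    · refine Finset.sum_congr rfl fun s hs => ?_
      have hs' := (hr s).2 (Finset.mem_range.1 hs)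
      rw [hPtrue, hPfalse, hKtrue, hKfalse, if_neg (not_lt.2 hs'.le),
        if_pos ((hinv_lt 0 s).2 hs')]
      simp only [hw, inv_inv, hy]
      simp
      ring
    · intro s _ hs
      rw [Finset.mem_range] at hs
      have t₁ : (w (true, ⟨0, s⟩) : ℂ) - (if ‖P (true, ⟨0, s⟩)‖ < 1 then 1 else 0) = 0 := by
        rw [sub_eq_zero, hPtrue]
        by_contra h
        exact hs (hw_true 0 s (by simpa [hw] using h)).2
      have t₂ : (w (false, ⟨0, s⟩) : ℂ) - (if ‖P (false, ⟨0, s⟩)‖ < 1 then 1 else 0) = 0 := by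
        rw [sub_eq_zero, hPfalse]
        by_contra h
        exact hs (hw_false 0 s (by simpa [hw] using h)).2
      rw [t₁, t₂, zero_mul, zero_mul, add_zero]
  · rintro ⟨x, i, s⟩ _
    cases x
    · rw [hPfalse, norm_inv]
      exact fun h => hne i s (inv_eq_one.1 h)
    · rw [hPtrue]
      exact hne i s
  · rintro ⟨x, i, s⟩ _
    cases x
    · rw [hPfalse]
      exact hγ.outside i s
    · rw [hPtrue]
      exact hγ.inside i s
  · rintro ⟨x, i, s⟩ _ hws
    cases x
    · rw [hPfalse] at hws ⊢
      obtain ⟨rfl, -⟩ := hw_false i s (by simpa [hw] using hws)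
      rw [hKfalse]
      have hy0 : (y s)⁻¹ ≠ 0 := inv_ne_zero (hp0 0 s)
      have c₁ : ContinuousAt (fun x => poleDenomRes q a b ε s x⁻¹) (y s)⁻¹ := by
        refine ContinuousAt.comp (g := poleDenomRes q a b ε s) ?_ (continuousAt_inv₀ hy0)
        exact continuousAt_poleDenomRes hq₀ hq₁ s (inv_ne_zero hy0)
      refine ContinuousAt.div ((hH _ hy0).continuousAt.mul continuousAt_const).neg c₁ ?_
      rw [inv_inv]
      exact hE0 s
    · rw [hPtrue] at hws ⊢
      obtain ⟨rfl, -⟩ := hw_true i s (by simpa [hw] using hws)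
      rw [hKtrue]
      exact ContinuousAt.div ((hH _ (hp0 0 s)).continuousAt.mul continuousAt_id)
        (continuousAt_poleDenomRes hq₀ hq₁ s (hp0 0 s)) (hE0 s)
  · rintro ⟨x, i, s⟩ _ hws
    have hx0 : ∀ p : ℂ, p ≠ 0 → ∀ᶠ x in 𝓝[≠] p, x ≠ 0 := fun p hp =>
      nhdsWithin_le_nhds (isOpen_ne.mem_nhds hp)
    cases x
    · rw [hPfalse] at hws ⊢
      obtain ⟨rfl, -⟩ := hw_false i s (by simpa [hw] using hws)
      rw [hKfalse]
      filter_upwards [hx0 _ (inv_ne_zero (hp0 0 s)), self_mem_nhdsWithin] with x hx hx'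
      have e : 1 - pole q a b ε 0 s * x = -(y s) * (x - (pole q a b ε 0 s)⁻¹) := by
        rw [hy]
        have := hp0 0 s
        field_simp
        ring
      rw [← poleDenom_inv, poleDenom_eq_mul hq₀ hq₁ s, inv_inv, e]
      simp only [div_eq_mul_inv, mul_inv, inv_neg]
      ring
    · rw [hPtrue] at hws ⊢
      obtain ⟨rfl, -⟩ := hw_true i s (by simpa [hw] using hws)
      rw [hKtrue]
      filter_upwards [hx0 _ (hp0 0 s), self_mem_nhdsWithin] with x hx hx'
      have e : 1 - pole q a b ε 0 s * x⁻¹ = (x - pole q a b ε 0 s) * x⁻¹ := by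
        field_simp
      rw [poleDenom_eq_mul hq₀ hq₁ s, e, div_div, mul_right_comm, mul_comm _ x⁻¹,
        ← div_div, div_inv_eq_mul, mul_comm (poleDenomRes _ _ _ _ _ _)]

end ResidueFormula

/-! ### The normalized residues -/

section Weights

/-- The standing conditions on `q`, `a`, `b` and `ε₀`. -/
structure Admissible (q : ℝ) (a b ε₀ : ℂ) : Prop where
  q_pos : 0 < q
  q_lt : q < 1
  a_ne : a ≠ 0
  a_lt : ‖a‖ < 1
  b_ne : b ≠ 0
  b_lt : ‖b‖ < 1
  lt_eps : √q < ‖ε₀‖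
  eps_lt : ‖ε₀‖ * √q < 1

variable {q : ℝ} {a b ε₀ ε : ℂ}

namespace Admissible

lemma sqrt_pos (h : Admissible q a b ε₀) : 0 < √q := Real.sqrt_pos.2 h.q_pos

lemma sqrt_lt (h : Admissible q a b ε₀) : √q < 1 := by
  rw [Real.sqrt_lt' one_pos, one_pow]
  exact h.q_lt

lemma norm_eps_pos (h : Admissible q a b ε₀) : 0 < ‖ε₀‖ := h.sqrt_pos.trans h.lt_eps

lemma eps_ne (h : Admissible q a b ε₀) : ε₀ ≠ 0 := norm_pos_iff.1 h.norm_eps_pos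

lemma epsSeq_ne (h : Admissible q a b ε₀) (r : ℕ) : epsSeq q ε₀ r ≠ 0 :=
  mul_ne_zero h.eps_ne (pow_ne_zero _ (ofReal_ne_zero_of_pos h.q_pos))

lemma norm_epsSeq (h : Admissible q a b ε₀) (r : ℕ) : ‖epsSeq q ε₀ r‖ = ‖ε₀‖ * q ^ r := by
  rw [epsSeq, norm_mul, norm_pow, norm_ofReal_of_pos h.q_pos]

lemma tendsto_epsSeq (h : Admissible q a b ε₀) : Tendsto (epsSeq q ε₀) atTop (𝓝 0) := by
  have : Tendsto (fun r : ℕ => ε₀ * (q : ℂ) ^ r) atTop (𝓝 (ε₀ * 0)) :=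
    (tendsto_pow_atTop_nhds_zero_of_norm_lt_one
      (by rw [norm_ofReal_of_pos h.q_pos]; exact h.q_lt)).const_mul _
  rwa [mul_zero] at this

end Admissible

/-- The normalizing factor `(-ε⁻¹ q, -ε⁻¹ a q)_∞`. -/
noncomputable def prefactor (q : ℝ) (a ε : ℂ) : ℂ := qInf q (-ε⁻¹ * q) * qInf q (-ε⁻¹ * a * q)

/-- The numerator `(x, -x, q^{1/2} x, x⁻¹, -x⁻¹, q^{1/2} x⁻¹)_∞` of the one-variable weight. -/
noncomputable def symNumer (q : ℝ) (x : ℂ) : ℂ :=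
  qInf q x * qInf q (-x) * qInf q ((√q : ℝ) * x) *
    (qInf q x⁻¹ * qInf q (-x⁻¹) * qInf q ((√q : ℝ) * x⁻¹))

/-- The normalized residue of the weight at `ε⁻¹ q^{s+1/2}`, as a function of `η = ε q^{-s}`. -/
noncomputable def weightFun (q : ℝ) (a b : ℂ) (s : ℕ) (η : ℂ) : ℂ :=
  (a * q) ^ s * (qFin q (-η) s * qFin q (-(a⁻¹ * η)) s *
    (qInf q (η * (√q : ℝ)⁻¹) * qInf q (-(η * (√q : ℝ)⁻¹)) * qInf q η)) /
    (qFin q (η ^ 2) s * qFin q q s * qInf q q * qInf q (b * (q : ℂ) ^ (s + 1)) *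
      qInf q (η ^ 2 * b * (q : ℂ) ^ s) * qInf q (-(a * η)))

/-- With `y = q^{1/2}/η`, the tail of `(-ε⁻¹q)_∞` after `s` factors is `(-q^{1/2}y)_∞`, the factor
that `symNumer` lacks to complete `(y²)_∞` in the duplication formula. As `y² = q/η²`, this cancels
the tail of `(q^{1-s}/η²)_∞` in the denominator, and the tail of `(-ε⁻¹aq)_∞` cancels against the
third family. The remaining factorials of large argument are finite; reflecting them gives an
expression regular at `η = 0`. -/
lemma prefactor_mul_residue (hq₀ : 0 < q) (hq₁ : q < 1) (ha : a ≠ 0) (hb : b ≠ 0) (hε : ε ≠ 0)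
    (hinj : Function.Injective (polePoint q a b ε)) (s : ℕ) :
    prefactor q a ε * (symNumer q (pole q a b ε 0 s) /
      poleDenomRes q a b ε s (pole q a b ε 0 s)) = weightFun q a b s (ε * ((q : ℂ) ^ s)⁻¹) := by
  have hr2 := ofReal_sqrt_sq hq₀
  have hr0 := ofReal_sqrt_ne_zero hq₀
  have hq := ofReal_ne_zero_of_pos hq₀
  have hqs : (q : ℂ) ^ s ≠ 0 := pow_ne_zero _ hq
  have n₀ := qInf_pole_ne_zero hq₀ hq₁ ha hb hε hinj 0 0 s
  have n₂ := qInf_pole_ne_zero hq₀ hq₁ ha hb hε hinj 2 0 s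
  set η := ε * ((q : ℂ) ^ s)⁻¹ with hη
  have hη0 : η ≠ 0 := mul_ne_zero hε (inv_ne_zero hqs)
  have hεη : ε = η * (q : ℂ) ^ s := by rw [hη]; field_simp
  have y_eq : pole q a b ε 0 s = η⁻¹ * (√q : ℝ) := by
    simp only [pole, Matrix.cons_val_zero]
    rw [hεη]; field_simp
  have yinv : (pole q a b ε 0 s)⁻¹ = η * (√q : ℝ)⁻¹ := by rw [y_eq]; push_cast; field_simp
  have e₀ : poleBase q a b ε 0 * pole q a b ε 0 s = (η ^ 2)⁻¹ * q * ((q : ℂ) ^ s)⁻¹ := by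
    rw [y_eq]; simp only [poleBase, Matrix.cons_val_zero]
    rw [hεη, ← hr2]; field_simp
  have e₁ : poleBase q a b ε 1 * pole q a b ε 0 s = b * (q : ℂ) ^ (s + 1) := by
    rw [y_eq]; simp only [poleBase, Matrix.cons_val_one]
    rw [hεη, pow_succ, ← hr2]; simp; field_simp
  have e₁' : poleBase q a b ε 1 * (pole q a b ε 0 s)⁻¹ = η ^ 2 * b * (q : ℂ) ^ s := by
    rw [yinv]; simp only [poleBase, Matrix.cons_val_one]
    rw [hεη]; simp; field_simp
  have e₂ : poleBase q a b ε 2 * pole q a b ε 0 s = -ε⁻¹ * a * q * (q : ℂ) ^ s := by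
    rw [y_eq]; simp only [poleBase, Matrix.cons_val]
    rw [hεη, ← hr2]; field_simp
  have e₂' : poleBase q a b ε 2 * (pole q a b ε 0 s)⁻¹ = -(a * η) := by
    rw [yinv]; simp only [poleBase, Matrix.cons_val]
    push_cast; field_simp
  have hnum : symNumer q (pole q a b ε 0 s) * qInf q (-ε⁻¹ * q) =
      qFin q (-ε⁻¹ * q) s * qInf q ((η ^ 2)⁻¹ * q) *
      (qInf q (η * (√q : ℝ)⁻¹) * qInf q (-(η * (√q : ℝ)⁻¹)) * qInf q η) := by
    have t₁ : -ε⁻¹ * q * (q : ℂ) ^ s = -((√q : ℝ) * (η⁻¹ * (√q : ℝ))) := by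
      rw [hεη, ← hr2]; field_simp
    have t₂ : (η⁻¹ * ((√q : ℝ) : ℂ)) ^ 2 = (η ^ 2)⁻¹ * q := by rw [← hr2]; field_simp
    have t₃ : ((√q : ℝ) : ℂ) * (η * (√q : ℝ)⁻¹) = η := by push_cast; field_simp
    rw [symNumer, yinv, y_eq, qInf_eq_qFin_mul hq₀ hq₁ (-ε⁻¹ * q) s, t₁, ← t₂, qInf_sq hq₀ hq₁, t₃]
    ring
  have hden : qInf q (poleBase q a b ε 0 * pole q a b ε 0 s) =
      qFin q ((η ^ 2)⁻¹ * q * ((q : ℂ) ^ s)⁻¹) s * qInf q ((η ^ 2)⁻¹ * q) := by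
    rw [e₀, qInf_eq_qFin_mul hq₀ hq₁ _ s, inv_mul_cancel_right₀ hqs]
  rw [poleDenomRes_pole hq₀ ha hb hε, hden, e₁, e₁', e₂', prefactor,
    qInf_eq_qFin_mul hq₀ hq₁ (-ε⁻¹ * a * q) s, ← e₂]
  have n₁ : qInf q ((η ^ 2)⁻¹ * q) ≠ 0 := by
    rw [hden] at n₀; exact right_ne_zero_of_mul n₀
  set Y := qInf q ((η ^ 2)⁻¹ * q)
  set Z := qInf q (poleBase q a b ε 2 * pole q a b ε 0 s)
  have r₁ : qFin q (-ε⁻¹ * q) s = (ε⁻¹ * q) ^ s * (q : ℂ) ^ s.choose 2 * qFin q (-η) s := by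
    rw [qFin_eq_reflect hq₀ (by simp [hε, hq])]
    congr 2
    · ring
    · rw [hεη]; field_simp
  have r₂ : qFin q (-ε⁻¹ * a * q) s =
      (ε⁻¹ * a * q) ^ s * (q : ℂ) ^ s.choose 2 * qFin q (-(a⁻¹ * η)) s := by
    rw [qFin_eq_reflect hq₀ (by simp [hε, hq, ha])]
    congr 2
    · ring
    · rw [hεη]; field_simp
  have r₃ : qFin q ((η ^ 2)⁻¹ * q * ((q : ℂ) ^ s)⁻¹) s =
      (-((η ^ 2)⁻¹ * q * ((q : ℂ) ^ s)⁻¹)) ^ s * (q : ℂ) ^ s.choose 2 * qFin q (η ^ 2) s := by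
    rw [qFin_eq_reflect hq₀ (by simp [hη0, hq])]
    congr 2
    field_simp
  have r₄ : qFin q ((q : ℂ) ^ s)⁻¹ s =
      (-((q : ℂ) ^ s)⁻¹) ^ s * (q : ℂ) ^ s.choose 2 * qFin q q s := by
    rw [qFin_eq_reflect hq₀ (by simp [hq])]
    congr 2
    field_simp
  -- The powers extracted by the four reflections leave only `(a q)^s`; this is the source of the
  -- geometric decay.
  have hpow : (ε⁻¹ * q) ^ s * (ε⁻¹ * a * q) ^ s =
      (a * q) ^ s * ((-((η ^ 2)⁻¹ * q * ((q : ℂ) ^ s)⁻¹)) ^ s * (-((q : ℂ) ^ s)⁻¹) ^ s) := by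
    rw [← mul_pow, ← mul_pow, ← mul_pow]
    congr 1
    rw [hεη]
    field_simp
  have hA : (-((η ^ 2)⁻¹ * q * ((q : ℂ) ^ s)⁻¹)) ^ s * (-((q : ℂ) ^ s)⁻¹) ^ s *
      ((q : ℂ) ^ s.choose 2) ^ 2 * Y * Z ≠ 0 := by
    simp [hq, hη0, n₁, n₂, Z]
  rw [r₂, r₃, r₄, weightFun]
  rw [r₁] at hnum
  rw [← mul_div_assoc]
  refine Eq.trans ?_ (mul_div_mul_left _ _ hA)
  generalize (ε⁻¹ * (q : ℂ)) ^ s = A₁ at *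
  generalize (ε⁻¹ * a * (q : ℂ)) ^ s = A₂ at *
  generalize (a * (q : ℂ)) ^ s = A₃ at *
  generalize (-((η ^ 2)⁻¹ * (q : ℂ) * ((q : ℂ) ^ s)⁻¹)) ^ s = A₄ at *
  generalize (-((q : ℂ) ^ s)⁻¹) ^ s = A₅ at *
  congr 1
  · linear_combination ((A₂ * (q : ℂ) ^ s.choose 2 * qFin q (-(a⁻¹ * η)) s) * Z) *
      hnum + (((q : ℂ) ^ s.choose 2) ^ 2 * Y * Z * qFin q (-η) s * qFin q (-(a⁻¹ * η)) s *
      (qInf q (η * (√q : ℝ)⁻¹) * qInf q (-(η * (√q : ℝ)⁻¹)) * qInf q η)) * hpow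
  · ring

end Weights

/-! ### Uniform bounds for residues and circle integral -/

section Bounds

variable {q : ℝ} {a b ε₀ ε : ℂ}

/-- For `|η| ≤ q^{1/2}` all arguments in the numerator are bounded, and those in the denominator
have modulus at most `max (q, |b|, |a|) < 1`. Every factorial is thus bounded above or away from
zero uniformly in `s`, and `(a q)^s` remains. -/
lemma exists_norm_weightFun_le (h : Admissible q a b ε₀) :
    ∃ C > 0, ∀ (s : ℕ) (η : ℂ), ‖η‖ ≤ √q → ‖weightFun q a b s η‖ ≤ C * (‖a‖ * q) ^ s := by
  have hq₀ := h.q_pos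
  have hq₁ := h.q_lt
  set R : ℝ := 1 + ‖a⁻¹‖ with hR
  have hR0 : 0 ≤ R := by positivity
  set ρ : ℝ := max q (max ‖b‖ ‖a‖) with hρ
  have hρ1 : ρ < 1 := max_lt hq₁ (max_lt h.b_lt h.a_lt)
  obtain ⟨C₁, hC₁, B₁⟩ := exists_norm_qInf_le hq₀ hq₁ R
  obtain ⟨C₂, hC₂, B₂⟩ := exists_norm_qFin_le hq₀ hq₁ hR0
  obtain ⟨c₁, hc₁, b₁⟩ := exists_le_norm_qInf hq₀ hq₁ hρ1
  obtain ⟨c₂, hc₂, b₂⟩ := exists_le_norm_qFin hq₀ hq₁ hρ1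
  refine ⟨C₂ * C₂ * (C₁ * C₁ * C₁) / (c₂ * c₂ * c₁ * c₁ * c₁ * c₁), by positivity,
    fun s η hη => ?_⟩
  have hs := h.sqrt_pos
  have hη1 : ‖η‖ ≤ 1 := hη.trans h.sqrt_lt.le
  have h1R : 1 ≤ R := by rw [hR]; linarith [norm_nonneg a⁻¹]
  have hηR := hη1.trans h1R
  have n₁ : ‖-η‖ ≤ R := by rwa [norm_neg]
  have n₂ : ‖-(a⁻¹ * η)‖ ≤ R := by
    rw [norm_neg, norm_mul]
    calc ‖a⁻¹‖ * ‖η‖ ≤ ‖a⁻¹‖ * 1 := by gcongr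
      _ ≤ R := by rw [hR]; linarith
  have n₃ : ‖η * (√q : ℝ)⁻¹‖ ≤ R := by
    rw [norm_mul, Complex.norm_real, norm_inv, Real.norm_of_nonneg hs.le, ← div_eq_mul_inv]
    exact ((div_le_one hs).2 hη).trans h1R
  have n₄ : ‖-(η * (√q : ℝ)⁻¹)‖ ≤ R := by rwa [norm_neg]
  have hqs : q ^ s ≤ 1 := pow_le_one₀ hq₀.le hq₁.le
  have m₁ : ‖η ^ 2‖ ≤ ρ := by
    rw [norm_pow]
    calc ‖η‖ ^ 2 ≤ √q ^ 2 := by gcongr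
      _ = q := Real.sq_sqrt hq₀.le
      _ ≤ ρ := le_max_left _ _
  have m₂ : ‖(q : ℂ)‖ ≤ ρ := by rw [norm_ofReal_of_pos hq₀]; exact le_max_left _ _
  have m₃ : ‖b * (q : ℂ) ^ (s + 1)‖ ≤ ρ := by
    rw [norm_mul, norm_pow, norm_ofReal_of_pos hq₀]
    calc ‖b‖ * q ^ (s + 1) ≤ ‖b‖ * 1 := by gcongr; exact pow_le_one₀ hq₀.le hq₁.le
      _ ≤ ρ := by rw [mul_one]; exact (le_max_left _ _).trans (le_max_right _ _)
  have m₄ : ‖η ^ 2 * b * (q : ℂ) ^ s‖ ≤ ρ := by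
    rw [norm_mul, norm_mul, norm_pow, norm_pow, norm_ofReal_of_pos hq₀]
    calc ‖η‖ ^ 2 * ‖b‖ * q ^ s ≤ 1 * ‖b‖ * 1 := by gcongr; exact pow_le_one₀ (norm_nonneg _) hη1
      _ ≤ ρ := by rw [mul_one, one_mul]; exact (le_max_left _ _).trans (le_max_right _ _)
  have m₅ : ‖-(a * η)‖ ≤ ρ := by
    rw [norm_neg, norm_mul]
    calc ‖a‖ * ‖η‖ ≤ ‖a‖ * 1 := by gcongr
      _ ≤ ρ := by rw [mul_one]; exact (le_max_right _ _).trans (le_max_right _ _)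
  have e : ‖(a * (q : ℂ)) ^ s‖ = (‖a‖ * q) ^ s := by
    rw [norm_pow, norm_mul, norm_ofReal_of_pos hq₀]
  rw [weightFun, norm_div, norm_mul, e, mul_comm, mul_div_right_comm]
  refine mul_le_mul_of_nonneg_right ?_ (by have := norm_nonneg a; positivity)
  simp only [norm_mul]
  have k₁ := B₂ _ s n₁
  have k₂ := B₂ _ s n₂
  have k₃ := B₁ _ n₃
  have k₄ := B₁ _ n₄
  have k₅ := B₁ _ hηR
  have l₁ := b₂ _ s m₁
  have l₂ := b₂ _ s m₂
  have l₃ := b₁ _ m₂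
  have l₄ := b₁ _ m₃
  have l₅ := b₁ _ m₄
  have l₆ := b₁ _ m₅
  gcongr

lemma tendsto_weightFun (h : Admissible q a b ε₀) (s : ℕ) :
    Tendsto (weightFun q a b s) (𝓝 0) (𝓝 (weightFun q a b s 0)) := by
  have hq₀ := h.q_pos
  have hq₁ := h.q_lt
  have hn : ‖(q : ℂ)‖ < 1 := by rw [norm_ofReal_of_pos hq₀]; exact hq₁
  have cI := continuous_qInf hq₀ hq₁
  have cF := continuous_qFin (q := q) s
  refine ContinuousAt.tendsto ?_
  unfold weightFun
  refine ContinuousAt.div (Continuous.continuousAt ?_) (Continuous.continuousAt ?_) ?_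
  · have := cF.comp continuous_neg
    have h₂ := cF.comp (by fun_prop : Continuous fun η : ℂ => -(a⁻¹ * η))
    simp only [Function.comp_def] at this h₂
    fun_prop
  · have := cF.comp (by fun_prop : Continuous fun η : ℂ => η ^ 2)
    simp only [Function.comp_def] at this
    fun_prop
  · have hb : ‖b * (q : ℂ) ^ (s + 1)‖ < 1 := by
      rw [norm_mul, norm_pow, norm_ofReal_of_pos hq₀]
      exact mul_lt_one_of_nonneg_of_lt_one_left (norm_nonneg _) h.b_lt (pow_le_one₀ hq₀.le hq₁.le)
    simp [qFin_zero_left, qInf_zero, qFin_ne_zero_of_norm_lt_one hq₀ hq₁ hn,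
      qInf_ne_zero_of_norm_lt_one hq₀ hq₁ hn, qInf_ne_zero_of_norm_lt_one hq₀ hq₁ hb]

lemma weightFun_zero (h : Admissible q a b ε₀) (s : ℕ) :
    weightFun q a b s 0 = (qInf q q ^ 2)⁻¹ *
      (a ^ s * (q : ℂ) ^ s * (qInf q ((q : ℂ) ^ (s + 1)) / qInf q (b * (q : ℂ) ^ (s + 1)))) := by
  have hq₀ := h.q_pos
  have hq₁ := h.q_lt
  have hn : ‖(q : ℂ)‖ < 1 := by rw [norm_ofReal_of_pos hq₀]; exact hq₁
  have h₁ := qInf_ne_zero_of_norm_lt_one hq₀ hq₁ hn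
  have h₂ := qFin_ne_zero_of_norm_lt_one hq₀ hq₁ hn s
  have e : qInf q q = qFin q q s * qInf q ((q : ℂ) ^ (s + 1)) := by
    rw [qInf_eq_qFin_mul hq₀ hq₁ _ s, pow_succ']
  have h₃ : qInf q ((q : ℂ) ^ (s + 1)) ≠ 0 := fun h0 => h₁ (by rw [e, h0, mul_zero])
  simp only [weightFun, neg_zero, mul_zero, zero_mul, qFin_zero_left, qInf_zero, mul_one, one_mul,
    ne_eq, OfNat.ofNat_ne_zero, not_false_eq_true, zero_pow]
  rw [e, mul_pow]
  field_simp

/-- `symNumer x` without the factor `1 - x⁻²`. -/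
noncomputable def coreNumer (q : ℝ) (x : ℂ) : ℂ :=
  qInf q x * qInf q (-x) * qInf q ((√q : ℝ) * x) *
    (qInf q (x⁻¹ * q) * qInf q (-x⁻¹ * q) * qInf q ((√q : ℝ) * x⁻¹))

lemma symNumer_eq (hq₀ : 0 < q) (hq₁ : q < 1) (x : ℂ) :
    symNumer q x = (1 - (x ^ 2)⁻¹) * coreNumer q x := by
  rw [symNumer, coreNumer, qInf_eq_qFin_mul hq₀ hq₁ x⁻¹ 1, qInf_eq_qFin_mul hq₀ hq₁ (-x⁻¹) 1]
  simp only [qFin, Finset.prod_range_one, pow_zero, pow_one, mul_one, ← inv_pow]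
  ring

lemma symNumer_inv (x : ℂ) : symNumer q x⁻¹ = symNumer q x := by
  simp only [symNumer, inv_inv]
  ring

lemma differentiableAt_coreNumer (hq₀ : 0 < q) (hq₁ : q < 1) {x : ℂ} (hx : x ≠ 0) :
    DifferentiableAt ℂ (coreNumer q) x := by
  have hd := differentiable_qInf hq₀ hq₁
  have hi : DifferentiableAt ℂ (fun x : ℂ => x⁻¹) x := differentiableAt_inv hx
  have k {f : ℂ → ℂ} (hf : DifferentiableAt ℂ f x) : DifferentiableAt ℂ (fun x => qInf q (f x)) x :=
    (hd (f x)).comp x hf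
  exact (((k differentiableAt_id).mul (k differentiableAt_id.neg)).mul
    (k (differentiableAt_id.const_mul _))).mul
    (((k (hi.mul_const _)).mul (k (hi.neg.mul_const _))).mul (k (hi.const_mul _)))

lemma epsSeq_inv_mul_pow (h : Admissible q a b ε₀) (r : ℕ) :
    (epsSeq q ε₀ r)⁻¹ * (q : ℂ) ^ r = ε₀⁻¹ := by
  have := ofReal_ne_zero_of_pos h.q_pos
  have := h.eps_ne
  rw [epsSeq]
  field_simp

/-- Since `ε⁻¹ q^r = ε₀⁻¹`, reflecting the first `r` factors of `(-ε⁻¹q)_∞` and `(-ε⁻¹aq)_∞`, and of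
the denominators `(ε⁻¹q^{1/2}x^{±1})_∞`, leaves factorials with arguments independent of `r` on the
circle up to a factor of modulus one. The extracted powers have quotient `|ε⁻¹q|^r |ε⁻¹aq|^r /
|ε⁻¹q^{1/2}|^{2r} = (|a| q)^r`. The two bounds on `|ε₀|` keep the reflected denominators away from
zero. -/
lemma exists_norm_circle_le (h : Admissible q a b ε₀) :
    ∃ C > 0, ∀ (r : ℕ) (x : ℂ), ‖x‖ = 1 →
      ‖prefactor q a (epsSeq q ε₀ r) * (coreNumer q x / poleDenom q a b (epsSeq q ε₀ r) x)‖ ≤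
        C * (‖a‖ * q) ^ r := by
  have hq₀ := h.q_pos
  have hq₁ := h.q_lt
  have hs0 := h.sqrt_pos
  have hs1 := h.sqrt_lt
  have hsc : ((√q : ℝ) : ℂ) ≠ 0 := ofReal_sqrt_ne_zero hq₀
  have hsn : ‖((√q : ℝ) : ℂ)‖ = √q := by rw [Complex.norm_real, Real.norm_of_nonneg hs0.le]
  have hqc := ofReal_ne_zero_of_pos hq₀
  have he := h.eps_ne
  have hep := h.norm_eps_pos
  set R : ℝ := 1 + ‖ε₀‖ + ‖ε₀ * a⁻¹‖ + ‖ε₀⁻¹ * q‖ + ‖ε₀⁻¹ * a * q‖ with hR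
  have hR0 : 0 ≤ R := by positivity
  have u₁ := norm_nonneg ε₀
  have u₂ := norm_nonneg (ε₀ * a⁻¹)
  have u₃ := norm_nonneg (ε₀⁻¹ * q)
  have u₄ := norm_nonneg (ε₀⁻¹ * a * q)
  set ρ : ℝ := max (‖ε₀⁻¹‖ * √q) (max (‖ε₀‖ * √q) √q) with hρ
  have hinv : ‖ε₀⁻¹‖ * √q < 1 := by
    rw [norm_inv, inv_mul_lt_one₀ hep]
    exact h.lt_eps
  have hρ1 : ρ < 1 := max_lt hinv (max_lt h.eps_lt hs1)
  have hρ2 : ‖ε₀‖ * √q ≤ ρ := (le_max_left _ _).trans (le_max_right _ _)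
  have hρ3 : √q ≤ ρ := (le_max_right _ _).trans (le_max_right _ _)
  have hρ0 : 0 ≤ ρ := hs0.le.trans hρ3
  obtain ⟨C₁, hC₁, B₁⟩ := exists_norm_qInf_le hq₀ hq₁ R
  obtain ⟨C₂, hC₂, B₂⟩ := exists_norm_qFin_le hq₀ hq₁ hR0
  obtain ⟨c₁, hc₁, b₁⟩ := exists_le_norm_qInf hq₀ hq₁ hρ1
  obtain ⟨c₂, hc₂, b₂⟩ := exists_le_norm_qFin hq₀ hq₁ hρ1
  refine ⟨(C₂ * C₁) * (C₂ * C₁) * (C₁ ^ 6) / ((c₂ * c₁) * (c₂ * c₁) * c₁ ^ 4), by positivity,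
    fun r x hx => ?_⟩
  have hx0 : x ≠ 0 := norm_pos_iff.1 (by rw [hx]; exact one_pos)
  set ε := epsSeq q ε₀ r with hε
  have hεr : ε⁻¹ * (q : ℂ) ^ r = ε₀⁻¹ := epsSeq_inv_mul_pow h r
  have hε0 : ε ≠ 0 := h.epsSeq_ne r
  have hεe : ε = ε₀ * (q : ℂ) ^ r := rfl
  have hqr : (q : ℂ) ^ r ≠ 0 := pow_ne_zero _ hqc
  have hqr1 : ‖(q : ℂ) ^ r‖ ≤ 1 := by
    rw [norm_pow, norm_ofReal_of_pos hq₀]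
    exact pow_le_one₀ hq₀.le hq₁.le
  have hqn : ‖(q : ℂ)‖ = q := norm_ofReal_of_pos hq₀
  have g₁ : ‖x‖ ≤ R := by rw [hx, hR]; linarith
  have h1R : 1 ≤ R := by rwa [hx] at g₁
  -- the two normalizing factors
  have p₁ : ‖qInf q (-ε⁻¹ * q)‖ ≤ ‖ε⁻¹ * q‖ ^ r * q ^ r.choose 2 * (C₂ * C₁) := by
    have t₁ : -ε⁻¹ * q * (q : ℂ) ^ r = -(ε₀⁻¹ * q) := by rw [← hεr]; ring
    have t₂ : (-(ε₀⁻¹ * (q : ℂ)))⁻¹ * q = -ε₀ := by field_simp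
    rw [qInf_eq_qFin_mul hq₀ hq₁ _ r, qFin_eq_reflect hq₀ (by simp [hε0, hqc]), t₁, t₂]
    simp only [norm_mul, norm_pow, norm_neg, hqn]
    have k₁ := B₂ (-ε₀) r (by rw [norm_neg, hR]; linarith)
    have k₂ := B₁ (-(ε₀⁻¹ * q)) (by rw [norm_neg, hR]; linarith)
    rw [mul_assoc _ (‖qFin q (-ε₀) r‖)]
    gcongr
  have p₂ : ‖qInf q (-ε⁻¹ * a * q)‖ ≤ ‖ε⁻¹ * a * q‖ ^ r * q ^ r.choose 2 * (C₂ * C₁) := by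
    have ha := h.a_ne
    have t₁ : -ε⁻¹ * a * q * (q : ℂ) ^ r = -(ε₀⁻¹ * a * q) := by rw [← hεr]; ring
    have t₂ : (-(ε₀⁻¹ * a * (q : ℂ)))⁻¹ * q = -(ε₀ * a⁻¹) := by field_simp
    rw [qInf_eq_qFin_mul hq₀ hq₁ _ r, qFin_eq_reflect hq₀ (by simp [hε0, hqc, ha]), t₁, t₂]
    simp only [norm_mul, norm_pow, norm_neg, hqn]
    have k₁ := B₂ (-(ε₀ * a⁻¹)) r (by rw [norm_neg, hR]; linarith)
    have k₂ := B₁ (-(ε₀⁻¹ * a * q)) (by rw [norm_neg, hR]; linarith)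
    rw [mul_assoc _ (‖qFin q (-(ε₀ * a⁻¹)) r‖)]
    gcongr
  -- the large factors of the denominator
  have d₁ : ∀ z : ℂ, ‖z‖ = 1 → ‖ε⁻¹ * (√q : ℝ)‖ ^ r * q ^ r.choose 2 * (c₂ * c₁) ≤
      ‖qInf q (poleBase q a b ε 0 * z)‖ := by
    intro z hz
    have hz0 : z ≠ 0 := norm_pos_iff.1 (by rw [hz]; exact one_pos)
    have t₁ : poleBase q a b ε 0 * z * (q : ℂ) ^ r = ε₀⁻¹ * (√q : ℝ) * z := by
      rw [← hεr]; simp only [poleBase, Matrix.cons_val_zero]; ring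
    have t₂ : (ε₀⁻¹ * (√q : ℝ) * z)⁻¹ * q = ε₀ * (√q : ℝ) * z⁻¹ := by
      rw [← ofReal_sqrt_sq hq₀]; field_simp
    rw [qInf_eq_qFin_mul hq₀ hq₁ _ r, qFin_eq_reflect hq₀
      (mul_ne_zero (poleBase_ne_zero hq₀ h.a_ne h.b_ne hε0 0) hz0), t₁, t₂]
    simp only [norm_mul, norm_pow, norm_neg, hqn, hz, mul_one]
    have k₁ := b₂ (ε₀ * (√q : ℝ) * z⁻¹) r (by
      rw [norm_mul, norm_mul, norm_inv, hz, inv_one, mul_one, hsn]; exact hρ2)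
    have k₂ := b₁ (ε₀⁻¹ * (√q : ℝ) * z) (by
      rw [norm_mul, norm_mul, hz, mul_one, hsn]; exact le_max_left _ _)
    have e : ‖poleBase q a b ε 0‖ = ‖ε⁻¹‖ * ‖((√q : ℝ) : ℂ)‖ := by
      simp [poleBase]
    rw [e, mul_assoc _ (‖qFin q (ε₀ * (√q : ℝ) * z⁻¹) r‖)]
    gcongr
  have d₂ : ∀ z : ℂ, ‖z‖ = 1 → c₁ ≤ ‖qInf q (poleBase q a b ε 1 * z)‖ := by
    intro z hz
    refine b₁ _ ?_
    have e : poleBase q a b ε 1 = ε * b * (√q : ℝ) := rfl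
    rw [e]
    simp only [norm_mul, hz, mul_one, hsn]
    calc ‖ε‖ * ‖b‖ * √q ≤ ‖ε₀‖ * 1 * √q := by
          have := h.b_lt.le
          gcongr
          rw [hεe, norm_mul]
          exact mul_le_of_le_one_right (norm_nonneg _) hqr1
      _ ≤ ρ := by rwa [mul_one]
  have d₃ : ∀ z : ℂ, ‖z‖ = 1 → c₁ ≤ ‖qInf q (poleBase q a b ε 2 * z)‖ := by
    intro z hz
    refine b₁ _ ?_
    simp only [poleBase, Matrix.cons_val, norm_mul, hz, mul_one, hsn, norm_neg]
    calc ‖a‖ * √q ≤ 1 * √q := by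
          have := h.a_lt.le
          gcongr
      _ ≤ ρ := by rwa [one_mul]
  have hxi : ‖x⁻¹‖ = 1 := by rw [norm_inv, hx, inv_one]
  have hcore : ‖coreNumer q x‖ ≤ C₁ ^ 6 := by
    have k₁ := B₁ x g₁
    have k₂ := B₁ (-x) (by rwa [norm_neg])
    have k₃ := B₁ ((√q : ℝ) * x) (by
      rw [norm_mul, hx, mul_one, hsn]; exact hs1.le.trans h1R)
    have k₄ := B₁ (x⁻¹ * q) (by
      rw [norm_mul, hxi, one_mul, hqn]; exact hq₁.le.trans h1R)
    have k₅ := B₁ (-x⁻¹ * q) (by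
      rw [norm_mul, norm_neg, hxi, one_mul, hqn]; exact hq₁.le.trans h1R)
    have k₆ := B₁ ((√q : ℝ) * x⁻¹) (by
      rw [norm_mul, hxi, mul_one, hsn]; exact hs1.le.trans h1R)
    rw [coreNumer]
    simp only [norm_mul]
    calc _ ≤ C₁ * C₁ * C₁ * (C₁ * C₁ * C₁) := by gcongr
      _ = _ := by ring
  set A : ℝ := ‖ε⁻¹ * (√q : ℝ)‖ ^ r * q ^ r.choose 2 with hA
  have hA0 : 0 < A := by
    have : 0 < ‖ε⁻¹ * (√q : ℝ)‖ := norm_pos_iff.2 (mul_ne_zero (inv_ne_zero hε0) hsc)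
    positivity
  have hden : (A * (c₂ * c₁)) * (A * (c₂ * c₁)) * c₁ ^ 4 ≤ ‖poleDenom q a b ε x‖ := by
    rw [poleDenom, Fin.prod_univ_three]
    simp only [norm_mul]
    calc _ = (A * (c₂ * c₁)) * (A * (c₂ * c₁)) * (c₁ * c₁) * (c₁ * c₁) := by ring
      _ ≤ _ := by
        have k₁ := d₁ x hx
        have k₂ := d₁ x⁻¹ hxi
        have k₃ := d₂ x hx
        have k₄ := d₂ x⁻¹ hxi
        have k₅ := d₃ x hx
        have k₆ := d₃ x⁻¹ hxi
        gcongr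
  have hpq : ‖ε⁻¹ * q‖ ^ r * q ^ r.choose 2 * (‖ε⁻¹ * a * q‖ ^ r * q ^ r.choose 2) =
      A * A * (‖a‖ * q) ^ r := by
    rw [hA]
    have : ‖ε⁻¹ * (q : ℂ)‖ * ‖ε⁻¹ * a * q‖ =
        ‖ε⁻¹ * (√q : ℝ)‖ * ‖ε⁻¹ * (√q : ℝ)‖ * (‖a‖ * q) := by
      simp only [norm_mul, hqn, hsn]
      have := Real.sq_sqrt hq₀.le
      linear_combination -(‖ε⁻¹‖ ^ 2 * ‖a‖ * q) * this
    calc _ = (‖ε⁻¹ * (q : ℂ)‖ * ‖ε⁻¹ * a * q‖) ^ r * (q ^ r.choose 2) ^ 2 := by ring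
      _ = _ := by rw [this]; ring
  rw [norm_mul, norm_div, prefactor, norm_mul]
  calc _ ≤ (‖ε⁻¹ * q‖ ^ r * q ^ r.choose 2 * (C₂ * C₁)) *
        (‖ε⁻¹ * a * q‖ ^ r * q ^ r.choose 2 * (C₂ * C₁)) * (C₁ ^ 6 /
          ((A * (c₂ * c₁)) * (A * (c₂ * c₁)) * c₁ ^ 4)) := by gcongr
    _ = (‖ε⁻¹ * q‖ ^ r * q ^ r.choose 2 * (‖ε⁻¹ * a * q‖ ^ r * q ^ r.choose 2)) *
        ((C₂ * C₁) * (C₂ * C₁) * C₁ ^ 6) / ((A * A) * ((c₂ * c₁) * (c₂ * c₁) * c₁ ^ 4)) := by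
        ring
    _ = _ := by
        rw [hpq]
        field_simp

end Bounds

/-! ### The one-variable limit -/

section OneVariable

variable {q : ℝ} {a b ε₀ : ℂ}

lemma Admissible.norm_pole_zero (h : Admissible q a b ε₀) (r s : ℕ) :
    ‖pole q a b (epsSeq q ε₀ r) 0 s‖ = (‖ε₀‖ * q ^ r)⁻¹ * (q ^ s * √q) := by
  have hs : ‖((√q : ℝ) : ℂ)‖ = √q := by rw [Complex.norm_real, Real.norm_of_nonneg h.sqrt_pos.le]
  have e : pole q a b (epsSeq q ε₀ r) 0 s = (epsSeq q ε₀ r)⁻¹ * ((q : ℂ) ^ s * (√q : ℝ)) := rfl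
  rw [e, norm_mul, norm_mul, norm_inv, norm_pow, hs, h.norm_epsSeq, norm_ofReal_of_pos h.q_pos]

/-- A gap between the outer poles and the unit circle that is uniform in `r` and `s`; it later
bounds `1 - y⁻²` away from zero. -/
lemma Admissible.norm_pole_zero_of_lt (h : Admissible q a b ε₀) {r s : ℕ} (hrs : s < r) :
    (‖ε₀‖ * √q)⁻¹ ≤ ‖pole q a b (epsSeq q ε₀ r) 0 s‖ := by
  have hq₀ := h.q_pos
  have hs0 := h.sqrt_pos
  have he := h.norm_eps_pos
  rw [h.norm_pole_zero, ← inv_inv (q ^ s * √q), ← mul_inv]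
  refine inv_anti₀ (by positivity) ?_
  rw [mul_assoc]
  refine mul_le_mul_of_nonneg_left ?_ he.le
  rw [← div_eq_mul_inv, div_le_iff₀ (by positivity)]
  calc q ^ r ≤ q ^ (s + 1) := pow_le_pow_of_le_one hq₀.le h.q_lt.le hrs
    _ = √q * (q ^ s * √q) := by
      rw [pow_succ]
      linear_combination -(q ^ s) * Real.sq_sqrt hq₀.le

/-- `|x_{r,s}| = |ε₀|⁻¹ q^{s-r+1/2}`, and `q^{1/2} < |ε₀| < q^{-1/2}` puts the unit circle between
`x_{r,r}` and `x_{r,r-1}`. -/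
lemma Admissible.one_lt_norm_pole_zero_iff (h : Admissible q a b ε₀) (r s : ℕ) :
    1 < ‖pole q a b (epsSeq q ε₀ r) 0 s‖ ↔ s < r := by
  have hq₀ := h.q_pos
  have hs0 := h.sqrt_pos
  have he := h.norm_eps_pos
  constructor
  · contrapose!
    intro hrs
    rw [h.norm_pole_zero, inv_mul_le_iff₀ (by positivity), mul_one]
    calc q ^ s * √q ≤ q ^ r * ‖ε₀‖ := by
          have h₁ := pow_le_pow_of_le_one hq₀.le h.q_lt.le hrs
          have h₂ := h.lt_eps.le
          gcongr
      _ = _ := mul_comm _ _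
  · intro hrs
    exact ((one_lt_inv₀ (by positivity)).2 h.eps_lt).trans_le (h.norm_pole_zero_of_lt hrs)

lemma Admissible.norm_pole_one_lt (h : Admissible q a b ε₀) (r s : ℕ) :
    ‖pole q a b (epsSeq q ε₀ r) 1 s‖ < 1 := by
  have hq₀ := h.q_pos
  have hs0 := h.sqrt_pos
  have hs : ‖((√q : ℝ) : ℂ)‖ = √q := by rw [Complex.norm_real, Real.norm_of_nonneg h.sqrt_pos.le]
  have e : pole q a b (epsSeq q ε₀ r) 1 s = epsSeq q ε₀ r * b * ((q : ℂ) ^ s * (√q : ℝ)) := rfl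
  rw [e, norm_mul, norm_mul, norm_mul, norm_pow, hs, h.norm_epsSeq, norm_ofReal_of_pos hq₀]
  have h₁ : q ^ r ≤ 1 := pow_le_one₀ hq₀.le h.q_lt.le
  have h₂ : q ^ s ≤ 1 := pow_le_one₀ hq₀.le h.q_lt.le
  have h₃ := h.b_lt.le
  calc ‖ε₀‖ * q ^ r * ‖b‖ * (q ^ s * √q) ≤ ‖ε₀‖ * 1 * 1 * (1 * √q) := by gcongr
    _ = ‖ε₀‖ * √q := by ring
    _ < 1 := h.eps_lt

lemma Admissible.norm_pole_two_lt (h : Admissible q a b ε₀) (r s : ℕ) :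
    ‖pole q a b (epsSeq q ε₀ r) 2 s‖ < 1 := by
  have hq₀ := h.q_pos
  have hs0 := h.sqrt_pos
  have hs : ‖((√q : ℝ) : ℂ)‖ = √q := by rw [Complex.norm_real, Real.norm_of_nonneg h.sqrt_pos.le]
  have e : pole q a b (epsSeq q ε₀ r) 2 s = -a * ((q : ℂ) ^ s * (√q : ℝ)) := rfl
  rw [e, norm_mul, norm_mul, norm_neg, norm_pow, hs, norm_ofReal_of_pos hq₀]
  have h₂ : q ^ s ≤ 1 := pow_le_one₀ hq₀.le h.q_lt.le
  have h₃ := h.a_lt.le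
  calc ‖a‖ * (q ^ s * √q) ≤ 1 * (1 * √q) := by gcongr
    _ < 1 := by simpa using h.sqrt_lt

/-- The residues that occur have `η` in the disc on which `weightFun` is bounded: `|ε₀| q^{r-s} ≤
|ε₀| q < q^{1/2}`. -/
lemma Admissible.norm_eta_le (h : Admissible q a b ε₀) {r s : ℕ} (hrs : s < r) :
    ‖epsSeq q ε₀ r * ((q : ℂ) ^ s)⁻¹‖ ≤ √q := by
  have hq₀ := h.q_pos
  have hs0 := h.sqrt_pos
  have he := h.norm_eps_pos
  rw [norm_mul, h.norm_epsSeq, norm_inv, norm_pow, norm_ofReal_of_pos hq₀, ← div_eq_mul_inv,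
    div_le_iff₀ (by positivity)]
  calc ‖ε₀‖ * q ^ r ≤ ‖ε₀‖ * q ^ (s + 1) := by
        gcongr ‖ε₀‖ * ?_
        exact pow_le_pow_of_le_one hq₀.le h.q_lt.le hrs
    _ = (‖ε₀‖ * √q) * (√q * q ^ s) := by
        rw [pow_succ]
        linear_combination -(‖ε₀‖ * q ^ s) * Real.sq_sqrt hq₀.le
    _ ≤ 1 * (√q * q ^ s) := by
        have := h.eps_lt.le
        gcongr
    _ = _ := one_mul _

lemma Admissible.summable_pow (h : Admissible q a b ε₀) :
    Summable fun s : ℕ => (‖a‖ * q) ^ s :=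
  summable_geometric_of_lt_one (mul_nonneg (norm_nonneg _) h.q_pos.le)
    (mul_lt_one_of_nonneg_of_lt_one_left (norm_nonneg _) h.a_lt h.q_lt.le)

/-- The integrand of the one-variable contour integral. -/
noncomputable def oneVarIntegrand (q : ℝ) (a b ε : ℂ) (N : ℂ → ℂ) (x : ℂ) : ℂ :=
  coreNumer q x * N x * x⁻¹ / poleDenom q a b ε x

/-- The normalized one-variable contour integral is a sum of residues and an integral over the
unit circle. -/
lemma prefactor_mul_integral_eq (h : Admissible q a b ε₀) (hgen : Generic q a b ε₀) {r : ℕ}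
    {γ : ℝ → ℂ} (hγ : IsDeformedContour q a b (epsSeq q ε₀ r) γ) {N : ℂ → ℂ}
    (hN : ∀ x ≠ 0, DifferentiableAt ℂ N x) :
    prefactor q a (epsSeq q ε₀ r) * ((2 * (Real.pi : ℂ) * Complex.I)⁻¹ *
      ∫ u in (0 : ℝ)..1, oneVarIntegrand q a b (epsSeq q ε₀ r) N (γ u) * deriv γ u) =
    (2 * (Real.pi : ℂ) * Complex.I)⁻¹ * (∮ x in C(0, 1), prefactor q a (epsSeq q ε₀ r) *
      (coreNumer q x / poleDenom q a b (epsSeq q ε₀ r) x) * (N x * x⁻¹)) +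
    ∑ s ∈ Finset.range r, weightFun q a b s (epsSeq q ε₀ r * ((q : ℂ) ^ s)⁻¹) *
      (N (pole q a b (epsSeq q ε₀ r) 0 s) / (1 - (pole q a b (epsSeq q ε₀ r) 0 s ^ 2)⁻¹) +
        N (pole q a b (epsSeq q ε₀ r) 0 s)⁻¹ / (1 - pole q a b (epsSeq q ε₀ r) 0 s ^ 2)) := by
  have hq₀ := h.q_pos
  have hq₁ := h.q_lt
  have hε := h.epsSeq_ne r
  have hinj : Function.Injective (polePoint q a b (epsSeq q ε₀ r)) := (hgen r).1
  simp only [oneVarIntegrand]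
  rw [hγ.integral_div_poleDenom (H := fun x => coreNumer q x * N x * x⁻¹) hq₀ hq₁ h.a_ne h.b_ne hε
    hinj (fun i s => ((hgen r).2 i s).1) (h.one_lt_norm_pole_zero_iff r) (h.norm_pole_one_lt r)
    (h.norm_pole_two_lt r)
    (fun x hx => ((differentiableAt_coreNumer hq₀ hq₁ hx).mul (hN x hx)).mul
      (differentiableAt_inv hx)), mul_add, mul_add,
    inv_mul_cancel_left₀ Complex.two_pi_I_ne_zero]
  congr 1
  · rw [mul_left_comm, ← circleIntegral.integral_const_mul]
    congr 1
    refine circleIntegral.integral_congr zero_le_one fun x _ => ?_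
    ring
  · rw [Finset.mul_sum]
    refine Finset.sum_congr rfl fun s hs => ?_
    rw [← prefactor_mul_residue hq₀ hq₁ h.a_ne h.b_ne hε hinj s]
    set y := pole q a b (epsSeq q ε₀ r) 0 s
    have hy1 : 1 < ‖y‖ := (h.one_lt_norm_pole_zero_iff r s).2 (Finset.mem_range.1 hs)
    have hy0 : y ≠ 0 := norm_pos_iff.1 (one_pos.trans hy1)
    have hy2 : 1 - y ^ 2 ≠ 0 := by
      intro e
      have : ‖y ^ 2‖ = 1 := by rw [← sub_eq_zero.1 e, norm_one]
      rw [norm_pow] at this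
      nlinarith
    have hy2' : 1 - (y ^ 2)⁻¹ ≠ 0 := by
      intro e
      apply hy2
      field_simp at e
      linear_combination -e
    -- The symmetric numerator takes the same value at `y` and `1/y`, so the two residues share one
    -- weight and differ only through `N` and the factor `1 - x⁻²`.
    have e₁ : coreNumer q y = symNumer q y / (1 - (y ^ 2)⁻¹) := by
      rw [symNumer_eq hq₀ hq₁, mul_div_cancel_left₀ _ hy2']
    have e₂ : coreNumer q y⁻¹ = symNumer q y / (1 - y ^ 2) := by
      rw [← symNumer_inv, symNumer_eq hq₀ hq₁, inv_pow, inv_inv, mul_div_cancel_left₀ _ hy2]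
    rw [e₁, e₂, inv_inv, mul_assoc _ y⁻¹ y, inv_mul_cancel₀ hy0, mul_assoc _ y y⁻¹,
      mul_inv_cancel₀ hy0]
    ring

/-- The limit of the normalized one-variable contour integrals. -/
theorem tendsto_prefactor_mul_integral (h : Admissible q a b ε₀) (hgen : Generic q a b ε₀)
    {γ : ℕ → ℝ → ℂ} (hγ : ∀ r, IsDeformedContour q a b (epsSeq q ε₀ r) (γ r)) {N : ℕ → ℂ → ℂ}
    (hN : ∀ r, ∀ x ≠ 0, DifferentiableAt ℂ (N r) x) {C : ℝ}
    (hC : ∀ r x, ‖x‖ = 1 → ‖N r x‖ ≤ C) {A B : ℕ → ℂ}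
    (hA : ∀ r s, s < r → ‖N r (pole q a b (epsSeq q ε₀ r) 0 s) /
      (1 - (pole q a b (epsSeq q ε₀ r) 0 s ^ 2)⁻¹)‖ ≤ C)
    (hB : ∀ r s, s < r → ‖N r (pole q a b (epsSeq q ε₀ r) 0 s)⁻¹ /
      (1 - pole q a b (epsSeq q ε₀ r) 0 s ^ 2)‖ ≤ C)
    (tA : ∀ s, Tendsto (fun r => N r (pole q a b (epsSeq q ε₀ r) 0 s) /
      (1 - (pole q a b (epsSeq q ε₀ r) 0 s ^ 2)⁻¹)) atTop (𝓝 (A s)))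
    (tB : ∀ s, Tendsto (fun r => N r (pole q a b (epsSeq q ε₀ r) 0 s)⁻¹ /
      (1 - pole q a b (epsSeq q ε₀ r) 0 s ^ 2)) atTop (𝓝 (B s))) :
    Summable (fun s => ‖weightFun q a b s 0 * (A s + B s)‖) ∧
    Tendsto (fun r => prefactor q a (epsSeq q ε₀ r) * ((2 * (Real.pi : ℂ) * Complex.I)⁻¹ *
      ∫ u in (0 : ℝ)..1, oneVarIntegrand q a b (epsSeq q ε₀ r) (N r) (γ r u) * deriv (γ r) u))
      atTop (𝓝 (∑' s, weightFun q a b s 0 * (A s + B s))) := by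
  have hq₀ := h.q_pos
  have haq : ‖a‖ * q < 1 := mul_lt_one_of_nonneg_of_lt_one_left (norm_nonneg _) h.a_lt h.q_lt.le
  have haq0 : 0 ≤ ‖a‖ * q := mul_nonneg (norm_nonneg _) hq₀.le
  obtain ⟨C₁, hC₁, hw⟩ := exists_norm_weightFun_le h
  obtain ⟨C₂, hC₂, hcirc⟩ := exists_norm_circle_le h
  have hC0 : 0 ≤ C := (norm_nonneg _).trans (hC 0 1 (by simp))
  have hAs : ∀ s, ‖A s‖ ≤ C := fun s => le_of_tendsto (tA s).norm
    ((eventually_gt_atTop s).mono fun r hr => hA r s hr)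
  have hBs : ∀ s, ‖B s‖ ≤ C := fun s => le_of_tendsto (tB s).norm
    ((eventually_gt_atTop s).mono fun r hr => hB r s hr)
  have hbound : Summable fun s : ℕ => C₁ * (‖a‖ * q) ^ s * (C + C) :=
    (h.summable_pow.mul_left C₁).mul_right _
  refine ⟨hbound.of_nonneg_of_le (fun s => norm_nonneg _) fun s => ?_, ?_⟩
  · rw [norm_mul]
    have h₁ := hw s 0 (by simp)
    have h₂ := (norm_add_le (A s) (B s)).trans (add_le_add (hAs s) (hBs s))
    gcongr
  have hη (s : ℕ) : Tendsto (fun r => epsSeq q ε₀ r * ((q : ℂ) ^ s)⁻¹) atTop (𝓝 0) := by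
    simpa using h.tendsto_epsSeq.mul_const (((q : ℂ) ^ s)⁻¹)
  -- The finite sums over `s < r` are extended by zero so that dominated convergence for series
  -- applies, with majorant `(|a| q)^s`.
  have lim_res : Tendsto (fun r => ∑' s, if s < r then
      weightFun q a b s (epsSeq q ε₀ r * ((q : ℂ) ^ s)⁻¹) *
      (N r (pole q a b (epsSeq q ε₀ r) 0 s) / (1 - (pole q a b (epsSeq q ε₀ r) 0 s ^ 2)⁻¹) +
        N r (pole q a b (epsSeq q ε₀ r) 0 s)⁻¹ / (1 - pole q a b (epsSeq q ε₀ r) 0 s ^ 2)) else 0)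
      atTop (𝓝 (∑' s, weightFun q a b s 0 * (A s + B s))) := by
    refine tendsto_tsum_of_dominated_convergence hbound (fun s => ?_)
      (Eventually.of_forall fun r s => ?_)
    · refine Tendsto.congr' ?_ (((tendsto_weightFun h s).comp (hη s)).mul ((tA s).add (tB s)))
      filter_upwards [eventually_gt_atTop s] with r hr
      simp [hr]
    · split_ifs with hs
      · rw [norm_mul]
        have h₁ := hw s _ (h.norm_eta_le hs)
        have h₂ := (norm_add_le _ _).trans (add_le_add (hA r s hs) (hB r s hs))
        gcongr
      · rw [norm_zero]
        positivity
  have lim_circ : Tendsto (fun r => (2 * (Real.pi : ℂ) * Complex.I)⁻¹ *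
      (∮ x in C(0, 1), prefactor q a (epsSeq q ε₀ r) *
      (coreNumer q x / poleDenom q a b (epsSeq q ε₀ r) x) * (N r x * x⁻¹))) atTop (𝓝 0) := by
    have key : Tendsto (fun r => ∮ x in C(0, 1), prefactor q a (epsSeq q ε₀ r) *
        (coreNumer q x / poleDenom q a b (epsSeq q ε₀ r) x) * (N r x * x⁻¹)) atTop (𝓝 0) := by
      refine squeeze_zero_norm (a := fun r =>
        2 * Real.pi * 1 * (C₂ * (‖a‖ * q) ^ r * C)) (fun r => ?_) ?_
      · refine circleIntegral.norm_integral_le_of_norm_le_const zero_le_one fun x hx => ?_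
        have hx1 : ‖x‖ = 1 := mem_sphere_zero_iff_norm.1 hx
        rw [norm_mul, norm_mul (N r x), norm_inv, hx1, inv_one, mul_one]
        have h₁ := hcirc r x hx1
        have h₂ := hC r x hx1
        gcongr
      · have := (tendsto_pow_atTop_nhds_zero_of_lt_one haq0 haq)
        simpa using ((this.const_mul C₂).mul_const C).const_mul (2 * Real.pi * 1)
    have := key.const_mul (2 * (Real.pi : ℂ) * Complex.I)⁻¹
    rwa [mul_zero] at this
  have := lim_circ.add lim_res
  rw [zero_add] at this
  refine this.congr fun r => ?_
  rw [prefactor_mul_integral_eq h hgen (hγ r) (hN r)]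
  congr 1
  rw [tsum_eq_sum (s := Finset.range r)]
  · exact Finset.sum_congr rfl fun s hs => if_pos (Finset.mem_range.1 hs)
  · intro s hs
    exact if_neg fun h => hs (Finset.mem_range.2 h)

end OneVariable

/-! ### Many variables: monomials and Fubini -/

section ManyVariables

variable {q : ℝ} {a b ε₀ ε : ℂ}

lemma volume_restrict_Icc_pi (n : ℕ) :
    (volume : Measure (Fin n → ℝ)).restrict (Icc 0 1) =
      Measure.pi fun _ => (volume : Measure ℝ).restrict (Icc 0 1) := by
  rw [volume_pi, ← Measure.restrict_pi_pi, pi_univ_Icc]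
  rfl

/-- A product of absolutely convergent series is an absolutely convergent multiple series. -/
lemma summable_norm_and_tsum_prod : ∀ {n : ℕ} (f : Fin n → ℕ → ℂ),
    (∀ i, Summable fun s => ‖f i s‖) →
    (Summable fun s : Fin n → ℕ => ‖∏ i, f i (s i)‖) ∧
      ∑' s : Fin n → ℕ, ∏ i, f i (s i) = ∏ i, ∑' s, f i s
  | 0, f, _ => by
    refine ⟨(hasSum_fintype _).summable, ?_⟩
    rw [tsum_fintype]
    simp
  | n + 1, f, hf => by
    obtain ⟨h₁, h₂⟩ := summable_norm_and_tsum_prod (fun i => f i.succ) fun i => hf i.succ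
    have e (p : ℕ × (Fin n → ℕ)) : ∏ i, f i ((Fin.consEquiv fun _ => ℕ) p i) =
        f 0 p.1 * ∏ i : Fin n, f i.succ (p.2 i) := by
      rw [Fin.prod_univ_succ]
      simp [Fin.consEquiv]
    constructor
    · rw [← (Fin.consEquiv fun _ => ℕ).summable_iff]
      refine (Summable.mul_norm (hf 0) h₁).congr fun p => ?_
      simp only [Function.comp_apply, e]
    · rw [← (Fin.consEquiv fun _ => ℕ).tsum_eq, Fin.prod_univ_succ, ← h₂,
        tsum_mul_tsum_of_summable_norm (hf 0) h₁]
      exact tsum_congr e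

lemma poleDenom_ne_zero (hq₀ : 0 < q) (hq₁ : q < 1) {x : ℂ} (hx : x ≠ 0)
    (hp : ∀ i s, x ≠ pole q a b ε i s) (hp' : ∀ i s, x ≠ (pole q a b ε i s)⁻¹) :
    poleDenom q a b ε x ≠ 0 := by
  refine Finset.prod_ne_zero_iff.2 fun i _ => mul_ne_zero ?_ ?_
  · refine qInf_ne_zero hq₀ hq₁ fun s hs => hp' i s (eq_inv_of_mul_eq_one_left ?_)
    rw [pole_eq, ← hs]
    ring
  · refine qInf_ne_zero hq₀ hq₁ fun s hs => hp i s ?_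
    rw [pole_eq]
    field_simp at hs
    exact hs.symm

lemma IsDeformedContour.continuousOn_oneVarIntegrand (hq₀ : 0 < q) (hq₁ : q < 1) {γ : ℝ → ℂ}
    (hγ : IsDeformedContour q a b ε γ) {N : ℂ → ℂ} (hN : ∀ x ≠ 0, DifferentiableAt ℂ N x) :
    ContinuousOn (fun u => oneVarIntegrand q a b ε N (γ u)) (Icc 0 1) := by
  have hd := differentiable_qInf hq₀ hq₁
  intro u hu
  have h0 : γ u ≠ 0 := hγ.origin.1 u hu
  have hi : DifferentiableAt ℂ (fun x : ℂ => x⁻¹) (γ u) := differentiableAt_inv h0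
  have hD : DifferentiableAt ℂ (poleDenom q a b ε) (γ u) := by
    refine DifferentiableAt.fun_finsetProd fun i _ => DifferentiableAt.mul ?_ ?_
    · exact (hd _).comp (γ u) (by fun_prop)
    · exact (hd _).comp (γ u) (hi.const_mul _)
  have hF : ContinuousAt (oneVarIntegrand q a b ε N) (γ u) :=
    (((differentiableAt_coreNumer hq₀ hq₁ h0).mul (hN _ h0)).mul hi).continuousAt.div
      hD.continuousAt (poleDenom_ne_zero hq₀ hq₁ h0 (fun i s => (hγ.inside i s).1 u hu)
        fun i s => (hγ.outside i s).1 u hu)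
  exact hF.comp_continuousWithinAt (hγ.curve.continuousOn u hu)

/-- The values `ε x_i` (for `true`) and `ε / x_i` (for `false`). -/
noncomputable def scaledVars {n : ℕ} (ε : ℂ) (x : Fin n → ℂ) (p : Fin n × Bool) : ℂ :=
  if p.2 then ε * x p.1 else ε * (x p.1)⁻¹

/-- The limits of the scaled variables: `ε x_i` or `ε / x_i` (according to `σ i`) has the limit
`q^{s_i+1/2}`, and the other one has the limit zero. -/
noncomputable def limitVars {n : ℕ} (q : ℝ) (σ : Fin n → Bool) (s : Fin n → ℕ)
    (p : Fin n × Bool) : ℂ :=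
  if p.2 = σ p.1 then (q : ℂ) ^ s p.1 * (√q : ℝ) else 0

/-- The bounds and limits required of the numerator of a one-variable weight. The limit is attained
at the large poles if `σ` is true, and at the small ones otherwise. -/
structure TameNumerator (q : ℝ) (a b ε₀ : ℂ) (σ : Bool) (L : ℕ → ℂ) (N : ℕ → ℂ → ℂ) : Prop where
  differentiable : ∀ r, ∀ x ≠ 0, DifferentiableAt ℂ (N r) x
  bound : ∃ C, (∀ r x, ‖x‖ = 1 → ‖N r x‖ ≤ C) ∧
    (∀ r s, s < r → ‖N r (pole q a b (epsSeq q ε₀ r) 0 s) /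
      (1 - (pole q a b (epsSeq q ε₀ r) 0 s ^ 2)⁻¹)‖ ≤ C) ∧
    (∀ r s, s < r → ‖N r (pole q a b (epsSeq q ε₀ r) 0 s)⁻¹ /
      (1 - pole q a b (epsSeq q ε₀ r) 0 s ^ 2)‖ ≤ C)
  tendsto_large : ∀ s, Tendsto (fun r => N r (pole q a b (epsSeq q ε₀ r) 0 s) /
      (1 - (pole q a b (epsSeq q ε₀ r) 0 s ^ 2)⁻¹)) atTop (𝓝 (if σ then L s else 0))
  tendsto_small : ∀ s, Tendsto (fun r => N r (pole q a b (epsSeq q ε₀ r) 0 s)⁻¹ /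
      (1 - pole q a b (epsSeq q ε₀ r) 0 s ^ 2)) atTop (𝓝 (if σ then 0 else L s))

lemma Admissible.eps_mul_pole (h : Admissible q a b ε₀) (r s : ℕ) :
    epsSeq q ε₀ r * pole q a b (epsSeq q ε₀ r) 0 s = (q : ℂ) ^ s * (√q : ℝ) := by
  have e : pole q a b (epsSeq q ε₀ r) 0 s = (epsSeq q ε₀ r)⁻¹ * ((q : ℂ) ^ s * (√q : ℝ)) := rfl
  rw [e, mul_inv_cancel_left₀ (h.epsSeq_ne r)]

lemma epsSeq_mul_pole_inv (r s : ℕ) :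
    epsSeq q ε₀ r * (pole q a b (epsSeq q ε₀ r) 0 s)⁻¹ =
      epsSeq q ε₀ r ^ 2 * ((q : ℂ) ^ s * (√q : ℝ))⁻¹ := by
  have e : pole q a b (epsSeq q ε₀ r) 0 s = (epsSeq q ε₀ r)⁻¹ * ((q : ℂ) ^ s * (√q : ℝ)) := rfl
  rw [e, mul_inv, inv_inv]
  ring

lemma Admissible.norm_epsSeq_le (h : Admissible q a b ε₀) (r : ℕ) :
    ‖epsSeq q ε₀ r‖ ≤ ‖ε₀‖ := by
  rw [h.norm_epsSeq]
  exact mul_le_of_le_one_right (norm_nonneg _) (pow_le_one₀ h.q_pos.le h.q_lt.le)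

/-- Multiplication of a numerator by a monomial in `ε x` and `ε / x`. -/
lemma TameNumerator.tendsto_integral_monomial (h : Admissible q a b ε₀)
    (hgen : Generic q a b ε₀) {γ : ℕ → ℝ → ℂ}
    (hγ : ∀ r, IsDeformedContour q a b (epsSeq q ε₀ r) (γ r)) {σ : Bool} {L : ℕ → ℂ}
    {N : ℕ → ℂ → ℂ} (hN : TameNumerator q a b ε₀ σ L N) (k l : ℕ) :
    Summable (fun s => ‖weightFun q a b s 0 * L s *
      ((if σ then (q : ℂ) ^ s * (√q : ℝ) else 0) ^ k *
        (if σ then 0 else (q : ℂ) ^ s * (√q : ℝ)) ^ l)‖) ∧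
    Tendsto (fun r => prefactor q a (epsSeq q ε₀ r) * ((2 * (Real.pi : ℂ) * Complex.I)⁻¹ *
      ∫ u in (0 : ℝ)..1, oneVarIntegrand q a b (epsSeq q ε₀ r)
        (fun x => N r x * ((epsSeq q ε₀ r * x) ^ k * (epsSeq q ε₀ r * x⁻¹) ^ l)) (γ r u) *
          deriv (γ r) u))
      atTop (𝓝 (∑' s, weightFun q a b s 0 * L s *
      ((if σ then (q : ℂ) ^ s * (√q : ℝ) else 0) ^ k *
        (if σ then 0 else (q : ℂ) ^ s * (√q : ℝ)) ^ l))) := by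
  obtain ⟨C, hC, hA, hB⟩ := hN.bound
  have hq₀ := h.q_pos
  have hs0 := h.sqrt_pos
  have hC0 : 0 ≤ C := (norm_nonneg _).trans (hC 0 1 (by simp))
  set R : ℝ := 1 + ‖ε₀‖ with hR
  have hR1 : 1 ≤ R := by rw [hR]; linarith [norm_nonneg ε₀]
  have hεR : ∀ r, ‖epsSeq q ε₀ r‖ ≤ R := fun r => (h.norm_epsSeq_le r).trans (by rw [hR]; linarith)
  have hsn : ‖((√q : ℝ) : ℂ)‖ = √q := by rw [Complex.norm_real, Real.norm_of_nonneg hs0.le]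
  have hu : ∀ s : ℕ, ‖(q : ℂ) ^ s * (√q : ℝ)‖ ≤ R := by
    intro s
    rw [norm_mul, norm_pow, norm_ofReal_of_pos hq₀, hsn]
    calc q ^ s * √q ≤ 1 * 1 := by
          have := h.sqrt_lt.le
          gcongr
          exact pow_le_one₀ hq₀.le h.q_lt.le
      _ ≤ R := by rwa [mul_one]
  have hw : ∀ r s, s < r → ‖epsSeq q ε₀ r ^ 2 * ((q : ℂ) ^ s * (√q : ℝ))⁻¹‖ ≤ R := by
    intro r s hrs
    have h₁ := h.norm_eta_le hrs
    have e : epsSeq q ε₀ r ^ 2 * ((q : ℂ) ^ s * (√q : ℝ))⁻¹ =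
        epsSeq q ε₀ r * ((epsSeq q ε₀ r * ((q : ℂ) ^ s)⁻¹) * ((√q : ℝ) : ℂ)⁻¹) := by
      rw [mul_inv]
      ring
    rw [e, norm_mul, norm_mul, norm_inv, hsn, ← div_eq_mul_inv]
    calc _ ≤ R * 1 := by
          have := hεR r
          gcongr
          exact (div_le_one hs0).2 h₁
      _ = R := mul_one R
  have hpow : ∀ (z w : ℂ), ‖z‖ ≤ R → ‖w‖ ≤ R → ‖z ^ k * w ^ l‖ ≤ R ^ (k + l) := by
    intro z w hz hw
    rw [norm_mul, norm_pow, norm_pow, pow_add]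
    gcongr
  have hε2 (s : ℕ) : Tendsto (fun r => epsSeq q ε₀ r ^ 2 * ((q : ℂ) ^ s * (√q : ℝ))⁻¹) atTop
      (𝓝 0) := by
    have := (h.tendsto_epsSeq.pow 2).mul_const ((q : ℂ) ^ s * (√q : ℝ))⁻¹
    simpa using this
  have hCR : C ≤ C * R ^ (k + l) := le_mul_of_one_le_right hC0 (one_le_pow₀ hR1)
  -- At the pole `ε x` equals `q^{s+1/2}` and `ε/x = ε² q^{-s-1/2}` tends to zero; at its reciprocal
  -- the roles are exchanged. The powers `0 ^ l` and `0 ^ k` record this, with `0 ^ 0 = 1` when the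
  -- vanishing variable is absent from the monomial.
  have main := tendsto_prefactor_mul_integral h hgen hγ
    (N := fun r x => N r x * ((epsSeq q ε₀ r * x) ^ k * (epsSeq q ε₀ r * x⁻¹) ^ l))
    (C := C * R ^ (k + l))
    (A := fun s => (if σ then L s else 0) * (((q : ℂ) ^ s * (√q : ℝ)) ^ k * 0 ^ l))
    (B := fun s => (if σ then 0 else L s) * (0 ^ k * ((q : ℂ) ^ s * (√q : ℝ)) ^ l))
    (fun r x hx => by
      have h₁ := hN.differentiable r x hx
      have h₂ : DifferentiableAt ℂ (fun x : ℂ => x⁻¹) x := differentiableAt_inv hx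
      fun_prop)
    (fun r x hx => by
      rw [norm_mul]
      have h₁ := hC r x hx
      have h₂ := hpow (epsSeq q ε₀ r * x) (epsSeq q ε₀ r * x⁻¹)
        (by rw [norm_mul, hx, mul_one]; exact hεR r)
        (by rw [norm_mul, norm_inv, hx, inv_one, mul_one]; exact hεR r)
      gcongr)
    (fun r s hrs => by
      rw [mul_div_right_comm, norm_mul, h.eps_mul_pole, epsSeq_mul_pole_inv]
      have h₁ := hA r s hrs
      have h₂ := hpow _ _ (hu s) (hw r s hrs)
      gcongr)
    (fun r s hrs => by
      rw [mul_div_right_comm, norm_mul, inv_inv, h.eps_mul_pole, epsSeq_mul_pole_inv]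
      have h₁ := hB r s hrs
      have h₂ := hpow _ _ (hw r s hrs) (hu s)
      gcongr)
    (fun s => by
      simp only [h.eps_mul_pole, epsSeq_mul_pole_inv, mul_div_right_comm]
      exact (hN.tendsto_large s).mul (((hε2 s).pow l).const_mul _))
    (fun s => by
      simp only [inv_inv, h.eps_mul_pole, epsSeq_mul_pole_inv, mul_div_right_comm]
      exact (hN.tendsto_small s).mul (((hε2 s).pow k).mul_const _))
  have e : ∀ s, weightFun q a b s 0 *
      ((if σ then L s else 0) * (((q : ℂ) ^ s * (√q : ℝ)) ^ k * 0 ^ l) +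
      (if σ then 0 else L s) * (0 ^ k * ((q : ℂ) ^ s * (√q : ℝ)) ^ l)) =
      weightFun q a b s 0 * L s * ((if σ then (q : ℂ) ^ s * (√q : ℝ) else 0) ^ k *
        (if σ then 0 else (q : ℂ) ^ s * (√q : ℝ)) ^ l) := by
    intro s
    cases σ <;> simp [mul_assoc]
  simp only [e] at main
  exact main

/-- The limit of the many-variable contour integrals, for a product of one-variable weights and a
polynomial in the scaled variables. -/
theorem tendsto_prefactor_pow_mul_integral {n : ℕ} (h : Admissible q a b ε₀)
    (hgen : Generic q a b ε₀) {γ : ℕ → ℝ → ℂ}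
    (hγ : ∀ r, IsDeformedContour q a b (epsSeq q ε₀ r) (γ r)) {σ : Fin n → Bool}
    {L : Fin n → ℕ → ℂ} {N : Fin n → ℕ → ℂ → ℂ}
    (hN : ∀ i, TameNumerator q a b ε₀ (σ i) (L i) (N i)) (Φ : MvPolynomial (Fin n × Bool) ℂ) :
    (∀ r, IntegrableOn (fun u : Fin n → ℝ =>
      (∏ i, oneVarIntegrand q a b (epsSeq q ε₀ r) (N i r) (γ r (u i)) * deriv (γ r) (u i)) *
        MvPolynomial.eval (scaledVars (epsSeq q ε₀ r) fun i => γ r (u i)) Φ) (Icc 0 1)) ∧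
    Summable (fun s : Fin n → ℕ => ‖(∏ i, weightFun q a b (s i) 0 * L i (s i)) *
      MvPolynomial.eval (limitVars q σ s) Φ‖) ∧
    Tendsto (fun r => prefactor q a (epsSeq q ε₀ r) ^ n *
      (1 / (2 * (Real.pi : ℂ) * Complex.I) ^ n * ∫ u in Icc (0 : Fin n → ℝ) 1,
        (∏ i, oneVarIntegrand q a b (epsSeq q ε₀ r) (N i r) (γ r (u i)) * deriv (γ r) (u i)) *
          MvPolynomial.eval (scaledVars (epsSeq q ε₀ r) fun i => γ r (u i)) Φ)) atTop
      (𝓝 (∑' s : Fin n → ℕ, (∏ i, weightFun q a b (s i) 0 * L i (s i)) *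
        MvPolynomial.eval (limitVars q σ s) Φ)) := by
  have hmono : ∀ (f : Fin n × Bool → ℂ) (d : Fin n × Bool →₀ ℕ),
      ∏ p, f p ^ d p = ∏ i, f (i, true) ^ d (i, true) * f (i, false) ^ d (i, false) := by
    intro f d
    rw [Fintype.prod_prod_type]
    simp only [Fintype.prod_bool]
  set mono : (Fin n × Bool →₀ ℕ) → Fin n → ℕ → ℂ → ℂ := fun d i r x =>
    N i r x * ((epsSeq q ε₀ r * x) ^ d (i, true) * (epsSeq q ε₀ r * x⁻¹) ^ d (i, false)) with hm
  set T : (Fin n × Bool →₀ ℕ) → Fin n → ℕ → ℂ := fun d i s => weightFun q a b s 0 * L i s *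
      ((if σ i then (q : ℂ) ^ s * (√q : ℝ) else 0) ^ d (i, true) *
        (if σ i then 0 else (q : ℂ) ^ s * (√q : ℝ)) ^ d (i, false)) with hT
  have hone := fun (d : Fin n × Bool →₀ ℕ) (i : Fin n) =>
    (hN i).tendsto_integral_monomial h hgen hγ (d (i, true)) (d (i, false))
  -- Each monomial in the scaled variables is a product over `i` of functions of `x_i` alone and is
  -- absorbed into the numerators `N i r`.
  have hint : ∀ r, (fun u : Fin n → ℝ =>
      (∏ i, oneVarIntegrand q a b (epsSeq q ε₀ r) (N i r) (γ r (u i)) * deriv (γ r) (u i)) *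
        MvPolynomial.eval (scaledVars (epsSeq q ε₀ r) fun i => γ r (u i)) Φ) =
      fun u => ∑ d ∈ Φ.support, Φ.coeff d * ∏ i,
        (oneVarIntegrand q a b (epsSeq q ε₀ r) (mono d i r) (γ r (u i)) * deriv (γ r) (u i)) := by
    intro r
    funext u
    rw [MvPolynomial.eval_eq', Finset.mul_sum]
    refine Finset.sum_congr rfl fun d _ => ?_
    rw [mul_left_comm, hmono, ← Finset.prod_mul_distrib]
    congr 1
    refine Finset.prod_congr rfl fun i _ => ?_
    simp only [scaledVars, oneVarIntegrand, hm, if_true, Bool.false_eq_true, if_false]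
    ring
  have hlim : ∀ s : Fin n → ℕ, (∏ i, weightFun q a b (s i) 0 * L i (s i)) *
      MvPolynomial.eval (limitVars q σ s) Φ =
      ∑ d ∈ Φ.support, Φ.coeff d * ∏ i, T d i (s i) := by
    intro s
    rw [MvPolynomial.eval_eq', Finset.mul_sum]
    refine Finset.sum_congr rfl fun d _ => ?_
    rw [mul_left_comm, hmono, ← Finset.prod_mul_distrib]
    congr 1
    refine Finset.prod_congr rfl fun i _ => ?_
    simp only [limitVars, hT]
    cases σ i <;> simp
  have hintegrable : ∀ r d i, IntegrableOn (fun u => oneVarIntegrand q a b (epsSeq q ε₀ r)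
      (mono d i r) (γ r u) * deriv (γ r) u) (Icc 0 1) := by
    intro r d i
    refine (hγ r).curve.integrableOn_mul_deriv ((hγ r).continuousOn_oneVarIntegrand h.q_pos h.q_lt
      fun x hx => ?_)
    have h₁ := (hN i).differentiable r x hx
    have h₂ : DifferentiableAt ℂ (fun x : ℂ => x⁻¹) x := differentiableAt_inv hx
    fun_prop
  have hprodint : ∀ r d, Integrable (fun u : Fin n → ℝ => ∏ i, (oneVarIntegrand q a b
      (epsSeq q ε₀ r) (mono d i r) (γ r (u i)) * deriv (γ r) (u i)))
      (Measure.pi fun _ => (volume : Measure ℝ).restrict (Icc 0 1)) := fun r d =>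
    Integrable.fintype_prod fun i => hintegrable r d i
  have hsum := fun d => summable_norm_and_tsum_prod (T d) fun i => (hone d i).1
  refine ⟨fun r => ?_, ?_, ?_⟩
  · rw [hint r, IntegrableOn, volume_restrict_Icc_pi]
    exact integrable_finsetSum _ fun d _ => (hprodint r d).const_mul _
  · simp only [hlim]
    refine Summable.of_nonneg_of_le (fun s => norm_nonneg _) (fun s => norm_sum_le _ _) ?_
    refine summable_sum fun d _ => ?_
    simp only [norm_mul (Φ.coeff d)]
    exact (hsum d).1.mul_left _
  · have hts : ∑' s : Fin n → ℕ, (∏ i, weightFun q a b (s i) 0 * L i (s i)) *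
        MvPolynomial.eval (limitVars q σ s) Φ =
        ∑ d ∈ Φ.support, Φ.coeff d * ∏ i, ∑' s, T d i s := by
      simp only [hlim]
      rw [Summable.tsum_finsetSum fun d _ => ((hsum d).1.of_norm).mul_left _]
      refine Finset.sum_congr rfl fun d _ => ?_
      rw [tsum_mul_left, (hsum d).2]
    rw [hts]
    refine (tendsto_finsetSum Φ.support fun d _ => (tendsto_finsetProd Finset.univ
      fun i _ => (hone d i).2).const_mul (Φ.coeff d)).congr fun r => ?_
    rw [hint r, volume_restrict_Icc_pi, integral_finsetSum _ fun d _ => (hprodint r d).const_mul _,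
      Finset.mul_sum, Finset.mul_sum]
    refine Finset.sum_congr rfl fun d _ => ?_
    rw [integral_const_mul, integral_fintype_prod_eq_prod
      (f := fun i u => oneVarIntegrand q a b (epsSeq q ε₀ r) (mono d i r) (γ r u) *
        deriv (γ r) u), Finset.prod_mul_distrib, Finset.prod_mul_distrib, Finset.prod_const,
      Finset.prod_const, Finset.card_univ, Fintype.card_fin]
    simp only [intervalIntegral.integral_of_le zero_le_one, ← integral_Icc_eq_integral_Ioc, hm]
    rw [inv_pow, one_div]
    ring

end ManyVariables

/-! ### The one-variable numerators in the two cases -/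

section Numerators

variable {q : ℝ} {a b ε₀ : ℂ}

/-- A criterion for tame numerators of the form `C(ε, x, 1/x)`. It uses expressions for the values
at the poles `1/v` and `v`, where `v w = ε`, which stay bounded as `ε` and `v` become small. -/
lemma TameNumerator.of_differentiable (h : Admissible q a b ε₀) {σ : Bool} {L : ℕ → ℂ}
    {C P Q : ℂ × ℂ × ℂ → ℂ} (hC : Differentiable ℂ C) (hP : Continuous P) (hQ : Continuous Q)
    (hCP : ∀ v w, v ≠ 0 → w ≠ 0 → C (v * w, v⁻¹, v) = P (v * w, v, w))
    (hCQ : ∀ v w, v ≠ 0 → w ≠ 0 → v ^ 2 * C (v * w, v, v⁻¹) = -Q (v * w, v, w))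
    (hLP : ∀ s : ℕ, P (0, 0, (q : ℂ) ^ s * (√q : ℝ)) = if σ then L s else 0)
    (hLQ : ∀ s : ℕ, Q (0, 0, (q : ℂ) ^ s * (√q : ℝ)) = if σ then 0 else L s) :
    TameNumerator q a b ε₀ σ L fun r x => C (epsSeq q ε₀ r, x, x⁻¹) := by
  set w : ℕ → ℂ := fun s => (q : ℂ) ^ s * (√q : ℝ) with hw
  set v : ℕ → ℕ → ℂ := fun r s => (pole q a b (epsSeq q ε₀ r) 0 s)⁻¹ with hv
  have hw0 (s) : w s ≠ 0 :=
    mul_ne_zero (pow_ne_zero _ (ofReal_ne_zero_of_pos h.q_pos)) (ofReal_sqrt_ne_zero h.q_pos)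
  have hv0 (r s) : v r s ≠ 0 :=
    inv_ne_zero (pole_ne_zero h.q_pos h.a_ne h.b_ne (h.epsSeq_ne r) 0 s)
  have hvw (r s) : v r s * w s = epsSeq q ε₀ r := by
    change v r s * ((q : ℂ) ^ s * (√q : ℝ)) = _
    rw [← h.eps_mul_pole r s, hv]
    have := inv_ne_zero (hv0 r s)
    simp only [hv, inv_inv] at this
    field_simp
  have hvε (r s) : v r s = epsSeq q ε₀ r * (w s)⁻¹ := by
    rw [← hvw r s, mul_inv_cancel_right₀ (hw0 s)]
  have hPv (r s) : C (epsSeq q ε₀ r, pole q a b (epsSeq q ε₀ r) 0 s,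
      (pole q a b (epsSeq q ε₀ r) 0 s)⁻¹) / (1 - (pole q a b (epsSeq q ε₀ r) 0 s ^ 2)⁻¹) =
      P (epsSeq q ε₀ r, v r s, w s) / (1 - v r s ^ 2) := by
    have := hCP _ _ (hv0 r s) (hw0 s)
    rw [hvw] at this
    rw [← this]
    simp [hv]
  have hQv (r s) : C (epsSeq q ε₀ r, (pole q a b (epsSeq q ε₀ r) 0 s)⁻¹,
      (pole q a b (epsSeq q ε₀ r) 0 s)⁻¹⁻¹) / (1 - pole q a b (epsSeq q ε₀ r) 0 s ^ 2) =
      Q (epsSeq q ε₀ r, v r s, w s) / (1 - v r s ^ 2) := by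
    have := hCQ _ _ (hv0 r s) (hw0 s)
    rw [hvw] at this
    have e : pole q a b (epsSeq q ε₀ r) 0 s = (v r s)⁻¹ := by simp [hv]
    rw [e, inv_inv, ← neg_eq_iff_eq_neg.2 this]
    have := hv0 r s
    -- At the small pole the denominator is of order `v⁻²`; this is why the second identity for `C`
    -- carries the factor `v²` and a minus sign.
    have e2 : 1 - (v r s)⁻¹ ^ 2 = -((1 - v r s ^ 2) / v r s ^ 2) := by field_simp; ring
    rw [e2, div_neg, div_div_eq_mul_div, neg_div, mul_comm]
  -- The uniform gap of the outer poles reads `|v| ≤ ρ < 1`, so `1 - v²` stays away from zero.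
  set ρ : ℝ := ‖ε₀‖ * √q with hρ
  have hρ0 : 0 < ρ := mul_pos h.norm_eps_pos h.sqrt_pos
  have hvle {r s : ℕ} (hrs : s < r) : ‖v r s‖ ≤ ρ := by
    rw [hv, norm_inv]
    exact inv_le_of_inv_le₀ hρ0 (h.norm_pole_zero_of_lt hrs)
  have hwle (s) : ‖w s‖ ≤ 1 := by
    rw [hw, norm_mul, norm_pow, norm_ofReal_of_pos h.q_pos, norm_ofReal_of_pos h.sqrt_pos]
    exact mul_le_one₀ (pow_le_one₀ h.q_pos.le h.q_lt.le) h.sqrt_pos.le h.sqrt_lt.le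
  have hbd {F : ℂ × ℂ × ℂ → ℂ} (hF : Continuous F) : ∃ M, ∀ x y z, ‖x‖ ≤ max ‖ε₀‖ 1 →
      ‖y‖ ≤ 1 → ‖z‖ ≤ 1 → ‖F (x, y, z)‖ ≤ M := by
    obtain ⟨M, hM⟩ := (isCompact_closedBall (0 : ℂ × ℂ × ℂ) (max ‖ε₀‖ 1)).exists_bound_of_continuousOn
      hF.continuousOn
    refine ⟨M, fun x y z hx hy hz => hM _ ?_⟩
    rw [mem_closedBall_zero_iff, Prod.norm_def, Prod.norm_def]
    exact max_le hx (max_le (hy.trans (le_max_right _ _)) (hz.trans (le_max_right _ _)))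
  have hεle (r) : ‖epsSeq q ε₀ r‖ ≤ max ‖ε₀‖ 1 := (h.norm_epsSeq_le r).trans (le_max_left _ _)
  have hρ2 : 0 < 1 - ρ ^ 2 := by nlinarith [h.eps_lt]
  have hden {r s : ℕ} (hrs : s < r) : 1 - ρ ^ 2 ≤ ‖1 - v r s ^ 2‖ := by
    have := norm_sub_norm_le 1 (v r s ^ 2)
    rw [norm_one, norm_pow] at this
    have := pow_le_pow_left₀ (norm_nonneg _) (hvle hrs) 2
    linarith
  have hquot {F : ℂ × ℂ × ℂ → ℂ} (hF : Continuous F) : ∃ M, ∀ r s, s < r →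
      ‖F (epsSeq q ε₀ r, v r s, w s) / (1 - v r s ^ 2)‖ ≤ M := by
    obtain ⟨M, hM⟩ := hbd hF
    refine ⟨M / (1 - ρ ^ 2), fun r s hrs => ?_⟩
    have h1 := hM (epsSeq q ε₀ r) (v r s) (w s) (hεle r)
      ((hvle hrs).trans h.eps_lt.le) (hwle s)
    rw [norm_div]
    exact div_le_div₀ ((norm_nonneg _).trans h1) h1 hρ2 (hden hrs)
  have hlim {F : ℂ × ℂ × ℂ → ℂ} (hF : Continuous F) (s : ℕ) :
      Tendsto (fun r => F (epsSeq q ε₀ r, v r s, w s) / (1 - v r s ^ 2)) atTop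
        (𝓝 (F (0, 0, w s))) := by
    have hvt : Tendsto (fun r => v r s) atTop (𝓝 0) := by
      simp only [hvε]
      simpa using h.tendsto_epsSeq.mul_const (w s)⁻¹
    have h1 : Tendsto (fun r => F (epsSeq q ε₀ r, v r s, w s)) atTop (𝓝 (F (0, 0, w s))) :=
      (hF.tendsto _).comp (h.tendsto_epsSeq.prodMk_nhds (hvt.prodMk_nhds tendsto_const_nhds))
    have h2 : Tendsto (fun r => 1 - v r s ^ 2) atTop (𝓝 (1 - 0 ^ 2)) :=
      (hvt.pow 2).const_sub 1
    have h3 := h1.div h2 (by simp)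
    rwa [zero_pow two_ne_zero, sub_zero, div_one] at h3
  refine ⟨fun r x hx => ?_, ?_, fun s => ?_, fun s => ?_⟩
  · have hi : DifferentiableAt ℂ (fun x : ℂ => x⁻¹) x := differentiableAt_inv hx
    exact (hC _).comp x (by fun_prop)
  · obtain ⟨M₁, h₁⟩ := hbd hC.continuous
    obtain ⟨M₂, h₂⟩ := hquot hP
    obtain ⟨M₃, h₃⟩ := hquot hQ
    refine ⟨max M₁ (max M₂ M₃), fun r x hx => ?_, fun r s hrs => ?_, fun r s hrs => ?_⟩
    · exact (h₁ _ _ _ (hεle r) hx.le (by rw [norm_inv, hx, inv_one])).trans (le_max_left _ _)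
    · rw [hPv]
      exact (h₂ r s hrs).trans ((le_max_left _ _).trans (le_max_right _ _))
    · rw [hQv]
      exact (h₃ r s hrs).trans ((le_max_right _ _).trans (le_max_right _ _))
  · simp only [hPv, ← hLP s]
    exact hlim hP s
  · simp only [hQv, ← hLQ s]
    exact hlim hQ s

/-- The numerators of the one-variable weights in Case I, as functions of `ε`, `x` and `1/x`; the
second one (for `true`) contains the one-variable factors of `χ₁ χ₁†` and the factor `ε²`. -/
noncomputable def numerI (q : ℝ) (b : ℂ) (c : Bool) (z : ℂ × ℂ × ℂ) : ℂ :=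
  (1 - z.1 * b * (√q : ℝ) * z.2.2) * (1 + (√q : ℝ) * z.2.2) *
    if c then (z.1 - (b * (√q : ℝ))⁻¹ * z.2.2) * (1 - z.1 * b * (√q : ℝ) * z.2.1) *
      (1 + ((√q : ℝ) : ℂ)⁻¹ * z.2.2) * (z.1 * (1 + (√q : ℝ) * z.2.1)) else 1

/-- The numerators of the one-variable weights in Case II, as functions of `ε`, `x` and `1/x`. The
first one contains the factor `ε` and the second one the factor `ε³`. -/
noncomputable def numerII (q : ℝ) (c : Bool) (z : ℂ × ℂ × ℂ) : ℂ :=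
  (z.1 - (√q : ℝ) * z.2.2) * (1 + (√q : ℝ) * z.2.2) *
    if c then (1 - z.1 * ((√q : ℝ) : ℂ)⁻¹ * z.2.2) * (z.1 - (√q : ℝ) * z.2.1) *
      (1 + ((√q : ℝ) : ℂ)⁻¹ * z.2.2) * (z.1 * (1 + (√q : ℝ) * z.2.1)) else 1

/-- At the large pole both factors tend to one. At the small pole, multiplied by `v²`, they become
`(v - ε b q^{1/2})(v + q^{1/2})`, which tends to zero. -/
lemma tameNumerator_numerI_false (h : Admissible q a b ε₀) :
    TameNumerator q a b ε₀ true (fun _ => 1)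
      fun r x => numerI q b false (epsSeq q ε₀ r, x, x⁻¹) := by
  refine TameNumerator.of_differentiable h
    (P := fun z => (1 - z.1 * b * (√q : ℝ) * z.2.1) * (1 + (√q : ℝ) * z.2.1))
    (Q := fun z => -((z.2.1 - z.1 * b * (√q : ℝ)) * (z.2.1 + (√q : ℝ)))) ?_
    (by fun_prop) (by fun_prop) ?_ ?_ ?_ ?_
  · change Differentiable ℂ fun z => numerI q b false z
    simp only [numerI, Bool.false_eq_true, if_false]
    fun_prop
  · intro v w hv hw
    simp [numerI]
  · intro v w hv hw
    simp only [numerI]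
    field_simp
    simp
  all_goals simp

/-- At the large pole the factor `ε (1 - a₃⁻¹/x)` tends to zero while the others stay bounded. At
the small pole it grows like `1/x`, which brings that residue back to order one. -/
lemma tameNumerator_numerI_true (h : Admissible q a b ε₀) :
    TameNumerator q a b ε₀ false
      (fun s => (q : ℂ) ^ s * b⁻¹ * (1 - b * (q : ℂ) ^ (s + 1)))
      fun r x => numerI q b true (epsSeq q ε₀ r, x, x⁻¹) := by
  have hκ := ofReal_sqrt_ne_zero h.q_pos
  have hκ2 := ofReal_sqrt_sq h.q_pos
  have hb := h.b_ne
  refine TameNumerator.of_differentiable h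
    (P := fun z => (1 - z.1 * b * (√q : ℝ) * z.2.1) * (1 + (√q : ℝ) * z.2.1) *
      (z.1 - (b * (√q : ℝ))⁻¹ * z.2.1) * (1 - b * (√q : ℝ) * z.2.2) * (1 + ((√q : ℝ) : ℂ)⁻¹ * z.2.1) *
      (z.1 + (√q : ℝ) * z.2.2))
    (Q := fun z => -((1 - b * (√q : ℝ) * z.2.2) * (z.1 + (√q : ℝ) * z.2.2) *
      (z.1 * z.2.1 - (b * (√q : ℝ))⁻¹) * (1 - z.1 * b * (√q : ℝ) * z.2.1) *
      (z.2.1 + ((√q : ℝ) : ℂ)⁻¹) * (1 + (√q : ℝ) * z.2.1))) ?_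
    (by fun_prop) (by fun_prop) ?_ ?_ ?_ ?_
  · change Differentiable ℂ fun z => numerI q b true z
    simp only [numerI, if_true]
    fun_prop
  · intro v w hv hw
    simp only [numerI, if_true]
    field_simp
  · intro v w hv hw
    simp only [numerI, if_true]
    field_simp
  · simp
  · intro s
    simp only [Bool.false_eq_true, if_false]
    rw [pow_succ, ← hκ2]
    field_simp
    ring

/-- Here `a₃` contains `ε⁻¹`: at the large pole `ε (1 - a₃/x) = ε - q^{1/2}/x` tends to zero, and at
the small pole the growth `q/x²` is cancelled by `1 - x⁻²`. -/
lemma tameNumerator_numerII_false (h : Admissible q a b ε₀) :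
    TameNumerator q a b ε₀ false (fun _ => (q : ℂ))
      fun r x => numerII q false (epsSeq q ε₀ r, x, x⁻¹) := by
  have hκ2 := ofReal_sqrt_sq h.q_pos
  refine TameNumerator.of_differentiable h
    (P := fun z => (z.1 - (√q : ℝ) * z.2.1) * (1 + (√q : ℝ) * z.2.1))
    (Q := fun z => -((z.1 * z.2.1 - (√q : ℝ)) * (z.2.1 + (√q : ℝ)))) ?_
    (by fun_prop) (by fun_prop) ?_ ?_ ?_ ?_
  · change Differentiable ℂ fun z => numerII q false z
    simp only [numerII, Bool.false_eq_true, if_false]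
    fun_prop
  · intro v w hv hw
    simp [numerII]
  · intro v w hv hw
    simp only [numerII]
    field_simp
    simp
  · simp
  · intro s
    simp [← hκ2, sq]

/-- At the large pole the small `ε - q^{1/2}/x` is compensated by the growing `ε - q^{1/2}x`. At the
small pole the latter tends to zero and is not compensated. -/
lemma tameNumerator_numerII_true (h : Admissible q a b ε₀) :
    TameNumerator q a b ε₀ true
      (fun s => (q : ℂ) ^ (s + 2) * (1 - (q : ℂ) ^ s))
      fun r x => numerII q true (epsSeq q ε₀ r, x, x⁻¹) := by
  have hκ := ofReal_sqrt_ne_zero h.q_pos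
  have hκ2 := ofReal_sqrt_sq h.q_pos
  refine TameNumerator.of_differentiable h
    (P := fun z => (z.1 + (√q : ℝ) * z.2.2 - (√q : ℝ) * z.2.1 - (√q : ℝ) ^ 2) *
      (1 + (√q : ℝ) * z.2.1) * (1 - z.1 * ((√q : ℝ) : ℂ)⁻¹ * z.2.1) *
      (z.1 ^ 2 - (√q : ℝ) * z.2.2) * (1 + ((√q : ℝ) : ℂ)⁻¹ * z.2.1))
    (Q := fun z => -((z.1 + (√q : ℝ) * z.2.2) * (z.2.1 + ((√q : ℝ) : ℂ)⁻¹) *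
      (1 - ((√q : ℝ) : ℂ)⁻¹ * z.2.2) * (z.1 * z.2.1 - (√q : ℝ)) * (z.1 - (√q : ℝ) * z.2.1) *
      (1 + (√q : ℝ) * z.2.1))) ?_
    (by fun_prop) (by fun_prop) ?_ ?_ ?_ ?_
  · change Differentiable ℂ fun z => numerII q true z
    simp only [numerII, if_true]
    fun_prop
  · intro v w hv hw
    simp only [numerII, if_true]
    field_simp
    ring
  · intro v w hv hw
    simp only [numerII, if_true]
    field_simp
  · intro s
    simp only [if_true]
    rw [pow_add, ← hκ2]
    ring
  · simp

end Numerators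

/-! ### Almost every parameter point is off the walls -/

section NullSets

variable {q : ℝ} {γ : ℝ → ℂ}

/-- Where the derivative does not vanish, a point of a level set is isolated in it, and a set of
isolated real points is countable. -/
lemma countable_setOf_deriv_ne_zero_and_eq (γ : ℝ → ℂ) (c : ℂ) :
    {w | deriv γ w ≠ 0 ∧ γ w = c}.Countable := by
  refine (countable_setOfPred_isolated_right_within
    (s := {w | deriv γ w ≠ 0 ∧ γ w = c})).mono ?_
  intro w hw
  refine ⟨hw, ?_⟩
  have h1 := (differentiableAt_of_deriv_ne_zero hw.1).hasDerivAt.eventually_ne (c := c) hw.1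
  rw [← empty_mem_iff_bot]
  have h2 : ∀ᶠ z in 𝓝[{w | deriv γ w ≠ 0 ∧ γ w = c} ∩ Ioi w] w, γ z ≠ c :=
    h1.filter_mono (nhdsWithin_mono _ fun z hz => (ne_of_gt hz.2 : z ≠ w))
  filter_upwards [h2, self_mem_nhdsWithin] with z hz hz'
  exact hz hz'.1.2

lemma ae_deriv_ne_zero_imp_notMem (γ : ℝ → ℂ) {K : Set ℂ} (hK : K.Countable) :
    ∀ᵐ w : ℝ, deriv γ w ≠ 0 → γ w ∉ K := by
  have h : (⋃ c ∈ K, {w | deriv γ w ≠ 0 ∧ γ w = c}).Countable :=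
    hK.biUnion fun c _ => countable_setOf_deriv_ne_zero_and_eq γ c
  filter_upwards [compl_mem_ae_iff.2 (h.measure_zero volume)] with w hw h1 h2
  exact hw (mem_iUnion₂.2 ⟨γ w, h2, h1, rfl⟩)

/-- The values `x_i^2`, `x_i x_j` and `x_i / x_j` for `i ≠ j` are not integer powers of `q`. -/
structure OffWalls {n : ℕ} (q : ℝ) (x : Fin n → ℂ) : Prop where
  sq_ne : ∀ i (m : ℤ), x i ^ 2 ≠ (q : ℂ) ^ m
  mul_ne : ∀ i j, i ≠ j → ∀ m : ℤ, x i * x j ≠ (q : ℂ) ^ m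
  mul_inv_ne : ∀ i j, i ≠ j → ∀ m : ℤ, x i * (x j)⁻¹ ≠ (q : ℂ) ^ m

instance : IsProbabilityMeasure ((volume : Measure ℝ).restrict (Icc 0 1)) :=
  ⟨by rw [Measure.restrict_apply_univ, Real.volume_Icc]; norm_num⟩

lemma IsClosedCurve.ae_prod (h : IsClosedCurve γ) (hq₀ : 0 < q) :
    ∀ᵐ p ∂((volume : Measure ℝ).restrict (Icc 0 1)).prod ((volume : Measure ℝ).restrict (Icc 0 1)),
      p.1 ∈ Icc (0 : ℝ) 1 → p.2 ∈ Icc (0 : ℝ) 1 → deriv γ p.2 ≠ 0 → ∀ m : ℤ,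
        γ p.2 * γ p.1 ≠ (q : ℂ) ^ m ∧ γ p.2 * (γ p.1)⁻¹ ≠ (q : ℂ) ^ m := by
  classical
  -- Nothing is known of `γ` outside `[0,1]`; cutting it off makes it measurable. Then Fubini
  -- applies: for a fixed first parameter the second point must hit a countable set.
  set g : ℝ → ℂ := (Icc (0 : ℝ) 1).piecewise γ 0 with hg
  have hgm : Measurable g :=
    h.continuousOn.measurable_piecewise continuousOn_const measurableSet_Icc
  have hgγ {u : ℝ} (hu : u ∈ Icc (0 : ℝ) 1) : g u = γ u := piecewise_eq_of_mem _ _ _ hu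
  have hdm : Measurable (deriv γ) := measurable_deriv γ
  set B : Set (ℝ × ℝ) := {p | deriv γ p.2 ≠ 0} ∩ ⋃ m : ℤ,
    ({p | g p.2 * g p.1 = (q : ℂ) ^ m} ∪ {p | g p.2 * (g p.1)⁻¹ = (q : ℂ) ^ m}) with hB
  have hBm : MeasurableSet B := by
    refine MeasurableSet.inter ?_ (MeasurableSet.iUnion fun m => MeasurableSet.union ?_ ?_)
    · exact (measurableSet_eq_fun (hdm.comp measurable_snd) measurable_const).compl
    · exact measurableSet_eq_fun (by fun_prop) measurable_const
    · exact measurableSet_eq_fun (by fun_prop) measurable_const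
  have hB0 : (((volume : Measure ℝ).restrict (Icc 0 1)).prod
      ((volume : Measure ℝ).restrict (Icc 0 1))) B = 0 := by
    rw [Measure.measure_prod_null hBm]
    refine Eventually.of_forall fun u => ?_
    change _ = (0 : ENNReal)
    set K : Set ℂ := ⋃ m : ℤ, ({(q : ℂ) ^ m * (g u)⁻¹} ∪ {(q : ℂ) ^ m * g u}) with hK
    have hKc : K.Countable :=
      countable_iUnion fun m => (countable_singleton _).union (countable_singleton _)
    have hae : ∀ᵐ w ∂(volume : Measure ℝ).restrict (Icc 0 1), w ∉ Prod.mk u ⁻¹' B := by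
      filter_upwards [ae_restrict_of_ae (ae_deriv_ne_zero_imp_notMem γ hKc),
        ae_restrict_mem measurableSet_Icc] with w hw hw' hwB
      refine hw hwB.1 ?_
      obtain ⟨m, hm⟩ := mem_iUnion.1 hwB.2
      refine mem_iUnion.2 ⟨m, ?_⟩
      simp only [mem_union, mem_ofPred_eq, mem_singleton_iff, hgγ hw'] at hm ⊢
      have hqm : (q : ℂ) ^ m ≠ 0 := zpow_ne_zero _ (ofReal_ne_zero_of_pos hq₀)
      have hu0 : g u ≠ 0 := by
        rintro hu0
        rw [hu0, inv_zero, mul_zero, or_self] at hm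
        exact hqm hm.symm
      rcases hm with hm | hm
      · left
        rw [← hm, mul_inv_cancel_right₀ hu0]
      · right
        rw [← hm, inv_mul_cancel_right₀ hu0]
    exact measure_eq_zero_iff_ae_notMem.2 hae
  filter_upwards [compl_mem_ae_iff.2 hB0] with p hp h1 h2 hd m
  refine ⟨fun e => hp ⟨hd, mem_iUnion.2 ⟨m, Or.inl ?_⟩⟩,
    fun e => hp ⟨hd, mem_iUnion.2 ⟨m, Or.inr ?_⟩⟩⟩
  · rw [mem_ofPred_eq, hgγ h1, hgγ h2, e]
  · rw [mem_ofPred_eq, hgγ h1, hgγ h2, e]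

open ProbabilityTheory in
/-- Almost every point of the cube at which no derivative vanishes is mapped off the walls. -/
theorem IsClosedCurve.ae_offWalls (h : IsClosedCurve γ) (hq₀ : 0 < q) (n : ℕ) :
    ∀ᵐ u ∂(volume : Measure (Fin n → ℝ)).restrict (Icc 0 1),
      (∀ i, deriv γ (u i) ≠ 0) → OffWalls q fun i => γ (u i) := by
  rw [volume_restrict_Icc_pi]
  set μ := (volume : Measure ℝ).restrict (Icc 0 1) with hμ
  have hmp (i : Fin n) : MeasurePreserving (Function.eval i) (Measure.pi fun _ : Fin n => μ) μ :=
    measurePreserving_eval (fun _ : Fin n => μ) i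
  have hsq : ∀ᵐ u ∂Measure.pi fun _ : Fin n => μ, ∀ i, deriv γ (u i) ≠ 0 →
      ∀ m : ℤ, γ (u i) ^ 2 ≠ (q : ℂ) ^ m := by
    refine ae_all_iff.2 fun i => ?_
    have hK : (⋃ m : ℤ, {x : ℂ | x ^ 2 = (q : ℂ) ^ m}).Countable := by
      refine countable_iUnion fun m => ?_
      have : {x : ℂ | x ^ 2 = (q : ℂ) ^ m} ⊆
          ((Polynomial.nthRoots 2 ((q : ℂ) ^ m)).toFinset : Set ℂ) := by
        intro x hx
        simpa [Polynomial.mem_nthRoots] using hx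
      exact (Finset.countable_toSet _).mono this
    filter_upwards [(hmp i).quasiMeasurePreserving.ae
      (ae_restrict_of_ae (ae_deriv_ne_zero_imp_notMem γ hK))] with u hu hd m hm
    exact hu hd (mem_iUnion.2 ⟨m, hm⟩)
  have hpair : ∀ᵐ u ∂Measure.pi fun _ : Fin n => μ, ∀ i j, i ≠ j → deriv γ (u i) ≠ 0 →
      ∀ m : ℤ, γ (u i) * γ (u j) ≠ (q : ℂ) ^ m ∧ γ (u i) * (γ (u j))⁻¹ ≠ (q : ℂ) ^ m := by
    refine ae_all_iff.2 fun i => ae_all_iff.2 fun j => ?_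
    by_cases hij : i = j
    · exact Eventually.of_forall fun u hne => absurd hij hne
    -- Independence of two distinct coordinates identifies their joint law with `μ.prod μ`, so the
    -- statement on the square transfers to the cube.
    have hind : IndepFun (fun u : Fin n → ℝ => u j) (fun u => u i) (Measure.pi fun _ => μ) :=
      (iIndepFun_pi (μ := fun _ : Fin n => μ) (X := fun _ x => x)
        fun _ => aemeasurable_id).indepFun (Ne.symm hij)
    have hmap := (indepFun_iff_map_prod_eq_prod_map_map (measurable_pi_apply j).aemeasurable
      (measurable_pi_apply i).aemeasurable).1 hind
    have e (l : Fin n) : Measure.map (fun u : Fin n → ℝ => u l) (Measure.pi fun _ => μ) = μ :=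
      (hmp l).map_eq
    rw [e, e] at hmap
    have hqm : MeasurePreserving (fun u : Fin n → ℝ => (u j, u i))
        (Measure.pi fun _ => μ) (μ.prod μ) := ⟨by fun_prop, hmap⟩
    filter_upwards [hqm.quasiMeasurePreserving.ae (h.ae_prod hq₀),
      (hmp i).quasiMeasurePreserving.ae (ae_restrict_mem measurableSet_Icc),
      (hmp j).quasiMeasurePreserving.ae (ae_restrict_mem measurableSet_Icc)] with u h1 h2 h3 _ hd
    exact h1 h3 h2 hd
  filter_upwards [hsq, hpair] with u h1 h2 hd
  exact ⟨fun i => h1 i (hd i), fun i j hij m => (h2 i j hij (hd i) m).1,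
    fun i j hij m => (h2 i j hij (hd i) m).2⟩

end NullSets

/-! ### Products over pairs of indices -/

section PairProducts

lemma map_natAddEmb_univ (n₀ n₁ : ℕ) :
    Finset.univ.map (Fin.natAddEmb n₀) = lastIdx n₀ n₁ := by
  ext i
  simp only [lastIdx, Finset.mem_map, Finset.mem_univ, true_and, Finset.mem_filter]
  refine ⟨fun ⟨j, hj⟩ => by simp [← hj], fun h => ⟨⟨i - n₀, by omega⟩, Fin.ext ?_⟩⟩
  simp only [Fin.natAddEmb_apply, Fin.val_natAdd]
  omega

lemma map_natAddEmb_Ioi (n₀ : ℕ) {n₁ : ℕ} (i : Fin n₁) :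
    (Finset.Ioi i).map (Fin.natAddEmb n₀) = Finset.Ioi (Fin.natAdd n₀ i) := by
  ext j
  simp only [Finset.mem_map, Finset.mem_Ioi]
  refine ⟨fun ⟨l, hl, e⟩ => by simpa [← e] using hl, fun h => ?_⟩
  have h' : n₀ + (i : ℕ) < j := h
  refine ⟨⟨j - n₀, by omega⟩, ?_, Fin.ext ?_⟩
  · rw [Fin.lt_def]
    simp only
    omega
  · simp only [Fin.natAddEmb_apply, Fin.val_natAdd]
    omega

variable {M : Type*} [CommMonoid M]

lemma prod_lastIdx (n₀ n₁ : ℕ) (f : Fin (n₀ + n₁) → M) :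
    ∏ i ∈ lastIdx n₀ n₁, f i = ∏ i : Fin n₁, f (Fin.natAdd n₀ i) := by
  rw [← map_natAddEmb_univ, Finset.prod_map]
  rfl

lemma prod_lastIdx_Ioi (n₀ n₁ : ℕ) (f : Fin (n₀ + n₁) → Fin (n₀ + n₁) → M) :
    ∏ i ∈ lastIdx n₀ n₁, ∏ j ∈ Finset.Ioi i, f i j =
      ∏ i : Fin n₁, ∏ j ∈ Finset.Ioi i, f (Fin.natAdd n₀ i) (Fin.natAdd n₀ j) := by
  rw [prod_lastIdx]
  refine Finset.prod_congr rfl fun i _ => ?_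
  rw [← map_natAddEmb_Ioi, Finset.prod_map]
  rfl

lemma prod_ite_lastIdx (n₀ n₁ : ℕ) (f : Fin (n₀ + n₁) → M) :
    ∏ i : Fin (n₀ + n₁), (if n₀ ≤ (i : ℕ) then f i else 1) = ∏ i ∈ lastIdx n₀ n₁, f i := by
  rw [lastIdx, Finset.prod_filter]

/-- Every index belongs to `n - 1` pairs. -/
lemma prod_Ioi_mul (n : ℕ) (g : Fin n → M) :
    ∏ i, ∏ j ∈ Finset.Ioi i, g i * g j = ∏ i, g i ^ (n - 1) := by
  rw [Finset.prod_prod_Ioi_mul_eq_prod_prod_off_diag fun (_ i : Fin n) => g i]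
  simp [Finset.card_compl]

lemma prod_Ioi_const (n : ℕ) (c : M) : ∏ i : Fin n, ∏ _j ∈ Finset.Ioi i, c = c ^ n.choose 2 := by
  simp only [Finset.prod_const, Fin.card_Ioi, Finset.prod_pow_eq_pow_sum]
  rw [Fin.sum_univ_eq_sum_range fun i => n - 1 - i, Finset.sum_range_reflect fun i => i,
    Finset.sum_range_id, Nat.choose_two_right]

lemma prod_Ioi_sq (n : ℕ) (c : M) :
    ∏ i : Fin n, ∏ _j ∈ Finset.Ioi i, c ^ 2 = c ^ (n * (n - 1)) := by
  simp only [sq]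
  rw [prod_Ioi_mul n fun _ => c, Finset.prod_const, Finset.card_univ, Fintype.card_fin, ← pow_mul,
    mul_comm]

end PairProducts

/-! ### Factorization of the integrand -/

section Integrand

variable {q t : ℝ} {a b ε : ℂ}

/-- The product `(1 - c₁ x y) (1 - c₂ / (x y)) (1 - c₃ x / y) (1 - c₄ y / x)`. -/
noncomputable def quad (c : Fin 4 → ℂ) (x y : ℂ) : ℂ :=
  (1 - c 0 * (x * y)) * (1 - c 1 * (x⁻¹ * y⁻¹)) * ((1 - c 2 * (x * y⁻¹)) * (1 - c 3 * (x⁻¹ * y)))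

/-- The product `ε² quad c x y` as a polynomial in `v = ε x`, `v' = ε y`, `w = ε / x` and
`w' = ε / y`. -/
def quadForm {R : Type*} [CommRing R] (c : Fin 4 → R) (v w v' w' : R) : R :=
  (1 + c 0 * c 1) * (1 + c 2 * c 3) * (v * w) - (1 + c 0 * c 1) * (c 2 * (v * w') + c 3 * (w * v')) -
    (1 + c 2 * c 3) * (c 0 * (v * v') + c 1 * (w * w')) + c 0 * c 2 * v ^ 2 + c 0 * c 3 * v' ^ 2 +
    c 1 * c 2 * w' ^ 2 + c 1 * c 3 * w ^ 2

/-- Every monomial of `quad` is a product of exactly two of `x`, `x⁻¹`, `y`, `y⁻¹`, the constant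
being read as `x · x⁻¹`. So each takes up the factor `ε²` exactly, and no power of `ε` is left over.
-/
lemma quadForm_eq (c : Fin 4 → ℂ) (ε : ℂ) {x y : ℂ} (hx : x ≠ 0) (hy : y ≠ 0) :
    quadForm c (ε * x) (ε * x⁻¹) (ε * y) (ε * y⁻¹) = ε ^ 2 * quad c x y := by
  rw [quadForm, quad]
  field_simp
  ring

/-- The polynomial whose value at `scaledVars ε x` is `ε² quad c x_i x_j`. -/
noncomputable def quadPoly {n : ℕ} (c : Fin 4 → ℂ) (i j : Fin n) : MvPolynomial (Fin n × Bool) ℂ :=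
  quadForm (fun l => MvPolynomial.C (c l)) (MvPolynomial.X (i, true)) (MvPolynomial.X (i, false))
    (MvPolynomial.X (j, true)) (MvPolynomial.X (j, false))

lemma eval_quadPoly {n : ℕ} (c : Fin 4 → ℂ) (i j : Fin n) (f : Fin n × Bool → ℂ) :
    MvPolynomial.eval f (quadPoly c i j) =
      quadForm c (f (i, true)) (f (i, false)) (f (j, true)) (f (j, false)) := by
  simp [quadPoly, quadForm]

/-- The coefficients of the `l`-th factor of the interaction in the weight. -/
noncomputable def weightCoeff (q : ℝ) (l : ℕ) : Fin 4 → ℂ :=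
  ![(q : ℂ) ^ l, (q : ℂ) ^ (l + 1), (q : ℂ) ^ l, (q : ℂ) ^ (l + 1)]

/-- The coefficients of the interaction in `χ₁ χ₁†`. -/
noncomputable def chiCoeff (t : ℝ) : Fin 4 → ℂ :=
  ![(t : ℂ) ^ 2, ((t : ℂ) ^ 2)⁻¹, (t : ℂ) ^ 2, ((t : ℂ) ^ 2)⁻¹]

/-- The polynomial that represents all the interactions between the variables. -/
noncomputable def interactionPoly (n₀ n₁ : ℕ) (q t : ℝ) (k : ℕ) :
    MvPolynomial (Fin (n₀ + n₁) × Bool) ℂ :=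
  (∏ i, ∏ j ∈ Finset.Ioi i, ∏ l ∈ Finset.range k, quadPoly (weightCoeff q l) i j) *
    ∏ i ∈ lastIdx n₀ n₁, ∏ j ∈ Finset.Ioi i, quadPoly (chiCoeff t) i j

/-- Two powers of `ε` for each quadruple of factors: `k` quadruples for every pair of indices and
one more for every pair among the last `n₁`. -/
lemma eval_interactionPoly (n₀ n₁ : ℕ) (q t : ℝ) (k : ℕ) {x : Fin (n₀ + n₁) → ℂ}
    (hx : ∀ i, x i ≠ 0) :
    MvPolynomial.eval (scaledVars ε x) (interactionPoly n₀ n₁ q t k) =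
      ε ^ ((n₀ + n₁) * (n₀ + n₁ - 1) * k + n₁ * (n₁ - 1)) *
        ((∏ i, ∏ j ∈ Finset.Ioi i, ∏ l ∈ Finset.range k, quad (weightCoeff q l) (x i) (x j)) *
          ∏ i ∈ lastIdx n₀ n₁, ∏ j ∈ Finset.Ioi i, quad (chiCoeff t) (x i) (x j)) := by
  have e (c : Fin 4 → ℂ) (i j : Fin (n₀ + n₁)) :
      MvPolynomial.eval (scaledVars ε x) (quadPoly c i j) = ε ^ 2 * quad c (x i) (x j) := by
    rw [eval_quadPoly, ← quadForm_eq c ε (hx i) (hx j)]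
    rfl
  simp only [interactionPoly, map_mul, map_prod, e, Finset.prod_mul_distrib, Finset.prod_const,
    Finset.card_range, pow_add]
  have e1 : ∏ i ∈ lastIdx n₀ n₁, (ε ^ 2) ^ (Finset.Ioi i).card = ε ^ (n₁ * (n₁ - 1)) := by
    have := prod_lastIdx_Ioi n₀ n₁ fun _ _ => ε ^ 2
    rw [prod_Ioi_sq] at this
    simpa only [Finset.prod_const] using this
  have e2 : ∏ i : Fin (n₀ + n₁), ((ε ^ 2) ^ k) ^ (Finset.Ioi i).card =
      ε ^ ((n₀ + n₁) * (n₀ + n₁ - 1) * k) := by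
    have := prod_Ioi_sq (n₀ + n₁) (ε ^ k)
    simp only [Finset.prod_const, pow_right_comm ε k 2] at this
    rw [this, ← pow_mul, mul_comm k]
  rw [e1, e2]
  ring

/-- Both sides are `(z)_{k+1}`, split at the last or at the first factor. -/
lemma qFin_mul_one_sub (q : ℝ) (z : ℂ) (k : ℕ) :
    qFin q z k * (1 - z * (q : ℂ) ^ k) = (1 - z) * qFin q (q * z) k := by
  have h : qFin q z (k + 1) = (1 - z) * qFin q (q * z) k := by
    rw [qFin, qFin, Finset.prod_range_succ', mul_comm]
    congr 1
    · simp
    · refine Finset.prod_congr rfl fun i _ => ?_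
      ring
  rw [← h, qFin, qFin, Finset.prod_range_succ]

/-- The interaction between two variables in the weight, off the walls. -/
lemma weight_pair_eq (hq₀ : 0 < q) (hq₁ : q < 1) {k : ℕ} (ht : t ^ 2 = q ^ k) {x y : ℂ}
    (hx : x ≠ 0) (hy : y ≠ 0) (hX : ∀ m : ℤ, x * y ≠ (q : ℂ) ^ m)
    (hY : ∀ m : ℤ, x * y⁻¹ ≠ (q : ℂ) ^ m) :
    ((x * y - (t : ℂ) ^ 2) * (x * y⁻¹ - (t : ℂ) ^ 2)) / ((x * y - 1) * (x * y⁻¹ - 1)) *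
      ((qInf q (x * y) * qInf q (x * y⁻¹) * qInf q (x⁻¹ * y) * qInf q (x⁻¹ * y⁻¹)) /
        (qInf q ((t : ℂ) ^ 2 * (x * y)) * qInf q ((t : ℂ) ^ 2 * (x * y⁻¹)) *
          qInf q ((t : ℂ) ^ 2 * (x⁻¹ * y)) * qInf q ((t : ℂ) ^ 2 * (x⁻¹ * y⁻¹)))) =
      ∏ l ∈ Finset.range k, quad (weightCoeff q l) x y := by
  have hq := ofReal_ne_zero_of_pos hq₀
  have ht' : (t : ℂ) ^ 2 = (q : ℂ) ^ k := by exact_mod_cast ht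
  -- For `z = x y^{±1}` the infinite products leave `(z)_k (1/z)_k`, and the factor `(z - q^k)/(z -
  -- 1)` of `𝒞` turns `(1/z)_k` into `(q/z)_k`.
  have key {z : ℂ} (hz : z ≠ 0) (hzq : ∀ m : ℤ, z ≠ (q : ℂ) ^ m) :
      (z - (t : ℂ) ^ 2) / (z - 1) *
        (qInf q z * qInf q z⁻¹ / (qInf q ((t : ℂ) ^ 2 * z) * qInf q ((t : ℂ) ^ 2 * z⁻¹))) =
      qFin q z k * qFin q (q * z⁻¹) k := by
    have h1 : qInf q (z * (q : ℂ) ^ k) ≠ 0 := by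
      refine qInf_ne_zero hq₀ hq₁ fun i hi => hzq (-((k + i : ℕ) : ℤ)) ?_
      rw [zpow_neg, zpow_natCast, pow_add]
      exact eq_inv_of_mul_eq_one_left (by rw [← hi]; ring)
    have h2 : qInf q (z⁻¹ * (q : ℂ) ^ k) ≠ 0 := by
      refine qInf_ne_zero hq₀ hq₁ fun i hi => hzq ((k + i : ℕ) : ℤ) ?_
      rw [zpow_natCast, pow_add]
      field_simp at hi
      exact hi.symm
    have h3 : z - 1 ≠ 0 := sub_ne_zero.2 (by simpa using hzq 0)
    have h4 := qFin_mul_one_sub q z⁻¹ k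
    rw [qInf_eq_qFin_mul hq₀ hq₁ z k, qInf_eq_qFin_mul hq₀ hq₁ z⁻¹ k, ht', mul_comm _ z,
      mul_comm _ z⁻¹]
    have h6 : (z - (q : ℂ) ^ k) / (z - 1) * qFin q z⁻¹ k = qFin q (q * z⁻¹) k := by
      rw [div_mul_eq_mul_div, div_eq_iff h3]
      field_simp at h4 ⊢
      linear_combination h4
    rw [← h6]
    generalize qInf q (z * (q : ℂ) ^ k) = A at *
    generalize qInf q (z⁻¹ * (q : ℂ) ^ k) = B at *
    field_simp
  have hX' := key (mul_ne_zero hx hy) hX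
  have hY' := key (mul_ne_zero hx (inv_ne_zero hy)) hY
  rw [mul_inv] at hX'
  rw [mul_inv, inv_inv] at hY'
  have e : ∏ l ∈ Finset.range k, quad (weightCoeff q l) x y =
      (qFin q (x * y) k * qFin q (q * (x⁻¹ * y⁻¹)) k) *
        (qFin q (x * y⁻¹) k * qFin q (q * (x⁻¹ * y)) k) := by
    simp only [qFin, ← Finset.prod_mul_distrib]
    refine Finset.prod_congr rfl fun l _ => ?_
    simp only [quad, weightCoeff, Matrix.cons_val]
    ring
  rw [e, ← hX', ← hY', div_mul_div_comm, div_mul_div_comm, div_mul_div_comm, div_mul_div_comm]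
  congr 1 <;> ring

/-- The one-variable part of the weight, off the walls. -/
lemma weight_one_eq (hq₀ : 0 < q) (hq₁ : q < 1) {p : Fin 4 → ℂ}
    (hp : ∀ x, ∏ r, (qInf q (p r * x) * qInf q (p r * x⁻¹)) = poleDenom q a b ε x *
      (qInf q (-((√q : ℝ) * x)) * qInf q (-((√q : ℝ) * x⁻¹)))) {x : ℂ} (hx : x ≠ 0)
    (hsq : ∀ m : ℤ, x ^ 2 ≠ (q : ℂ) ^ m) :
    ((x - p 2) * (x - p 3)) / (x ^ 2 - 1) *
      ((qInf q (x ^ 2) * qInf q (x⁻¹ ^ 2)) / ∏ r, (qInf q (p r * x) * qInf q (p r * x⁻¹))) =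
      coreNumer q x * ((1 - p 2 * x⁻¹) * (1 - p 3 * x⁻¹)) / poleDenom q a b ε x := by
  have hκ2 := ofReal_sqrt_sq hq₀
  have hne {y : ℂ} (hy : ∀ m : ℤ, y ^ 2 ≠ (q : ℂ) ^ m) : qInf q (-((√q : ℝ) * y)) ≠ 0 := by
    refine qInf_ne_zero hq₀ hq₁ fun i hi => hy (-((2 * i + 1 : ℕ) : ℤ)) ?_
    rw [zpow_neg, zpow_natCast]
    refine eq_inv_of_mul_eq_one_left ?_
    have := congrArg (· ^ 2) hi
    simp only [one_pow] at this
    rw [← this, pow_succ, ← hκ2]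
    ring
  have h1 := hne hsq
  have h2 : qInf q (-((√q : ℝ) * x⁻¹)) ≠ 0 := by
    refine hne fun m hm => hsq (-m) ?_
    rw [zpow_neg, ← hm, inv_pow, inv_inv]
  have h3 : x ^ 2 - 1 ≠ 0 := sub_ne_zero.2 (by simpa using hsq 0)
  -- By duplication, `(x², x⁻²)_∞` contains the denominator factor of the parameter `-q^{1/2}`, and
  -- these cancel. The denominator `x² - 1` of `𝒞` then removes `1 - x⁻²` from `symNumer`.
  have h4 : qInf q (x ^ 2) * qInf q (x⁻¹ ^ 2) = symNumer q x *
      (qInf q (-((√q : ℝ) * x)) * qInf q (-((√q : ℝ) * x⁻¹))) := by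
    rw [qInf_sq hq₀ hq₁ x, qInf_sq hq₀ hq₁ x⁻¹, symNumer]
    ring
  rw [hp, h4, mul_div_mul_right _ _ (mul_ne_zero h1 h2), symNumer_eq hq₀ hq₁]
  rw [← mul_div_assoc]
  congr 1
  field_simp

/-- The monomials of `χ₁` and `χ₁†` are inverse to each other, and the two factors of each pair
combine with their images under `†` to one `quad`. -/
lemma chi_mul_chiDagger (n₀ n₁ : ℕ) {p : Fin 4 → ℂ} {x : Fin (n₀ + n₁) → ℂ} (hx : ∀ i, x i ≠ 0) :
    chi n₀ n₁ t p x * chiDagger n₀ n₁ t p x =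
      (∏ i ∈ lastIdx n₀ n₁, ((1 - (p 2)⁻¹ * (x i)⁻¹) * (1 - (p 3)⁻¹ * (x i)⁻¹)) *
        ((1 - p 2 * x i) * (1 - p 3 * x i))) *
      ∏ i ∈ lastIdx n₀ n₁, ∏ j ∈ Finset.Ioi i, quad (chiCoeff t) (x i) (x j) := by
  have h1 : (∏ i ∈ lastIdx n₀ n₁, x i ^ (n₀ + n₁ - (i : ℕ))) *
      ∏ i ∈ lastIdx n₀ n₁, (x i)⁻¹ ^ (n₀ + n₁ - (i : ℕ)) = 1 := by
    rw [← Finset.prod_mul_distrib]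
    refine Finset.prod_eq_one fun i _ => ?_
    rw [← mul_pow, mul_inv_cancel₀ (hx i), one_pow]
  have h2 : (∏ i ∈ lastIdx n₀ n₁, ∏ j ∈ Finset.Ioi i,
      (1 - ((t : ℂ) ^ 2)⁻¹ * ((x i)⁻¹ * x j)) * (1 - ((t : ℂ) ^ 2)⁻¹ * ((x i)⁻¹ * (x j)⁻¹))) *
      (∏ i ∈ lastIdx n₀ n₁, ∏ j ∈ Finset.Ioi i,
      (1 - (((t⁻¹ : ℝ) : ℂ) ^ 2)⁻¹ * ((x i)⁻¹⁻¹ * (x j)⁻¹)) *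
        (1 - (((t⁻¹ : ℝ) : ℂ) ^ 2)⁻¹ * ((x i)⁻¹⁻¹ * (x j)⁻¹⁻¹))) =
      ∏ i ∈ lastIdx n₀ n₁, ∏ j ∈ Finset.Ioi i, quad (chiCoeff t) (x i) (x j) := by
    simp only [← Finset.prod_mul_distrib]
    refine Finset.prod_congr rfl fun i _ => Finset.prod_congr rfl fun j _ => ?_
    simp only [quad, chiCoeff, Matrix.cons_val, Complex.ofReal_inv, inv_pow, inv_inv]
    ring
  have h3 : ∏ i ∈ lastIdx n₀ n₁, ((1 - (p 2)⁻¹ * (x i)⁻¹) * (1 - (p 3)⁻¹ * (x i)⁻¹)) *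
      ((1 - p 2 * x i) * (1 - p 3 * x i)) =
      (∏ i ∈ lastIdx n₀ n₁, (1 - (p 2)⁻¹ * (x i)⁻¹) * (1 - (p 3)⁻¹ * (x i)⁻¹)) *
        ∏ i ∈ lastIdx n₀ n₁, (1 - p 2 * x i) * (1 - p 3 * x i) := Finset.prod_mul_distrib
  rw [chiDagger, chi, chi, ← h2, h3]
  simp only [inv_inv] at h1 ⊢
  linear_combination (∏ i ∈ lastIdx n₀ n₁, (1 - (p 2)⁻¹ * (x i)⁻¹) * (1 - (p 3)⁻¹ * (x i)⁻¹)) *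
    (∏ i ∈ lastIdx n₀ n₁, ∏ j ∈ Finset.Ioi i,
      (1 - ((t : ℂ) ^ 2)⁻¹ * ((x i)⁻¹ * x j)) * (1 - ((t : ℂ) ^ 2)⁻¹ * ((x i)⁻¹ * (x j)⁻¹))) *
    (∏ i ∈ lastIdx n₀ n₁, (1 - p 2 * x i) * (1 - p 3 * x i)) *
      (∏ i ∈ lastIdx n₀ n₁, ∏ j ∈ Finset.Ioi i,
      (1 - (((t⁻¹ : ℝ) : ℂ) ^ 2)⁻¹ * (x i * (x j)⁻¹)) *
        (1 - (((t⁻¹ : ℝ) : ℂ) ^ 2)⁻¹ * (x i * x j))) * h1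

/-- The scaled integrand, off the walls, in terms of one-variable weights and a polynomial. -/
theorem pow_mul_integrand_eq (hq₀ : 0 < q) (hq₁ : q < 1) {k : ℕ} (ht : t ^ 2 = q ^ k)
    (n₀ n₁ : ℕ) {p : Fin 4 → ℂ}
    (hp : ∀ x, ∏ r, (qInf q (p r * x) * qInf q (p r * x⁻¹)) = poleDenom q a b ε x *
      (qInf q (-((√q : ℝ) * x)) * qInf q (-((√q : ℝ) * x⁻¹))))
    {N : Fin (n₀ + n₁) → ℂ → ℂ} {E : Fin (n₀ + n₁) → ℕ}
    (hN : ∀ i, ∀ x ≠ 0, N i x = ε ^ E i * (((1 - p 2 * x⁻¹) * (1 - p 3 * x⁻¹)) *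
      if n₀ ≤ (i : ℕ) then ((1 - (p 2)⁻¹ * x⁻¹) * (1 - (p 3)⁻¹ * x⁻¹)) *
        ((1 - p 2 * x) * (1 - p 3 * x)) else 1))
    {x : Fin (n₀ + n₁) → ℂ} (hx : ∀ i, x i ≠ 0) (hw : OffWalls q x) :
    ε ^ ((n₀ + n₁) * (n₀ + n₁ - 1) * k + n₁ * (n₁ - 1) + ∑ i, E i) * integrand n₀ n₁ q t p x =
      (∏ i, oneVarIntegrand q a b ε (N i) (x i)) *
        MvPolynomial.eval (scaledVars ε x) (interactionPoly n₀ n₁ q t k) := by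
  have hpair := Finset.prod_congr (s₁ := Finset.univ) rfl fun i _ =>
    Finset.prod_congr (s₁ := Finset.Ioi i) rfl fun j hj =>
      weight_pair_eq hq₀ hq₁ ht (hx i) (hx j) (hw.mul_ne i j (Finset.mem_Ioi.1 hj).ne)
        (hw.mul_inv_ne i j (Finset.mem_Ioi.1 hj).ne)
  have hone := Finset.prod_congr (s₁ := Finset.univ) rfl fun i _ =>
    weight_one_eq hq₀ hq₁ hp (hx i) (hw.sq_ne i)
  have hdelta : delta q t p x = (∏ i, ∏ j ∈ Finset.Ioi i, ∏ l ∈ Finset.range k,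
      quad (weightCoeff q l) (x i) (x j)) * ∏ i, coreNumer q (x i) *
        ((1 - p 2 * (x i)⁻¹) * (1 - p 3 * (x i)⁻¹)) / poleDenom q a b ε (x i) := by
    rw [← hpair, ← hone]
    simp only [Finset.prod_mul_distrib (f := fun i => _ / _)]
    simp only [delta, cFun, deltaPlus, Finset.prod_mul_distrib]
    ring
  have hov : ∏ i, oneVarIntegrand q a b ε (N i) (x i) = ε ^ (∑ i, E i) *
      (∏ i, coreNumer q (x i) * ((1 - p 2 * (x i)⁻¹) * (1 - p 3 * (x i)⁻¹)) /
        poleDenom q a b ε (x i)) *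
      (∏ i ∈ lastIdx n₀ n₁, ((1 - (p 2)⁻¹ * (x i)⁻¹) * (1 - (p 3)⁻¹ * (x i)⁻¹)) *
        ((1 - p 2 * x i) * (1 - p 3 * x i))) * ∏ i, (x i)⁻¹ := by
    rw [← prod_ite_lastIdx, ← Finset.prod_pow_eq_pow_sum, ← Finset.prod_mul_distrib,
      ← Finset.prod_mul_distrib, ← Finset.prod_mul_distrib]
    refine Finset.prod_congr rfl fun i _ => ?_
    rw [oneVarIntegrand, hN i _ (hx i)]
    ring
  rw [integrand, chi_mul_chiDagger n₀ n₁ hx, hdelta, hov, eval_interactionPoly n₀ n₁ q t k hx,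
    pow_add ε (_ + _)]
  ring

end Integrand

/-! ### Values at the limit points and the summands -/

section Terms

variable {q t : ℝ} {a b ε₀ : ℂ}

/-- For coefficients of the pattern `x, y, x, y` the form is invariant under inversion of the second
variable, so the value does not depend on `σ'`. -/
lemma quadForm_limit (x y u u' : ℂ) (σ σ' : Bool) :
    quadForm ![x, y, x, y] (if true = σ then u else 0) (if false = σ then u else 0)
      (if true = σ' then u' else 0) (if false = σ' then u' else 0) =
      if σ then -(x * (u' - x * u) * (u - y * u')) else -(y * (u - x * u') * (u' - y * u)) := by
  cases σ <;> cases σ' <;> simp [quadForm] <;> ring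

lemma prod_pow_succ (x : ℂ) (k : ℕ) :
    ∏ l ∈ Finset.range k, x ^ (l + 1) = x ^ (k * (k + 1) / 2) := by
  have h := Finset.sum_range_id (k + 1)
  rw [Finset.sum_range_succ', add_zero, Nat.add_sub_cancel, mul_comm] at h
  rw [Finset.prod_pow_eq_pow_sum, h]

lemma prod_weightCoeff_true (hq₀ : 0 < q) (k : ℕ) {w w' : ℂ} (hw : w ≠ 0) (hw' : w' ≠ 0) :
    ∏ l ∈ Finset.range k, -((q : ℂ) ^ l * (w' * (√q : ℝ) - (q : ℂ) ^ l * (w * (√q : ℝ))) *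
      (w * (√q : ℝ) - (q : ℂ) ^ (l + 1) * (w' * (√q : ℝ)))) =
      (-1) ^ k * (q : ℂ) ^ (k * (k + 1) / 2) * (w ^ k * w' ^ k) *
        (qFin q (w / w') k * qFin q (w' / w * q) k) := by
  rw [← prod_pow_succ, ← mul_pow, mul_right_comm _ _ ((w * w') ^ k), ← mul_pow, qFin, qFin,
    ← Finset.prod_mul_distrib, Finset.pow_eq_prod_const, ← Finset.prod_mul_distrib,
    ← Finset.prod_mul_distrib]
  refine Finset.prod_congr rfl fun l _ => ?_
  rw [pow_succ, ← ofReal_sqrt_sq hq₀]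
  field_simp

lemma prod_weightCoeff_false (hq₀ : 0 < q) (k : ℕ) {w w' : ℂ} (hw : w ≠ 0) (hw' : w' ≠ 0) :
    ∏ l ∈ Finset.range k, -((q : ℂ) ^ (l + 1) * (w * (√q : ℝ) - (q : ℂ) ^ l * (w' * (√q : ℝ))) *
      (w' * (√q : ℝ) - (q : ℂ) ^ (l + 1) * (w * (√q : ℝ)))) =
      (-1) ^ k * (q : ℂ) ^ (k * (k + 1) / 2) * (w ^ k * w' ^ k) *
        ((q : ℂ) ^ k * (qFin q (w / w' * q) k * qFin q (w' / w) k)) := by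
  rw [← prod_pow_succ, ← mul_pow, mul_right_comm _ _ ((w * w') ^ k), ← mul_pow, qFin, qFin,
    ← Finset.prod_mul_distrib, Finset.pow_eq_prod_const, Finset.pow_eq_prod_const (q : ℂ),
    ← Finset.prod_mul_distrib, ← Finset.prod_mul_distrib, ← Finset.prod_mul_distrib]
  refine Finset.prod_congr rfl fun l _ => ?_
  rw [pow_succ, ← ofReal_sqrt_sq hq₀]
  field_simp

/-- Both sides are equal to `(w - w') (q w / w')_k (q w' / w)_k`. -/
lemma sub_mul_qFin_mul_qFin (q : ℝ) (k : ℕ) {w w' : ℂ} (hw : w ≠ 0) (hw' : w' ≠ 0) :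
    (w - (q : ℂ) ^ k * w') * (qFin q (w / w' * q) k * qFin q (w' / w) k) =
      ((q : ℂ) ^ k * w - w') * (qFin q (w / w') k * qFin q (w' / w * q) k) := by
  have h1 := qFin_mul_one_sub q (w / w') k
  have h2 := qFin_mul_one_sub q (w' / w) k
  rw [mul_comm (q : ℂ)] at h1 h2
  generalize qFin q (w / w' * q) k = A at *
  generalize qFin q (w' / w * q) k = B at *
  generalize qFin q (w / w') k = C at *
  generalize qFin q (w' / w) k = D at *
  field_simp at h1 h2
  linear_combination A * h2 + B * h1

lemma prod_mul_prod_lastIdx {M : Type*} [CommMonoid M] (n₀ n₁ : ℕ)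
    (f g : Fin (n₀ + n₁) → Fin (n₀ + n₁) → M) :
    (∏ i, ∏ j ∈ Finset.Ioi i, f i j) * ∏ i ∈ lastIdx n₀ n₁, ∏ j ∈ Finset.Ioi i, g i j =
      ∏ i, ∏ j ∈ Finset.Ioi i, f i j * if n₀ ≤ (i : ℕ) then g i j else 1 := by
  rw [← prod_ite_lastIdx, ← Finset.prod_mul_distrib]
  refine Finset.prod_congr rfl fun i _ => ?_
  split_ifs <;> simp [Finset.prod_mul_distrib]

lemma sq_pow_choose_two (c : ℂ) (n : ℕ) : (c ^ 2) ^ n.choose 2 = c ^ (n * (n - 1)) := by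
  rw [← prod_Ioi_const, prod_Ioi_sq]

lemma eval_quadPoly_limitVars {n : ℕ} (q : ℝ) (x y : ℂ) (σ : Fin n → Bool) (s : Fin n → ℕ)
    (i j : Fin n) :
    MvPolynomial.eval (limitVars q σ s) (quadPoly ![x, y, x, y] i j) =
      if σ i then -(x * ((q : ℂ) ^ s j * (√q : ℝ) - x * ((q : ℂ) ^ s i * (√q : ℝ))) *
        ((q : ℂ) ^ s i * (√q : ℝ) - y * ((q : ℂ) ^ s j * (√q : ℝ))))
      else -(y * ((q : ℂ) ^ s i * (√q : ℝ) - x * ((q : ℂ) ^ s j * (√q : ℝ))) *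
        ((q : ℂ) ^ s j * (√q : ℝ) - y * ((q : ℂ) ^ s i * (√q : ℝ)))) := by
  rw [eval_quadPoly, ← quadForm_limit _ _ _ _ (σ i) (σ j)]
  rfl

/-- The value of the interaction at the limits of the scaled variables, Case I. -/
lemma eval_interactionPoly_caseI (hq₀ : 0 < q) (ht₀ : t ≠ 0) (n₀ n₁ : ℕ) {k : ℕ}
    (ht : t ^ 2 = q ^ k) (s : Fin (n₀ + n₁) → ℕ) :
    MvPolynomial.eval (limitVars q (fun i => !decide (n₀ ≤ (i : ℕ))) s) (interactionPoly n₀ n₁ q t k) =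
      ((-1) ^ k * (q : ℂ) ^ (k * (k + 1) / 2)) ^ (n₀ + n₁).choose 2 *
      (∏ i, (((q : ℂ) ^ s i) ^ k) ^ (n₀ + n₁ - 1)) * ((t : ℂ) ^ 2 * q) ^ n₁.choose 2 *
      ((∏ i, ∏ j ∈ Finset.Ioi i,
        qFin q ((q : ℂ) ^ ((s i : ℤ) - s j)) k * qFin q ((q : ℂ) ^ (-(s i : ℤ) + s j + 1)) k) *
      ∏ i ∈ lastIdx n₀ n₁, ∏ j ∈ Finset.Ioi i,
        (((t : ℂ) ^ 2)⁻¹ * (q : ℂ) ^ s i - (q : ℂ) ^ s j) *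
          ((q : ℂ) ^ s i - ((t : ℂ) ^ 2)⁻¹ * (q : ℂ) ^ s j)) := by
  have hq := ofReal_ne_zero_of_pos hq₀
  have htt : (t : ℂ) ^ 2 = (q : ℂ) ^ k := by exact_mod_cast ht
  have ht2 : (t : ℂ) ^ 2 ≠ 0 := pow_ne_zero _ (by exact_mod_cast ht₀)
  have hz1 (i j : Fin (n₀ + n₁)) : (q : ℂ) ^ ((s i : ℤ) - s j) = (q : ℂ) ^ s i / (q : ℂ) ^ s j := by
    simp only [zpow_sub₀ hq, zpow_natCast]
  have hz2 (i j : Fin (n₀ + n₁)) : (q : ℂ) ^ (-(s i : ℤ) + s j + 1) = (q : ℂ) ^ s j / (q : ℂ) ^ s i * q := by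
    simp only [zpow_add₀ hq, zpow_neg, zpow_natCast, zpow_one]
    ring
  rw [← prod_Ioi_const, ← prod_Ioi_const, ← prod_Ioi_mul,
    ← prod_lastIdx_Ioi n₀ n₁ fun _ _ => ((t : ℂ) ^ 2 * q)]
  rw [← Finset.prod_mul_distrib, mul_mul_mul_comm, ← Finset.prod_mul_distrib,
    ← Finset.prod_mul_distrib]
  simp only [← Finset.prod_mul_distrib]
  rw [prod_mul_prod_lastIdx, interactionPoly, map_mul, map_prod, map_prod]
  simp only [map_prod]
  rw [prod_mul_prod_lastIdx]
  refine Finset.prod_congr rfl fun i _ => Finset.prod_congr rfl fun j _ => ?_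
  simp only [weightCoeff, chiCoeff, eval_quadPoly_limitVars, hz1, hz2]
  have hwi : (q : ℂ) ^ s i ≠ 0 := pow_ne_zero _ hq
  have hwj : (q : ℂ) ^ s j ≠ 0 := pow_ne_zero _ hq
  have hT := prod_weightCoeff_true hq₀ k hwi hwj
  have hF := prod_weightCoeff_false hq₀ k hwi hwj
  have hsw := sub_mul_qFin_mul_qFin q k hwi hwj
  have hκ2 := ofReal_sqrt_sq hq₀
  rw [← htt] at hF hsw
  generalize (q : ℂ) ^ s i = w at *
  generalize (q : ℂ) ^ s j = w' at *
  generalize qFin q (w / w') k * qFin q (w' / w * q) k = A at *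
  generalize qFin q (w / w' * q) k * qFin q (w' / w) k = B at *
  generalize (-1 : ℂ) ^ k * (q : ℂ) ^ (k * (k + 1) / 2) = c at *
  generalize (t : ℂ) ^ 2 = Q at *
  -- For `i > n₀` the surviving residue is at the small pole, which yields the opposite pair of
  -- factorials. The factor `w - t² w'` from `χ₁ χ₁†` allows the exchange and becomes `t² w - w'`.
  by_cases hi : n₀ ≤ (i : ℕ)
  · simp only [hi, decide_true, Bool.not_true, Bool.false_eq_true, if_true, if_false, hF]
    rw [← hκ2]
    field_simp
    linear_combination c * (√q : ℝ) ^ 2 * (w - Q * w') * hsw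
  · simp only [hi, decide_false, Bool.not_false, if_true, if_false, hT]

/-- The value of the interaction at the limits of the scaled variables, Case II. -/
lemma eval_interactionPoly_caseII (hq₀ : 0 < q) (ht₀ : t ≠ 0) (n₀ n₁ : ℕ) {k : ℕ}
    (ht : t ^ 2 = q ^ k) (s : Fin (n₀ + n₁) → ℕ) :
    MvPolynomial.eval (limitVars q (fun i => decide (n₀ ≤ (i : ℕ))) s) (interactionPoly n₀ n₁ q t k) =
      ((-1) ^ k * (q : ℂ) ^ (k * (k + 1) / 2) * (t : ℂ) ^ 2) ^ (n₀ + n₁).choose 2 *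
      (∏ i, (((q : ℂ) ^ s i) ^ k) ^ (n₀ + n₁ - 1)) * (((t : ℂ) ^ 2)⁻¹ * q) ^ n₁.choose 2 *
      ((∏ i, ∏ j ∈ Finset.Ioi i,
        qFin q ((q : ℂ) ^ ((s i : ℤ) - s j + 1)) k * qFin q ((q : ℂ) ^ (-(s i : ℤ) + s j)) k) *
      ∏ i ∈ lastIdx n₀ n₁, ∏ j ∈ Finset.Ioi i,
        ((t : ℂ) ^ 2 * (q : ℂ) ^ s i - (q : ℂ) ^ s j) *
          ((q : ℂ) ^ s i - (t : ℂ) ^ 2 * (q : ℂ) ^ s j)) := by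
  have hq := ofReal_ne_zero_of_pos hq₀
  have htt : (t : ℂ) ^ 2 = (q : ℂ) ^ k := by exact_mod_cast ht
  have ht2 : (t : ℂ) ^ 2 ≠ 0 := pow_ne_zero _ (by exact_mod_cast ht₀)
  have hz1 (i j : Fin (n₀ + n₁)) : (q : ℂ) ^ ((s i : ℤ) - s j + 1) = (q : ℂ) ^ s i / (q : ℂ) ^ s j * q := by
    simp only [zpow_add₀ hq, zpow_sub₀ hq, zpow_natCast, zpow_one]
  have hz2 (i j : Fin (n₀ + n₁)) : (q : ℂ) ^ (-(s i : ℤ) + s j) = (q : ℂ) ^ s j / (q : ℂ) ^ s i := by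
    simp only [zpow_add₀ hq, zpow_neg, zpow_natCast]
    ring
  rw [← prod_Ioi_const, ← prod_Ioi_const, ← prod_Ioi_mul,
    ← prod_lastIdx_Ioi n₀ n₁ fun _ _ => (((t : ℂ) ^ 2)⁻¹ * q)]
  rw [← Finset.prod_mul_distrib, mul_mul_mul_comm, ← Finset.prod_mul_distrib,
    ← Finset.prod_mul_distrib]
  simp only [← Finset.prod_mul_distrib]
  rw [prod_mul_prod_lastIdx, interactionPoly, map_mul, map_prod, map_prod]
  simp only [map_prod]
  rw [prod_mul_prod_lastIdx]
  refine Finset.prod_congr rfl fun i _ => Finset.prod_congr rfl fun j _ => ?_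
  simp only [weightCoeff, chiCoeff, eval_quadPoly_limitVars, hz1, hz2]
  have hwi : (q : ℂ) ^ s i ≠ 0 := pow_ne_zero _ hq
  have hwj : (q : ℂ) ^ s j ≠ 0 := pow_ne_zero _ hq
  have hT := prod_weightCoeff_true hq₀ k hwi hwj
  have hF := prod_weightCoeff_false hq₀ k hwi hwj
  have hsw := sub_mul_qFin_mul_qFin q k hwi hwj
  have hκ2 := ofReal_sqrt_sq hq₀
  rw [← htt] at hF hsw
  generalize (q : ℂ) ^ s i = w at *
  generalize (q : ℂ) ^ s j = w' at *
  generalize qFin q (w / w') k * qFin q (w' / w * q) k = A at *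
  generalize qFin q (w / w' * q) k * qFin q (w' / w) k = B at *
  generalize (-1 : ℂ) ^ k * (q : ℂ) ^ (k * (k + 1) / 2) = c at *
  generalize (t : ℂ) ^ 2 = Q at *
  -- Here the exchange goes the other way: `t² w - w'` becomes `w - t² w'`. The pairs with `i ≤ n₀`
  -- already have the desired factorials and carry the factor `q^k = t²`.
  by_cases hi : n₀ ≤ (i : ℕ)
  · simp only [hi, decide_true, if_true, hT]
    rw [← hκ2]
    field_simp
    linear_combination -(c * (√q : ℝ) ^ 2 * (Q * w - w') * hsw)
  · simp only [hi, decide_false, Bool.false_eq_true, if_false, hF]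
    ring

lemma prod_weightFun_zero_mul (h : Admissible q a b ε₀) {n : ℕ} (k : ℕ) (L : Fin n → ℕ → ℂ)
    (s : Fin n → ℕ) :
    (∏ i, weightFun q a b (s i) 0 * L i (s i)) * ∏ i, (((q : ℂ) ^ s i) ^ k) ^ (n - 1) =
      (qInf q q ^ (2 * n))⁻¹ * (∏ i, a ^ s i * (q : ℂ) ^ (((n - 1) * k + 1) * s i) *
        (qInf q ((q : ℂ) ^ (s i + 1)) / qInf q (b * (q : ℂ) ^ (s i + 1)))) * ∏ i, L i (s i) := by
  have e : (qInf q q ^ (2 * n))⁻¹ = ∏ _i : Fin n, (qInf q q ^ 2)⁻¹ := by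
    rw [Finset.prod_const, Finset.card_univ, Fintype.card_fin, pow_mul, inv_pow]
  rw [e, ← Finset.prod_mul_distrib, ← Finset.prod_mul_distrib, ← Finset.prod_mul_distrib]
  refine Finset.prod_congr rfl fun i _ => ?_
  rw [weightFun_zero h]
  have e1 : (q : ℂ) ^ (((n - 1) * k + 1) * s i) = (((q : ℂ) ^ s i) ^ k) ^ (n - 1) * (q : ℂ) ^ s i := by
    ring
  rw [e1]
  ring

/-- The limits in Case I of the one-variable numerators. -/
noncomputable def numerLimitI (n₀ : ℕ) {n : ℕ} (q : ℝ) (b : ℂ) (i : Fin n) (s : ℕ) : ℂ :=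
  if n₀ ≤ (i : ℕ) then (q : ℂ) ^ s * b⁻¹ * (1 - b * (q : ℂ) ^ (s + 1)) else 1

/-- The limits in Case II of the one-variable numerators. -/
noncomputable def numerLimitII (n₀ : ℕ) {n : ℕ} (q : ℝ) (i : Fin n) (s : ℕ) : ℂ :=
  if n₀ ≤ (i : ℕ) then (q : ℂ) ^ (s + 2) * (1 - (q : ℂ) ^ s) else q

lemma limit_eq_constI_mul_termI (h : Admissible q a b ε₀) (ht₀ : t ≠ 0) (n₀ n₁ : ℕ) {k : ℕ}
    (ht : t ^ 2 = q ^ k) (s : Fin (n₀ + n₁) → ℕ) :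
    (∏ i, weightFun q a b (s i) 0 * numerLimitI n₀ q b i (s i)) *
      MvPolynomial.eval (limitVars q (fun i => !decide (n₀ ≤ (i : ℕ))) s)
        (interactionPoly n₀ n₁ q t k) = constI n₀ n₁ q t k b * termI n₀ n₁ q t k a b s := by
  have h1 := prod_weightFun_zero_mul h k (numerLimitI n₀ q b) s
  have h2 : ∏ i : Fin (n₀ + n₁), numerLimitI n₀ q b i (s i) =
      (b ^ n₁)⁻¹ * ∏ i ∈ lastIdx n₀ n₁, (q : ℂ) ^ s i * (1 - b * (q : ℂ) ^ (s i + 1)) := by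
    have e : (b ^ n₁)⁻¹ = ∏ i ∈ lastIdx n₀ n₁, b⁻¹ := by
      rw [prod_lastIdx, Finset.prod_const, Finset.card_univ, Fintype.card_fin, inv_pow]
    rw [e, ← Finset.prod_mul_distrib, ← prod_ite_lastIdx]
    refine Finset.prod_congr rfl fun i _ => ?_
    rw [numerLimitI]
    split_ifs <;> ring
  have h3 : ((-1 : ℂ) ^ k * (q : ℂ) ^ (k * (k + 1) / 2)) ^ (n₀ + n₁).choose 2 *
      ((t : ℂ) ^ 2 * q) ^ n₁.choose 2 * (qInf q q ^ (2 * (n₀ + n₁)))⁻¹ * (b ^ n₁)⁻¹ =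
      constI n₀ n₁ q t k b := by
    rw [constI, mul_pow _ (q : ℂ), sq_pow_choose_two]
    ring
  rw [eval_interactionPoly_caseI h.q_pos ht₀ n₀ n₁ ht, ← h3, termI]
  rw [h2] at h1
  linear_combination ((-1 : ℂ) ^ k * (q : ℂ) ^ (k * (k + 1) / 2)) ^ (n₀ + n₁).choose 2 *
    ((t : ℂ) ^ 2 * q) ^ n₁.choose 2 * ((∏ i, ∏ j ∈ Finset.Ioi i,
        qFin q ((q : ℂ) ^ ((s i : ℤ) - s j)) k * qFin q ((q : ℂ) ^ (-(s i : ℤ) + s j + 1)) k) *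
      ∏ i ∈ lastIdx n₀ n₁, ∏ j ∈ Finset.Ioi i,
        (((t : ℂ) ^ 2)⁻¹ * (q : ℂ) ^ s i - (q : ℂ) ^ s j) *
          ((q : ℂ) ^ s i - ((t : ℂ) ^ 2)⁻¹ * (q : ℂ) ^ s j)) * h1

/-- Separates the ordered pairs inside the two blocks from the mixed ones. In Case II the last
summand of the exponent of `t` cancels against `t^{-n₁(n₁-1)}`. -/
lemma add_mul_add_sub_one (m n : ℕ) :
    (m + n) * (m + n - 1) = m * (m - 1) + 2 * m * n + n * (n - 1) := by
  rcases m with _ | m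
  · simp
  rcases n with _ | n
  · simp
  simp only [Nat.add_sub_cancel, ← add_assoc]
  ring

lemma limit_eq_constII_mul_termII (h : Admissible q a b ε₀) (ht₀ : t ≠ 0) (n₀ n₁ : ℕ) {k : ℕ}
    (ht : t ^ 2 = q ^ k) (s : Fin (n₀ + n₁) → ℕ) :
    (∏ i, weightFun q a b (s i) 0 * numerLimitII n₀ q i (s i)) *
      MvPolynomial.eval (limitVars q (fun i => decide (n₀ ≤ (i : ℕ))) s)
        (interactionPoly n₀ n₁ q t k) = constII n₀ n₁ q t k * termII n₀ n₁ q t k a b s := by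
  have htC : (t : ℂ) ≠ 0 := by exact_mod_cast ht₀
  have h1 := prod_weightFun_zero_mul h k (numerLimitII n₀ q) s
  have h2 : ∏ i : Fin (n₀ + n₁), numerLimitII n₀ q i (s i) =
      (q : ℂ) ^ (n₀ + n₁ + n₁) * ∏ i ∈ lastIdx n₀ n₁, (q : ℂ) ^ s i * (1 - (q : ℂ) ^ s i) := by
    have e : (q : ℂ) ^ n₁ = ∏ i ∈ lastIdx n₀ n₁, (q : ℂ) := by
      rw [prod_lastIdx, Finset.prod_const, Finset.card_univ, Fintype.card_fin]
    have e' : (q : ℂ) ^ (n₀ + n₁) = ∏ i : Fin (n₀ + n₁), (q : ℂ) := by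
      rw [Finset.prod_const, Finset.card_univ, Fintype.card_fin]
    rw [pow_add, mul_assoc, e, ← Finset.prod_mul_distrib, ← prod_ite_lastIdx, e',
      ← Finset.prod_mul_distrib]
    refine Finset.prod_congr rfl fun i _ => ?_
    rw [numerLimitII]
    split_ifs <;> ring
  have h3 : ((-1 : ℂ) ^ k * (q : ℂ) ^ (k * (k + 1) / 2) * (t : ℂ) ^ 2) ^ (n₀ + n₁).choose 2 *
      (((t : ℂ) ^ 2)⁻¹ * q) ^ n₁.choose 2 * (qInf q q ^ (2 * (n₀ + n₁)))⁻¹ *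
      (q : ℂ) ^ (n₀ + n₁ + n₁) = constII n₀ n₁ q t k := by
    have e1 : n₁ * (n₁ + 1) / 2 = n₁ + n₁.choose 2 := by
      have := Nat.choose_succ_succ' n₁ 1
      rw [Nat.choose_one_right, Nat.choose_two_right, Nat.add_sub_cancel] at this
      rw [mul_comm, this]
    rw [constII, e1, mul_pow _ (q : ℂ), mul_pow _ ((t : ℂ) ^ 2), inv_pow, sq_pow_choose_two,
      sq_pow_choose_two, add_mul_add_sub_one, pow_add (t : ℂ) (_ + _)]
    field_simp
    ring
  rw [eval_interactionPoly_caseII h.q_pos ht₀ n₀ n₁ ht, ← h3, termII]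
  rw [h2] at h1
  linear_combination ((-1 : ℂ) ^ k * (q : ℂ) ^ (k * (k + 1) / 2) * (t : ℂ) ^ 2) ^
    (n₀ + n₁).choose 2 * (((t : ℂ) ^ 2)⁻¹ * q) ^ n₁.choose 2 * ((∏ i, ∏ j ∈ Finset.Ioi i,
        qFin q ((q : ℂ) ^ ((s i : ℤ) - s j + 1)) k * qFin q ((q : ℂ) ^ (-(s i : ℤ) + s j)) k) *
      ∏ i ∈ lastIdx n₀ n₁, ∏ j ∈ Finset.Ioi i,
        ((t : ℂ) ^ 2 * (q : ℂ) ^ s i - (q : ℂ) ^ s j) *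
          ((q : ℂ) ^ s i - (t : ℂ) ^ 2 * (q : ℂ) ^ s j)) * h1

end Terms

/-! ### Assembly of the two cases -/

section Limits

variable {q t : ℝ} {a b ε₀ : ℂ}

/-- The limit of the scaled integrals for a family of parameters whose weight decomposes into
one-variable weights with tame numerators. -/
theorem tendsto_contourIntegral (h : Admissible q a b ε₀) (hgen : Generic q a b ε₀)
    {γ : ℕ → ℝ → ℂ} (hγ : ∀ r, IsDeformedContour q a b (epsSeq q ε₀ r) (γ r)) {n₀ n₁ k : ℕ}
    (ht : t ^ 2 = q ^ k) {p : ℕ → Fin 4 → ℂ}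
    (hp : ∀ r x, ∏ i, (qInf q (p r i * x) * qInf q (p r i * x⁻¹)) =
      poleDenom q a b (epsSeq q ε₀ r) x *
        (qInf q (-((√q : ℝ) * x)) * qInf q (-((√q : ℝ) * x⁻¹))))
    {σ : Fin (n₀ + n₁) → Bool} {L : Fin (n₀ + n₁) → ℕ → ℂ}
    {N : Fin (n₀ + n₁) → ℕ → ℂ → ℂ} {E : Fin (n₀ + n₁) → ℕ}
    (htame : ∀ i, TameNumerator q a b ε₀ (σ i) (L i) (N i))
    (hN : ∀ r i, ∀ x ≠ 0, N i r x = epsSeq q ε₀ r ^ E i *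
      (((1 - p r 2 * x⁻¹) * (1 - p r 3 * x⁻¹)) *
        if n₀ ≤ (i : ℕ) then ((1 - (p r 2)⁻¹ * x⁻¹) * (1 - (p r 3)⁻¹ * x⁻¹)) *
          ((1 - p r 2 * x) * (1 - p r 3 * x)) else 1))
    {c : ℂ} (hc : c ≠ 0) {term : (Fin (n₀ + n₁) → ℕ) → ℂ}
    (hterm : ∀ s, (∏ i, weightFun q a b (s i) 0 * L i (s i)) *
      MvPolynomial.eval (limitVars q σ s) (interactionPoly n₀ n₁ q t k) = c * term s)
    {D : ℕ} (hD : D = (n₀ + n₁) * (n₀ + n₁ - 1) * k + n₁ * (n₁ - 1) + ∑ i, E i) :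
    (∀ r, IntegrableOn (pullback (γ r) (integrand n₀ n₁ q t (p r))) (Icc 0 1)) ∧
      (Summable fun s => ‖term s‖) ∧
      Tendsto (fun r => prefactor q a (epsSeq q ε₀ r) ^ (n₀ + n₁) * epsSeq q ε₀ r ^ D *
        ((1 / (2 * (Real.pi : ℂ) * Complex.I) ^ (n₀ + n₁)) *
          contourIntegral (γ r) (integrand n₀ n₁ q t (p r)))) atTop (𝓝 (c * ∑' s, term s)) := by
  obtain ⟨hint, hsum, hlim⟩ := tendsto_prefactor_pow_mul_integral h hgen hγ htame
    (interactionPoly n₀ n₁ q t k)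
  have hae (r) : ∀ᵐ u ∂(volume : Measure (Fin (n₀ + n₁) → ℝ)).restrict (Icc 0 1),
      epsSeq q ε₀ r ^ D * pullback (γ r) (integrand n₀ n₁ q t (p r)) u =
        (∏ i, oneVarIntegrand q a b (epsSeq q ε₀ r) (N i r) (γ r (u i)) * deriv (γ r) (u i)) *
          MvPolynomial.eval (scaledVars (epsSeq q ε₀ r) fun i => γ r (u i))
            (interactionPoly n₀ n₁ q t k) := by
    filter_upwards [(hγ r).curve.ae_offWalls h.q_pos (n₀ + n₁),
      ae_restrict_mem measurableSet_Icc] with u hu hu'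
    rw [Finset.prod_mul_distrib, pullback]
    -- If some derivative vanishes, both sides are zero whatever the integrand is; otherwise the
    -- point is off the walls.
    by_cases hd : ∀ i, deriv (γ r) (u i) ≠ 0
    · have hx (i) : γ r (u i) ≠ 0 := (hγ r).origin.1 _ ⟨hu'.1 i, hu'.2 i⟩
      have := pow_mul_integrand_eq h.q_pos h.q_lt ht n₀ n₁ (hp r) (fun i => hN r i) hx (hu hd)
      rw [← hD] at this
      linear_combination (∏ i, deriv (γ r) (u i)) * this
    · push Not at hd
      obtain ⟨i, hi⟩ := hd
      rw [Finset.prod_eq_zero (Finset.mem_univ i) hi]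
      ring
  have hε (r) : epsSeq q ε₀ r ^ D ≠ 0 := pow_ne_zero _ (h.epsSeq_ne r)
  refine ⟨fun r => ?_, ?_, ?_⟩
  · refine ((hint r).const_mul (epsSeq q ε₀ r ^ D)⁻¹).congr ?_
    filter_upwards [hae r] with u hu
    rw [← hu, inv_mul_cancel_left₀ (hε r)]
  · simp only [hterm, norm_mul] at hsum
    exact (summable_mul_left_iff (norm_ne_zero_iff.2 hc)).1 hsum
  · simp only [hterm, tsum_mul_left] at hlim
    refine hlim.congr fun r => ?_
    rw [← integral_congr_ae (hae r), integral_const_mul, contourIntegral]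
    ring

/-- The two cases differ by the exchange of `a₁` and `a₃` only, so they share the denominator of
`Δ₊`. -/
lemma prod_paramI (q : ℝ) (a b ε x : ℂ) :
    ∏ i, (qInf q (paramI q a b ε i * x) * qInf q (paramI q a b ε i * x⁻¹)) =
      poleDenom q a b ε x * (qInf q (-((√q : ℝ) * x)) * qInf q (-((√q : ℝ) * x⁻¹))) := by
  simp [Fin.prod_univ_succ, paramI, poleDenom, poleBase]
  ring

lemma prod_paramII (q : ℝ) (a b ε x : ℂ) :
    ∏ i, (qInf q (paramII q a b ε i * x) * qInf q (paramII q a b ε i * x⁻¹)) =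
      poleDenom q a b ε x * (qInf q (-((√q : ℝ) * x)) * qInf q (-((√q : ℝ) * x⁻¹))) := by
  simp [Fin.prod_univ_succ, paramII, poleDenom, poleBase]
  ring

lemma numerI_eq (hq₀ : 0 < q) (hb : b ≠ 0) {ε x : ℂ} (hε : ε ≠ 0) (hx : x ≠ 0) (c : Prop)
    [Decidable c] : numerI q b (decide c) (ε, x, x⁻¹) = ε ^ (if c then 2 else 0) *
      (((1 - paramI q a b ε 2 * x⁻¹) * (1 - paramI q a b ε 3 * x⁻¹)) *
        if c then ((1 - (paramI q a b ε 2)⁻¹ * x⁻¹) * (1 - (paramI q a b ε 3)⁻¹ * x⁻¹)) *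
          ((1 - paramI q a b ε 2 * x) * (1 - paramI q a b ε 3 * x)) else 1) := by
  have hκ := ofReal_sqrt_ne_zero hq₀
  by_cases hc : c
  · simp only [numerI, paramI, hc, decide_true, if_true, Matrix.cons_val]
    field_simp
    ring
  · simp only [numerI, paramI, hc, decide_false, Bool.false_eq_true, if_false, Matrix.cons_val]
    ring

lemma numerII_eq (hq₀ : 0 < q) {ε x : ℂ} (hε : ε ≠ 0) (hx : x ≠ 0) (c : Prop)
    [Decidable c] : numerII q (decide c) (ε, x, x⁻¹) = ε ^ (if c then 3 else 1) *
      (((1 - paramII q a b ε 2 * x⁻¹) * (1 - paramII q a b ε 3 * x⁻¹)) *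
        if c then ((1 - (paramII q a b ε 2)⁻¹ * x⁻¹) * (1 - (paramII q a b ε 3)⁻¹ * x⁻¹)) *
          ((1 - paramII q a b ε 2 * x) * (1 - paramII q a b ε 3 * x)) else 1) := by
  have hκ := ofReal_sqrt_ne_zero hq₀
  by_cases hc : c
  · simp only [numerII, paramII, hc, decide_true, if_true, Matrix.cons_val]
    field_simp
    ring
  · simp only [numerII, paramII, hc, decide_false, Bool.false_eq_true, if_false, Matrix.cons_val]
    field_simp
    ring

lemma tameNumerator_numerI (h : Admissible q a b ε₀) (n₀ : ℕ) {n : ℕ} (i : Fin n) :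
    TameNumerator q a b ε₀ (!decide (n₀ ≤ (i : ℕ))) (numerLimitI n₀ q b i)
      fun r x => numerI q b (decide (n₀ ≤ (i : ℕ))) (epsSeq q ε₀ r, x, x⁻¹) := by
  by_cases hi : n₀ ≤ (i : ℕ)
  · have e : numerLimitI n₀ q b i = _ := funext fun s => if_pos hi
    simpa [hi, e] using tameNumerator_numerI_true h
  · have e : numerLimitI n₀ q b i = _ := funext fun s => if_neg hi
    simpa [hi, e] using tameNumerator_numerI_false h

lemma tameNumerator_numerII (h : Admissible q a b ε₀) (n₀ : ℕ) {n : ℕ} (i : Fin n) :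
    TameNumerator q a b ε₀ (decide (n₀ ≤ (i : ℕ))) (numerLimitII n₀ q i)
      fun r x => numerII q (decide (n₀ ≤ (i : ℕ))) (epsSeq q ε₀ r, x, x⁻¹) := by
  by_cases hi : n₀ ≤ (i : ℕ)
  · have e : numerLimitII n₀ q i = _ := funext fun s => if_pos hi
    simpa [hi, e] using tameNumerator_numerII_true h
  · have e : numerLimitII n₀ q i = _ := funext fun s => if_neg hi
    simpa [hi, e] using tameNumerator_numerII_false h

lemma sum_ite_le (n₀ n₁ c d : ℕ) :
    ∑ i : Fin (n₀ + n₁), (if n₀ ≤ (i : ℕ) then c + d else d) = n₁ * c + (n₀ + n₁) * d := by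
  rw [Fin.sum_univ_add]
  simp [fun i : Fin n₀ => not_le.2 i.isLt]
  ring

lemma qInf_self_ne_zero (hq₀ : 0 < q) (hq₁ : q < 1) : qInf q q ≠ 0 :=
  qInf_ne_zero_of_norm_lt_one hq₀ hq₁ (by rwa [norm_ofReal_of_pos hq₀])

lemma constI_ne_zero (hq₀ : 0 < q) (hq₁ : q < 1) (ht₀ : t ≠ 0) (hb : b ≠ 0) (n₀ n₁ k : ℕ) :
    constI n₀ n₁ q t k b ≠ 0 := by
  have := ofReal_ne_zero_of_pos hq₀
  have := qInf_self_ne_zero hq₀ hq₁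
  simp [constI, *]

lemma constII_ne_zero (hq₀ : 0 < q) (hq₁ : q < 1) (ht₀ : t ≠ 0) (n₀ n₁ k : ℕ) :
    constII n₀ n₁ q t k ≠ 0 := by
  have := ofReal_ne_zero_of_pos hq₀
  have := qInf_self_ne_zero hq₀ hq₁
  simp [constII, *]

end Limits

end KoornwinderLimit

open KoornwinderLimit
theorem theorem5p4 (n₀ n₁ : ℕ) (hn₁ : 2 ≤ n₁) (q t : ℝ) (hq₀ : 0 < q) (hq₁ : q < 1)
    (ht₀ : 0 < t) (k : ℕ) (ht : t ^ 2 = q ^ k)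
    (a b : ℂ) (ha₀ : 0 < ‖a‖) (ha₁ : ‖a‖ < 1) (hb₀ : 0 < ‖b‖) (hb₁ : ‖b‖ < 1)
    (ε₀ : ℂ) (hε₀ : √q < ‖ε₀‖) (hε₁ : ‖ε₀‖ < (√q)⁻¹) (hgen : Generic q a b ε₀)
    (γ : ℕ → ℝ → ℂ) (hγ : ∀ r, IsDeformedContour q a b (epsSeq q ε₀ r) (γ r)) :
    -- Case I
    ((∀ r, MeasureTheory.IntegrableOn
        (pullback (γ r) (integrand n₀ n₁ q t (paramI q a b (epsSeq q ε₀ r))))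
        (Set.Icc 0 1)) ∧
      (Summable fun s : Fin (n₀ + n₁) → ℕ => ‖termI n₀ n₁ q t k a b s‖) ∧
      Filter.Tendsto
        (fun r : ℕ =>
          (qInf q (-(epsSeq q ε₀ r)⁻¹ * q) * qInf q (-(epsSeq q ε₀ r)⁻¹ * a * q)) ^ (n₀ + n₁) *
          epsSeq q ε₀ r ^ ((n₀ + n₁) * (n₀ + n₁ - 1) * k + n₁ * (n₁ + 1)) *
          ((1 / (2 * (Real.pi : ℂ) * Complex.I) ^ (n₀ + n₁)) *
            contourIntegral (γ r) (integrand n₀ n₁ q t (paramI q a b (epsSeq q ε₀ r)))))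
        Filter.atTop
        (nhds (constI n₀ n₁ q t k b * ∑' s, termI n₀ n₁ q t k a b s))) ∧
    -- Case II
    ((∀ r, MeasureTheory.IntegrableOn
        (pullback (γ r) (integrand n₀ n₁ q t (paramII q a b (epsSeq q ε₀ r))))
        (Set.Icc 0 1)) ∧
      (Summable fun s : Fin (n₀ + n₁) → ℕ => ‖termII n₀ n₁ q t k a b s‖) ∧
      Filter.Tendsto
        (fun r : ℕ =>
          (qInf q (-(epsSeq q ε₀ r)⁻¹ * q) * qInf q (-(epsSeq q ε₀ r)⁻¹ * a * q)) ^ (n₀ + n₁) *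
          epsSeq q ε₀ r ^
            ((n₀ + n₁) * (n₀ + n₁ - 1) * k + n₁ * (n₁ + 1) + (n₀ + n₁)) *
          ((1 / (2 * (Real.pi : ℂ) * Complex.I) ^ (n₀ + n₁)) *
            contourIntegral (γ r) (integrand n₀ n₁ q t (paramII q a b (epsSeq q ε₀ r)))))
        Filter.atTop
        (nhds (constII n₀ n₁ q t k * ∑' s, termII n₀ n₁ q t k a b s))) := by
  have hs : 0 < √q := Real.sqrt_pos.2 hq₀
  have h : Admissible q a b ε₀ :=
    ⟨hq₀, hq₁, norm_pos_iff.1 ha₀, ha₁, norm_pos_iff.1 hb₀, hb₁, hε₀,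
      by simpa [hs.ne'] using mul_lt_mul_of_pos_right hε₁ hs⟩
  -- The exponent of `ε` splits into two for each pair of the last `n₁` indices and two for each
  -- such index; Case II has one more for each of the `n` indices.
  have hsq : n₁ * (n₁ + 1) = n₁ * (n₁ - 1) + n₁ * 2 := by
    obtain ⟨m, rfl⟩ : ∃ m, n₁ = m + 1 := ⟨n₁ - 1, by omega⟩
    rw [Nat.add_sub_cancel]
    ring
  refine ⟨tendsto_contourIntegral h hgen hγ ht (fun r x => prod_paramI q a b _ x)
    (fun i => tameNumerator_numerI h n₀ i) (fun r i x hx => numerI_eq hq₀ h.b_ne (h.epsSeq_ne r) hx _)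
    (constI_ne_zero hq₀ hq₁ ht₀.ne' h.b_ne n₀ n₁ k)
    (limit_eq_constI_mul_termI h ht₀.ne' n₀ n₁ ht) ?_,
    tendsto_contourIntegral h hgen hγ ht (fun r x => prod_paramII q a b _ x)
    (fun i => tameNumerator_numerII h n₀ i) (fun r i x hx => numerII_eq hq₀ (h.epsSeq_ne r) hx _)
    (constII_ne_zero hq₀ hq₁ ht₀.ne' n₀ n₁ k)
    (limit_eq_constII_mul_termII h ht₀.ne' n₀ n₁ ht) ?_⟩
  · rw [hsq, sum_ite_le n₀ n₁ 2 0]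
    ring
  · rw [hsq, sum_ite_le n₀ n₁ 2 1]
    ring
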